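/- Let $\mathcal H$ be a separable complex Hilbert space with norm $|\cdot|$. For $T>0$ put $I=(0,T)$. For an operator $H$ on $\mathcal H$ with domain $D(H)$, for $u,f\in L^2(I,\mathcal H)$ and for bounded operators $B(t)$, $t\in\overline I$, strongly continuous in $t$, say that $(i\partial_t-H-B(t))u=f$ holds weakly if $$\big(u\,\big|\,(i\partial_t-H-B(t))\varphi\big)_{L^2(I,\mathcal H)}=(f\,|\,\varphi)_{L^2(I,\mathcal H)}\qquad\text{for all }\varphi\in C^0_c(I,D(H))\cap C^1_c(I,\mathcal H),$$ where $D(H)$ carries the graph norm; say that $u(0)=u_0$ if $u$ has a representative that is continuous on $\overline I$ and equals $u_0$ at $0$. Let $\mathcal X_H$ be the space of all $u\in L^2(I,\mathcal H)$ for which there are $u_0\in\mathcal H$ and $f\in L^2(I,\mathcal H)$ such that $(i\partial_t-H)u=f$ weakly and $u(0)=u_0$, with $$\|u\|_{\mathcal X_H}=\Big(|u(0)|^2+T\,\|(i\partial_t-H)u\|_{L^2(I,\mathcal H)}^2\Big)^{1/2}.$$ Theorem. Let $H_0$ be a self-adjoint operator on $\mathcal H$, and let $A$ be a closed symmetric operator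 on $\mathcal H$ with $D(H_0)\subset D(A)$. Assume that for some $\varepsilon>0$ $$\sup_{\lambda\in\mathbb R}\|A(H_0-\lambda\pm i\varepsilon)^{-1}\|<1$$ (for both signs). Let $H=H_0+A$, with domain $D(H_0)$. (i) For every $T>0$, $\mathcal X_H=\mathcal X_{H_0}$. There are constants $\alpha,C>0$, independent of $T$, such that for all $T>0$ and all $u\in\mathcal X_{H_0}$ $$\frac{\alpha}{1+T}\|u\|_{\mathcal X_{H_0}}\le\|u\|_{\mathcal X_H}\le C(1+T)\|u\|_{\mathcal X_{H_0}}.$$ (ii) Let $T>0$ and let $(B(t))_{t\in\overline I}$ be a strongly continuous family of bounded self-adjoint operators on $\mathcal H$. For each $u\in\mathcal X_{H_0}$ there is exactly one $f\in L^2(I,\mathcal H)$ such that $(i\partial_t-H-B(t))u=f$ weakly, and $$N(u)=\Big(|u(0)|^2+T\,\|(i\partial_t-H-B(t))u\|_{L^2(I,\mathcal H)}^2\Big)^{1/2}$$ defines a norm on $\mathcal X_{H_0}$. Moreover, for every $M\ge0$ there are constants $\alpha,C>0$ (depending on $H_0$, $A$ and $M$, but not on $T$) such that for all $T>0$, all such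 families with $\sup_{t\in\overline I}\|B(t)\|\le M$ (the supremum is always finite, by the uniform boundedness principle) and all $u\in\mathcal X_{H_0}$ $$\frac{\alpha}{(1+T)^2}\|u\|_{\mathcal X_{H_0}}\le N(u)\le C(1+T)\|u\|_{\mathcal X_{H_0}}.$$ -/

import Mathlib

open MeasureTheory Set
open scoped InnerProductSpace ENNReal

noncomputable section

namespace SchrodingerSpaceTime

variable {E : Type*} [NormedAddCommGroup E] [InnerProductSpace ℂ E]

/-! ### Unbounded operators -/

/-- The resolvent `(H - z)⁻¹`, as a partially defined operator whose domain is the range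
of `H - z`. -/
def resolventOp (H : E →ₗ.[ℂ] E) (z : ℂ) : E →ₗ.[ℂ] E :=
  LinearPMap.inverse ((-(z • (LinearMap.id : E →ₗ[ℂ] E))) +ᵥ H)

/-- The product `A R` of two unbounded operators, with its natural domain
`{x ∈ D(R) | R x ∈ D(A)}`. -/
def compOp (A R : E →ₗ.[ℂ] E) : E →ₗ.[ℂ] E where
  domain := (A.domain.comap R.toFun).map R.domain.subtype
  toFun :=
    { toFun := fun x => A ⟨R ⟨x, by obtain ⟨y, -, hy⟩ := x.2; exact hy ▸ y.2⟩, by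
        obtain ⟨x, y, hy, rfl⟩ := x; exact hy⟩
      map_add' := fun x y => by
        rw [← LinearPMap.map_add]
        congr 1
        apply Subtype.ext
        exact (R.map_add ⟨x, by obtain ⟨y, -, hy⟩ := x.2; exact hy ▸ y.2⟩
          ⟨y, by obtain ⟨y, -, hy⟩ := y.2; exact hy ▸ y.2⟩)
      map_smul' := fun c x => by
        rw [RingHom.id_apply, ← LinearPMap.map_smul]
        congr 1
        apply Subtype.ext
        exact (R.map_smul c ⟨x, by obtain ⟨y, -, hy⟩ := x.2; exact hy ▸ y.2⟩) }

/-- The operator norm `sup_{x ≠ 0} |S x| / |x|`, with values in `[0, ∞]`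
(in `[0, ∞]` the quotient `0 / 0` is `0`, so that `x = 0` does not contribute). -/
def unboundedNorm (S : E →ₗ.[ℂ] E) : ℝ≥0∞ :=
  ⨆ x : S.domain, ‖S x‖ₑ / ‖(x : E)‖ₑ

/-- The assumptions (A) on the pair `H₀`, `A`. -/
structure AssumptionsA [CompleteSpace E] (H₀ A : E →ₗ.[ℂ] E) : Prop where
  /-- `H₀` is self-adjoint (in particular densely defined). -/
  selfAdjoint : IsSelfAdjoint H₀
  /-- `A` is closed. -/
  closed : A.IsClosed
  /-- `A` is symmetric (it is densely defined because its domain contains `D(H₀)`). -/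
  symmetric : A.IsFormalAdjoint A
  /-- `D(H₀) ⊆ D(A)`. -/
  domain_le : H₀.domain ≤ A.domain
  /-- `sup_λ ‖A (H₀ - λ ± i ε)⁻¹‖ < 1` for some `ε > 0`, for both signs. -/
  resolvent_bound : ∃ ε : ℝ, 0 < ε ∧
    (⨆ l : ℝ, unboundedNorm (compOp A (resolventOp H₀ (l + Complex.I * ε)))) < 1 ∧
    (⨆ l : ℝ, unboundedNorm (compOp A (resolventOp H₀ (l - Complex.I * ε)))) < 1

/-! ### Weak solutions on `I = (0, T)` -/

/-- The Bochner space `L²(I, E)`, where `I = (0, T)`. -/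
abbrev L2I (E : Type*) [NormedAddCommGroup E] [InnerProductSpace ℂ E] (T : ℝ) : Type _ :=
  Lp E 2 (volume.restrict (Ioo 0 T))

/-- Test functions: `φ ∈ C⁰_c(I, D(H)) ∩ C¹_c(I, E)`, where `D(H)` has the graph norm of `H`.
Functions with compact support in `I` are extended by zero to `ℝ`. -/
structure IsTestFunction (T : ℝ) (H : E →ₗ.[ℂ] E) (φ : ℝ → H.domain) : Prop where
  contDiff : ContDiff ℝ 1 (fun t => (φ t : E))
  continuous_apply : Continuous (fun t => H (φ t))
  hasCompactSupport : HasCompactSupport (fun t => (φ t : E))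
  tsupport_subset : tsupport (fun t => (φ t : E)) ⊆ Ioo 0 T

/-- `(i ∂ₜ - H - B(t)) u = f` holds weakly on `I = (0, T)`:
`(u | (i ∂ₜ - H - B(t)) φ) = (f | φ)` in `L²(I, E)` for all test functions `φ`. -/
def WeakEq (T : ℝ) (H : E →ₗ.[ℂ] E) (B : ℝ → E →L[ℂ] E) (u f : L2I E T) : Prop :=
  ∀ φ : ℝ → H.domain, IsTestFunction T H φ →
    ∫ t in Ioo 0 T,
        ⟪u t, Complex.I • deriv (fun s => (φ s : E)) t - H (φ t) - B t (φ t)⟫_ℂ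
      = ∫ t in Ioo 0 T, ⟪f t, (φ t : E)⟫_ℂ

/-- `u(0) = u₀` : the class `u` has a representative that is continuous on `[0, T]`
and takes the value `u₀` at `0`. -/
def HasInitialValue (T : ℝ) (u : L2I E T) (u₀ : E) : Prop :=
  ∃ v : ℝ → E, ContinuousOn v (Icc 0 T) ∧ u =ᵐ[volume.restrict (Ioo 0 T)] v ∧ v 0 = u₀

/-- `u` is a weak solution of `(i ∂ₜ - H - B(t)) u = f` on `I`, `u(0) = u₀`. -/
def IsWeakSolution (T : ℝ) (H : E →ₗ.[ℂ] E) (B : ℝ → E →L[ℂ] E) (u₀ : E)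
    (f u : L2I E T) : Prop :=
  WeakEq T H B u f ∧ HasInitialValue T u u₀

theorem integrable_inner_of_continuous {T : ℝ} (u : L2I E T) {g : ℝ → E}
    (hg : Continuous g) : IntegrableOn (fun t => ⟪u t, g t⟫_ℂ) (Ioo 0 T) := by
  have hu : IntegrableOn (fun t => u t) (Ioo 0 T) := (Lp.memLp u).integrable (by norm_num)
  obtain ⟨C, hC⟩ := isCompact_Icc.exists_bound_of_continuousOn (s := Icc 0 T) hg.continuousOn
  refine (hu.norm.mul_const C).mono'
    (hu.aestronglyMeasurable.inner hg.aestronglyMeasurable) ?_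
  filter_upwards [ae_restrict_mem measurableSet_Ioo] with t ht
  exact (norm_inner_le_norm _ _).trans
    (mul_le_mul_of_nonneg_left (hC t (Ioo_subset_Icc_self ht)) (norm_nonneg _))

theorem IsTestFunction.continuous_deriv_sub {T : ℝ} {H : E →ₗ.[ℂ] E} {φ : ℝ → H.domain}
    (hφ : IsTestFunction T H φ) :
    Continuous (fun t => Complex.I • deriv (fun s => (φ s : E)) t - H (φ t)
      - (0 : E →L[ℂ] E) (φ t)) := by
  have h1 := hφ.contDiff.continuous_deriv le_rfl
  have h2 := hφ.continuous_apply
  have h3 := (h1.const_smul Complex.I).sub h2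
  refine h3.congr fun t => ?_
  simp

/-- The space `𝒳_H` of all `u ∈ L²(I, E)` that solve `(i ∂ₜ - H) u = f`, `u(0) = u₀` weakly,
for some `u₀ ∈ E` and some `f ∈ L²(I, E)`. -/
def XX (T : ℝ) (H : E →ₗ.[ℂ] E) : Submodule ℂ (L2I E T) where
  carrier := {u | ∃ (u₀ : E) (f : L2I E T), IsWeakSolution T H (fun _ => 0) u₀ f u}
  zero_mem' := by
    refine ⟨0, 0, fun φ _ => ?_, fun _ => 0, continuousOn_const, Lp.coeFn_zero _ _ _, rfl⟩
    rw [integral_eq_zero_of_ae, integral_eq_zero_of_ae]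
    all_goals
      filter_upwards [Lp.coeFn_zero E 2 (volume.restrict (Ioo 0 T))] with t ht
      exact (congrArg (fun z => ⟪z, _⟫_ℂ) ht).trans (inner_zero_left _)
  add_mem' := by
    rintro u v ⟨u₀, f, hu, a, ha, hua, ha0⟩ ⟨v₀, g, hv, b, hb, hvb, hb0⟩
    refine ⟨u₀ + v₀, f + g, fun φ hφ => ?_, a + b, ha.add hb, ?_, by simp [ha0, hb0]⟩
    · have h1 := integral_add (integrable_inner_of_continuous u hφ.continuous_deriv_sub)
        (integrable_inner_of_continuous v hφ.continuous_deriv_sub)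
      have h2 := integral_add (integrable_inner_of_continuous f hφ.contDiff.continuous)
        (integrable_inner_of_continuous g hφ.contDiff.continuous)
      rw [hu φ hφ, hv φ hφ, ← h2] at h1
      refine Eq.trans (integral_congr_ae ?_) (h1.trans (integral_congr_ae ?_))
      · filter_upwards [Lp.coeFn_add u v] with t ht
        rw [ht, Pi.add_apply, inner_add_left]
      · filter_upwards [Lp.coeFn_add f g] with t ht
        rw [ht, Pi.add_apply, inner_add_left]
    · filter_upwards [Lp.coeFn_add u v, hua, hvb] with t h1 h2 h3
      rw [h1, Pi.add_apply, Pi.add_apply, h2, h3]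
  smul_mem' := by
    rintro c u ⟨u₀, f, hu, a, ha, hua, ha0⟩
    refine ⟨c • u₀, c • f, fun φ hφ => ?_, c • a, ha.const_smul c, ?_, by simp [ha0]⟩
    · have h1 := congrArg (fun z => (starRingEnd ℂ) c * z) (hu φ hφ)
      simp only [← integral_const_mul] at h1
      refine Eq.trans (integral_congr_ae ?_) (h1.trans (integral_congr_ae ?_))
      · filter_upwards [Lp.coeFn_smul c u] with t ht
        rw [ht, Pi.smul_apply, inner_smul_left]
      · filter_upwards [Lp.coeFn_smul c f] with t ht
        rw [ht, Pi.smul_apply, inner_smul_left]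
    · filter_upwards [Lp.coeFn_smul c u, hua] with t h1 h2
      rw [h1, Pi.smul_apply, Pi.smul_apply, h2]

open Classical in
/-- The value `u(0)` of the continuous representative of `u` (and `0` if there is none). -/
def initialValue (T : ℝ) (u : L2I E T) : E :=
  if h : ∃ u₀, HasInitialValue T u u₀ then h.choose else 0

open Classical in
/-- The element `(i ∂ₜ - H - B(t)) u` of `L²(I, E)`, in the weak sense
(and `0` if it does not exist in `L²(I, E)`). -/
def schrodingerOp (T : ℝ) (H : E →ₗ.[ℂ] E) (B : ℝ → E →L[ℂ] E) (u : L2I E T) : L2I E T :=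
  if h : ∃ f, WeakEq T H B u f then h.choose else 0

/-- `N(u) = (|u(0)|² + T ‖(i ∂ₜ - H - B(t)) u‖²)^{1/2}`, with the norm of `L²(I, E)`. -/
def energyNorm (T : ℝ) (H : E →ₗ.[ℂ] E) (B : ℝ → E →L[ℂ] E) (u : L2I E T) : ℝ :=
  Real.sqrt (‖initialValue T u‖ ^ 2 + T * ‖schrodingerOp T H B u‖ ^ 2)

/-- The norm `(|u(0)|² + T ‖(i ∂ₜ - H) u‖²)^{1/2}` of `𝒳_H`. -/
def xxNorm (T : ℝ) (H : E →ₗ.[ℂ] E) (u : L2I E T) : ℝ :=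
  energyNorm T H (fun _ => 0) u

/-- `B` is a strongly continuous family of bounded self-adjoint operators on `[0, T]`. -/
structure IsStronglyContinuousFamily [CompleteSpace E] (T : ℝ) (B : ℝ → E →L[ℂ] E) : Prop where
  continuousOn : ∀ x : E, ContinuousOn (fun t => B t x) (Icc 0 T)
  selfAdjoint : ∀ t ∈ Icc 0 T, IsSelfAdjoint (B t)

end SchrodingerSpaceTime

end

/-!
Let `u` be a weak solution of `(i∂ₜ - H) u = F` on `(0, T)`, for a self-adjoint operator `H`,
and let `A` be symmetric with `‖A x‖ ≤ c ‖(H - l - iε) x‖` for all real `l`. The theorem rests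
on two estimates: the energy inequality `sup ‖u(t)‖ ≤ ‖u(0)‖ + 2 √T ‖F‖`, in which a bounded
self-adjoint term `B(t)` does not matter (`WeakEq.norm_le`), and the smoothing estimate `‖A u‖²
≤ c² (‖F + iεu‖² + 2ε ‖u(0)‖²)` in `L²(I, E)` (`IsPerturbation.exists_apply`). By the second,
`u` is a weak solution for `H + A` as well, with the right-hand side `F - A u`
(`IsPerturbation.exists_weakEq`), and by the first `‖u‖ ≤ 3 √T ‖u‖_𝒳`, whence the bounds with
the factor `1 + T`. The hypothesis on `H₀` and `A` makes `H₀ + A` self-adjoint, by a Neumann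
series, and gives the same kind of bound for `A` relative to `H₀ + A`. So `H₀` and `H₀ + A` play
symmetric roles, with the perturbations `A` and `-A` (`AssumptionsA.exists_isPerturbation`), and
one inclusion and one inequality yield the equality of the spaces and the equivalence of the
norms.

The smoothing estimate is Plancherel's theorem in time. If `y ∈ L²(ℝ, E)` solves `(i∂ₜ - H + iε)
y = G` on the whole line, its Fourier transform satisfies `-(H - l - iε) ŷ = Ĝ` with `l = -2πξ`,
so that `‖A y‖ ≤ c ‖G‖` (`norm_compLp_le_of_uniform_bound`). A solution on `[0, T]` is extended
to the line by free evolution, damped by `exp (-ε |t - t₀|)` from the end points `t₀` on. Then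
`G` is `F + iεu` on `(0, T)`; it is `2iε y` before the time `0`, with a squared norm `2ε
‖u(0)‖²`, and it vanishes after the time `T`.

Neither the functional calculus nor the unitary group of `H` is needed. All computations are
done for `J u` with the bounded regularizations `J = (1 + iH/k)⁻¹` (`yosida`), for which the
weak equation becomes an integral equation (`WeakEq.yosida_eq_integral`), and the free evolution
is replaced by the contraction semigroups `exp (τ |k| (J - 1))` (`yosidaFlow`), whose defect
vanishes in the limit `k → ∞` (`integral_norm_sq_apply_le`). The smoothing estimate for the
difference of two regularizations shows that `A J u` is Cauchy in `L²(I, E)`, and its limit is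
`A u`.
-/

namespace SchrodingerSpaceTime

noncomputable section

open Filter Topology
open scoped ComplexConjugate FourierTransform LineDeriv LinearPMap NNReal SchwartzMap

/-! ### Resolvents of self-adjoint operators -/

section Resolvent

variable {E : Type*} [NormedAddCommGroup E] [InnerProductSpace ℂ E]

theorem abs_im_mul_norm_le {H : E →ₗ.[ℂ] E} (hH : H.IsFormalAdjoint H) (z : ℂ) (x : H.domain) :
    |z.im| * ‖(x : E)‖ ≤ ‖H x - z • (x : E)‖ := by
  have h1 : (⟪(x : E), H x - z • (x : E)⟫_ℂ).im = -z.im * ‖(x : E)‖ ^ 2 := by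
    have h2 : (⟪(x : E), H x⟫_ℂ).im = 0 := by
      have h3 := congrArg Complex.im (inner_conj_symm (𝕜 := ℂ) (x : E) (H x))
      rw [hH x x, Complex.conj_im] at h3
      linarith
    rw [inner_sub_right, inner_smul_right, Complex.sub_im, h2, inner_self_eq_norm_sq_to_K]
    simp [← Complex.ofReal_pow]
  have h4 : |z.im| * ‖(x : E)‖ ^ 2 ≤ ‖(x : E)‖ * ‖H x - z • (x : E)‖ := by
    calc |z.im| * ‖(x : E)‖ ^ 2 = |(⟪(x : E), H x - z • (x : E)⟫_ℂ).im| := by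
          rw [h1, abs_mul, abs_neg, abs_of_nonneg (sq_nonneg ‖(x : E)‖)]
      _ ≤ _ := (Complex.abs_im_le_norm _).trans (norm_inner_le_norm _ _)
  rcases eq_or_lt_of_le (norm_nonneg (x : E)) with h5 | h5
  · rw [← h5]; simp
  · nlinarith

/-- `R` is the everywhere defined bounded inverse of `H - z`. -/
structure IsResolvent (H : E →ₗ.[ℂ] E) (z : ℂ) (R : E →L[ℂ] E) : Prop where
  mem : ∀ x, R x ∈ H.domain
  apply : ∀ x, H ⟨R x, mem x⟩ = x + z • R x
  leftInv : ∀ x : H.domain, R (H x - z • (x : E)) = x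

theorem exists_isResolvent_of_surjective {H : E →ₗ.[ℂ] E} (hH : H.IsFormalAdjoint H) {z : ℂ}
    (hz : z.im ≠ 0) (hs : ∀ y, ∃ x : H.domain, H x - z • (x : E) = y) :
    ∃ R, IsResolvent H z R := by
  have hinj : ∀ x y : H.domain, H x - z • (x : E) = H y - z • (y : E) → x = y := by
    intro x y h
    have h1 := abs_im_mul_norm_le hH z (x - y)
    have h2 : H (x - y) - z • ((x - y : H.domain) : E) = 0 := by
      rw [LinearPMap.map_sub, Submodule.coe_sub, smul_sub, sub_sub_sub_comm, h, sub_self]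
    rw [h2, norm_zero] at h1
    have h3 : ‖((x - y : H.domain) : E)‖ = 0 := by
      have := abs_pos.2 hz
      nlinarith [norm_nonneg ((x - y : H.domain) : E)]
    exact sub_eq_zero.1 (Subtype.ext (norm_eq_zero.1 h3))
  choose g hg using hs
  let R₀ : E →ₗ[ℂ] E :=
    { toFun := fun y => g y
      map_add' := fun x y => by
        rw [← Submodule.coe_add]
        congr 1
        apply hinj
        rw [hg, LinearPMap.map_add, Submodule.coe_add, smul_add, add_sub_add_comm, hg, hg]
      map_smul' := fun c x => by
        rw [RingHom.id_apply, ← Submodule.coe_smul]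
        congr 1
        apply hinj
        rw [hg, LinearPMap.map_smul, Submodule.coe_smul, smul_comm, ← smul_sub, hg] }
  refine ⟨R₀.mkContinuous |z.im|⁻¹ fun y => ?_, fun y => (g y).2, fun y => ?_, fun x => ?_⟩
  · have h1 := abs_im_mul_norm_le hH z (g y)
    rw [hg] at h1
    rw [inv_mul_eq_div, le_div_iff₀ (abs_pos.2 hz), mul_comm]
    exact h1
  · exact sub_eq_iff_eq_add.1 (hg y)
  · exact congrArg Subtype.val (hinj _ _ (hg (H x - z • (x : E))))

/-- The range of `H - z` is closed, because `H` is closed and `H - z` is bounded below. A vector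
orthogonal to it is an eigenvector of `H` with the eigenvalue `z̄`, hence zero. -/
theorem surjective_sub_smul [CompleteSpace E] {H : E →ₗ.[ℂ] E} (hH : IsSelfAdjoint H) {z : ℂ}
    (hz : z.im ≠ 0) (y : E) : ∃ x : H.domain, H x - z • (x : E) = y := by
  have hsym : H.IsFormalAdjoint H := by
    have h := LinearPMap.adjoint_isFormalAdjoint hH.dense_domain
    rwa [LinearPMap.isSelfAdjoint_def.1 hH] at h
  let M : Submodule ℂ E := LinearMap.range (H.toFun - z • H.domain.subtype)
  have hM : ∀ x : H.domain, H x - z • (x : E) ∈ M := fun x => ⟨x, rfl⟩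
  have hclosed : IsClosed (M : Set E) := by
    rw [← isSeqClosed_iff_isClosed]
    intro w y hw hy
    choose x hx using hw
    replace hx : ∀ n, H (x n) - z • (x n : E) = w n := hx
    have hc : CauchySeq fun n => (x n : E) := by
      have h1 := hy.cauchySeq
      rw [Metric.cauchySeq_iff] at h1 ⊢
      intro ε hε
      obtain ⟨N, hN⟩ := h1 (|z.im| * ε) (mul_pos (abs_pos.2 hz) hε)
      refine ⟨N, fun m hm n hn => ?_⟩
      have h2 := hN m hm n hn
      have h3 := abs_im_mul_norm_le hsym z (x m - x n)
      rw [LinearPMap.map_sub, Submodule.coe_sub, smul_sub, sub_sub_sub_comm, hx, hx] at h3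
      rw [dist_eq_norm] at h2 ⊢
      exact lt_of_mul_lt_mul_left (h3.trans_lt h2) (abs_nonneg _)
    obtain ⟨x', hx'⟩ := cauchySeq_tendsto_of_complete hc
    have h4 : Tendsto (fun n => H (x n)) atTop (𝓝 (y + z • x')) := by
      refine (hy.add (hx'.const_smul z)).congr fun n => ?_
      rw [← hx n]; simp
    have h5 : (x', y + z • x') ∈ H.graph :=
      hH.isClosed.mem_of_tendsto (hx'.prodMk_nhds h4)
        (Eventually.of_forall fun n => H.mem_graph (x n))
    obtain ⟨x'', h6, h7⟩ := (LinearPMap.mem_graph_iff _).1 h5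
    refine ⟨x'', ?_⟩
    change H x'' - z • (x'' : E) = y
    rw [h7, h6]; simp
  have horth : Mᗮ = ⊥ := by
    rw [Submodule.eq_bot_iff]
    intro y hy
    have h1 : ∀ x : H.domain, ⟪conj z • y, (x : E)⟫_ℂ = ⟪y, H x⟫_ℂ := by
      intro x
      have h2 := Submodule.inner_left_of_mem_orthogonal (hM x) hy
      rw [inner_sub_right, sub_eq_zero, inner_smul_right] at h2
      rw [h2, inner_smul_left, Complex.conj_conj]
    have h3 : y ∈ H.domain := by
      have h := LinearPMap.mem_adjoint_domain_of_exists y ⟨_, h1⟩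
      rwa [LinearPMap.isSelfAdjoint_def.1 hH] at h
    have h4 : H ⟨y, h3⟩ = conj z • y :=
      hH.dense_domain.eq_of_inner_left ℂ fun x hx =>
        (hsym ⟨y, h3⟩ ⟨x, hx⟩).trans (h1 ⟨x, hx⟩).symm
    have h5 := abs_im_mul_norm_le hsym (conj z) ⟨y, h3⟩
    rw [h4, sub_self, norm_zero, Complex.conj_im, abs_neg] at h5
    have h6 : ‖y‖ = 0 := by
      have := abs_pos.2 hz
      have h7 : |z.im| * ‖y‖ ≤ 0 := h5
      nlinarith [norm_nonneg y]
    exact norm_eq_zero.1 h6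
  have : CompleteSpace M := hclosed.completeSpace_coe
  have htop : M = ⊤ := Submodule.orthogonal_eq_bot_iff.1 horth
  have : y ∈ M := htop ▸ Submodule.mem_top
  exact this

/-- A densely defined symmetric operator `T` with `ran (T - z) = ran (T - z̄) = E` is
self-adjoint. -/
theorem isSelfAdjoint_of_surjective [CompleteSpace E] {T : E →ₗ.[ℂ] E}
    (hd : Dense (T.domain : Set E)) (hT : T.IsFormalAdjoint T) (z : ℂ)
    (h₁ : ∀ y, ∃ x : T.domain, T x - z • (x : E) = y)
    (h₂ : ∀ y, ∃ x : T.domain, T x - conj z • (x : E) = y) : IsSelfAdjoint T := by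
  have hle : T ≤ T† := hT.le_adjoint hd
  rw [LinearPMap.isSelfAdjoint_def]
  refine (LinearPMap.eq_of_le_of_domain_eq hle (le_antisymm hle.1 ?_)).symm
  intro y hy
  obtain ⟨x, hx⟩ := h₁ (T† ⟨y, hy⟩ - z • y)
  have hxy : y = x := by
    obtain ⟨w, hw⟩ := h₂ (y - x)
    have h3 : ⟪T† ⟨y, hy⟩, (w : E)⟫_ℂ = ⟪y, T w⟫_ℂ :=
      LinearPMap.adjoint_isFormalAdjoint hd ⟨y, hy⟩ w
    have h4 : ⟪T x, (w : E)⟫_ℂ = ⟪(x : E), T w⟫_ℂ := hT x w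
    have h5 : ⟪y - x, y - (x : E)⟫_ℂ = 0 := by
      calc ⟪y - x, y - (x : E)⟫_ℂ = ⟪y - x, T w - conj z • (w : E)⟫_ℂ := by rw [hw]
        _ = ⟪T† ⟨y, hy⟩ - z • y, (w : E)⟫_ℂ - ⟪T x - z • (x : E), (w : E)⟫_ℂ := by
          simp only [inner_sub_left, inner_sub_right, inner_smul_left, inner_smul_right, h3, h4]
          ring
        _ = 0 := by rw [hx, sub_self]
    exact sub_eq_zero.1 (inner_self_eq_zero.1 h5)
  rw [hxy]
  exact x.2

variable [CompleteSpace E]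

theorem isFormalAdjoint_self {H : E →ₗ.[ℂ] E} (hH : IsSelfAdjoint H) : H.IsFormalAdjoint H := by
  have h := LinearPMap.adjoint_isFormalAdjoint hH.dense_domain
  rwa [LinearPMap.isSelfAdjoint_def.1 hH] at h

open Classical in
/-- The bounded resolvent `(H - z)⁻¹` on the whole space (and `0` if it does not exist). -/
def resolvent (H : E →ₗ.[ℂ] E) (z : ℂ) : E →L[ℂ] E :=
  if h : ∃ R, IsResolvent H z R then h.choose else 0

variable {H : E →ₗ.[ℂ] E} (hH : IsSelfAdjoint H)

include hH

theorem isResolvent_resolvent {z : ℂ} (hz : z.im ≠ 0) : IsResolvent H z (resolvent H z) := by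
  have h : ∃ R, IsResolvent H z R :=
    exists_isResolvent_of_surjective (isFormalAdjoint_self hH) hz (surjective_sub_smul hH hz)
  rw [resolvent, dif_pos h]
  exact h.choose_spec

theorem norm_resolvent_apply_le {z : ℂ} (hz : z.im ≠ 0) (x : E) :
    |z.im| * ‖resolvent H z x‖ ≤ ‖x‖ := by
  have hR := isResolvent_resolvent hH hz
  have h := abs_im_mul_norm_le (isFormalAdjoint_self hH) z ⟨_, hR.mem x⟩
  rwa [hR.apply, add_sub_cancel_right] at h

theorem inner_resolvent_left {z : ℂ} (hz : z.im ≠ 0) (x y : E) :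
    ⟪resolvent H z x, y⟫_ℂ = ⟪x, resolvent H (conj z) y⟫_ℂ := by
  have hz' : (conj z).im ≠ 0 := by simpa using hz
  have hR := isResolvent_resolvent hH hz
  have hR' := isResolvent_resolvent hH hz'
  have h := isFormalAdjoint_self hH ⟨_, hR.mem x⟩ ⟨_, hR'.mem y⟩
  rw [hR.apply, hR'.apply] at h
  simp only [inner_add_left, inner_add_right, inner_smul_left, inner_smul_right] at h
  simpa using h.symm

/-- The first resolvent identity. -/
theorem resolvent_apply_eq {z w : ℂ} (hz : z.im ≠ 0) (hw : w.im ≠ 0) (x : E) :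
    resolvent H z x = resolvent H w x + (z - w) • resolvent H z (resolvent H w x) := by
  have hR := isResolvent_resolvent hH hz
  have hR' := isResolvent_resolvent hH hw
  have h := hR.leftInv ⟨_, hR'.mem x⟩
  rw [hR'.apply, add_sub_assoc, ← sub_smul, _root_.map_add, map_smul] at h
  rw [← sub_eq_iff_eq_add.2 h.symm, ← neg_sub w z, neg_smul, ← sub_eq_add_neg]

theorem commute_resolvent {z w : ℂ} (hz : z.im ≠ 0) (hw : w.im ≠ 0) :
    Commute (resolvent H z) (resolvent H w) := by
  rcases eq_or_ne z w with rfl | hzw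
  · exact Commute.refl _
  ext x
  have h1 := resolvent_apply_eq hH hz hw x
  have h2 := resolvent_apply_eq hH hw hz x
  have h3 : (z - w) • resolvent H z (resolvent H w x)
      = (z - w) • resolvent H w (resolvent H z x) := by
    rw [← sub_eq_iff_eq_add'.2 h1, ← neg_sub w z, neg_smul, ← sub_eq_iff_eq_add'.2 h2, neg_sub]
  exact smul_right_injective E (sub_ne_zero.2 hzw) h3

end Resolvent

/-! ### Yosida regularization -/

section Yosida

variable {E : Type*} [NormedAddCommGroup E] [InnerProductSpace ℂ E]

/-- The regularizing contraction `(1 + i H / k)⁻¹ = -ik (H - ik)⁻¹`, for real `k ≠ 0`. -/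
def yosida (H : E →ₗ.[ℂ] E) (k : ℝ) : E →L[ℂ] E :=
  -((k : ℂ) * Complex.I) • resolvent H (k * Complex.I)

theorem yosida_apply (H : E →ₗ.[ℂ] E) (k : ℝ) (x : E) :
    yosida H k x = -((k : ℂ) * Complex.I) • resolvent H (k * Complex.I) x := rfl

variable [CompleteSpace E] {H : E →ₗ.[ℂ] E} (hH : IsSelfAdjoint H) {k : ℝ}

theorem im_mul_I_ne_zero (hk : k ≠ 0) : ((k : ℂ) * Complex.I).im ≠ 0 := by simpa using hk

include hH

theorem yosida_mem_domain (hk : k ≠ 0) (x : E) : yosida H k x ∈ H.domain :=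
  H.domain.smul_mem _ ((isResolvent_resolvent hH (im_mul_I_ne_zero hk)).mem x)

theorem apply_yosida (hk : k ≠ 0) (x : E) :
    H ⟨yosida H k x, yosida_mem_domain hH hk x⟩
      = ((k : ℂ) * Complex.I) • (yosida H k x - x) := by
  have hR := isResolvent_resolvent hH (im_mul_I_ne_zero hk)
  have h : (⟨yosida H k x, yosida_mem_domain hH hk x⟩ : H.domain)
      = -((k : ℂ) * Complex.I) • ⟨_, hR.mem x⟩ := rfl
  rw [h, LinearPMap.map_smul, hR.apply, yosida_apply]
  module

theorem norm_yosida_apply_le (hk : k ≠ 0) (x : E) : ‖yosida H k x‖ ≤ ‖x‖ := by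
  have h := norm_resolvent_apply_le hH (im_mul_I_ne_zero hk) x
  rw [yosida_apply, norm_smul]
  simpa using h

theorem inner_yosida_left (hk : k ≠ 0) (x y : E) :
    ⟪yosida H k x, y⟫_ℂ = ⟪x, yosida H (-k) y⟫_ℂ := by
  have h := inner_resolvent_left hH (im_mul_I_ne_zero hk) x y
  simp only [yosida_apply, inner_smul_left, inner_smul_right, h]
  simp

theorem commute_yosida {l : ℝ} (hk : k ≠ 0) (hl : l ≠ 0) :
    Commute (yosida H k) (yosida H l) :=
  ((commute_resolvent hH (im_mul_I_ne_zero hk) (im_mul_I_ne_zero hl)).smul_left _).smul_right _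

/-- The regularizations converge strongly to the identity as `|k| → ∞`. -/
theorem tendsto_yosida (x : E) :
    Tendsto (fun k => yosida H k x) (Bornology.cobounded ℝ) (𝓝 x) := by
  have hne : ∀ᶠ k : ℝ in Bornology.cobounded ℝ, k ≠ 0 := by
    have h := tendsto_norm_cobounded_atTop (E := ℝ) |>.eventually_gt_atTop 0
    filter_upwards [h] with k hk using norm_pos_iff.1 hk
  -- on the domain the error is `(H - ik)⁻¹ H x`, of norm at most `‖H x‖ / |k|`
  have hdom : ∀ y : H.domain, Tendsto (fun k => yosida H k (y : E)) (Bornology.cobounded ℝ)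
      (𝓝 (y : E)) := by
    intro y
    rw [tendsto_iff_norm_sub_tendsto_zero]
    have h0 : Tendsto (fun k : ℝ => ‖H y‖ / ‖k‖) (Bornology.cobounded ℝ) (𝓝 0) :=
      tendsto_norm_cobounded_atTop.const_div_atTop _
    refine squeeze_zero' (Eventually.of_forall fun _ => norm_nonneg _) ?_ h0
    filter_upwards [hne] with k hk
    have hR := isResolvent_resolvent hH (im_mul_I_ne_zero hk)
    have h1 := hR.leftInv y
    rw [_root_.map_sub, map_smul] at h1
    have h2 : yosida H k (y : E) - y = -resolvent H (k * Complex.I) (H y) := by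
      rw [yosida_apply, neg_smul]
      nth_rw 2 [← h1]
      abel
    have h3 := norm_resolvent_apply_le hH (im_mul_I_ne_zero hk) (H y)
    rw [h2, norm_neg, le_div_iff₀ (norm_pos_iff.2 hk), mul_comm]
    simpa using h3
  rw [Metric.tendsto_nhds]
  intro ε hε
  obtain ⟨y, hy, hxy⟩ := Metric.mem_closure_iff.1 (hH.dense_domain x) (ε / 3) (by positivity)
  filter_upwards [hne, Metric.tendsto_nhds.1 (hdom ⟨y, hy⟩) (ε / 3) (by positivity)] with k hk h1
  have h2 : dist (yosida H k x) (yosida H k y) ≤ dist x y := by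
    rw [dist_eq_norm, dist_eq_norm, ← _root_.map_sub]
    exact norm_yosida_apply_le hH hk _
  have h3 := dist_triangle4 (yosida H k x) (yosida H k y) y x
  rw [dist_comm y x] at h3
  change dist (yosida H k y) y < ε / 3 at h1
  linarith

end Yosida

/-! ### Perturbations that are small uniformly along a line parallel to the real axis -/

section Perturbation

variable {E : Type*} [NormedAddCommGroup E] [InnerProductSpace ℂ E]

/-- If `A` is bounded relative to `H - z` and `H R = K` with bounded operators `R` and `K`, then
`A R` is a bounded operator. -/
theorem exists_clm_comp {H A : E →ₗ.[ℂ] E} (hle : H.domain ≤ A.domain) {c : ℝ} {z : ℂ}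
    (hc : 0 ≤ c)
    (hb : ∀ (x : E) (h : x ∈ H.domain) (hA : x ∈ A.domain),
      ‖A ⟨x, hA⟩‖ ≤ c * ‖H ⟨x, h⟩ - z • x‖)
    (R K : E →L[ℂ] E) (hR : ∀ x, R x ∈ H.domain) (hK : ∀ x, H ⟨R x, hR x⟩ = K x) :
    ∃ S : E →L[ℂ] E, ∀ x, S x = A ⟨R x, hle (hR x)⟩ := by
  let S₀ : E →ₗ[ℂ] E :=
    { toFun := fun x => A ⟨R x, hle (hR x)⟩
      map_add' := fun x y => by
        rw [← LinearPMap.map_add]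
        congr 1
        exact Subtype.ext (map_add R x y)
      map_smul' := fun a x => by
        rw [RingHom.id_apply, ← LinearPMap.map_smul]
        congr 1
        exact Subtype.ext (map_smul R a x) }
  refine ⟨S₀.mkContinuous (c * ‖K - z • R‖) fun x => ?_, fun x => rfl⟩
  have h := hb (R x) (hR x) (hle (hR x))
  rw [hK] at h
  rw [mul_assoc]
  exact h.trans (mul_le_mul_of_nonneg_left ((K - z • R).le_opNorm x) hc)

/-- The symmetric operator `A` is an admissible perturbation that leads from the self-adjoint
operator `H` to `H' = H + A`: on the line `ℝ + iε` it is bounded relative to `H - z` and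
relative to `H' - z`, uniformly in `z`. If `A` perturbs `H` to `H'`, then `-A` perturbs
`H'` to `H`. -/
structure IsPerturbation [CompleteSpace E] (H H' A : E →ₗ.[ℂ] E) (c ε : ℝ) : Prop where
  selfAdjoint : IsSelfAdjoint H
  symmetric : A.IsFormalAdjoint A
  domain_eq : H'.domain = H.domain
  domain_le : H.domain ≤ A.domain
  apply_eq : ∀ (x : E) (h : x ∈ H.domain) (h' : x ∈ H'.domain) (hA : x ∈ A.domain),
    H' ⟨x, h'⟩ = H ⟨x, h⟩ + A ⟨x, hA⟩
  nonneg : 0 ≤ c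
  pos : 0 < ε
  bound : ∀ (l : ℝ) (x : E) (h : x ∈ H.domain) (hA : x ∈ A.domain),
    ‖A ⟨x, hA⟩‖ ≤ c * ‖H ⟨x, h⟩ - ((l : ℂ) + Complex.I * ε) • x‖
  bound' : ∀ (l : ℝ) (x : E) (h' : x ∈ H'.domain) (hA : x ∈ A.domain),
    ‖A ⟨x, hA⟩‖ ≤ c * ‖H' ⟨x, h'⟩ - ((l : ℂ) + Complex.I * ε) • x‖

theorem norm_apply_le_of_unboundedNorm_le {H A : E →ₗ.[ℂ] E} (hH : H.IsFormalAdjoint H)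
    {z : ℂ} (hz : z.im ≠ 0) {a : ℝ} (ha : 0 ≤ a)
    (h : unboundedNorm (compOp A (resolventOp H z)) ≤ ENNReal.ofReal a)
    (x : E) (hx : x ∈ H.domain) (hA : x ∈ A.domain) :
    ‖A ⟨x, hA⟩‖ ≤ a * ‖H ⟨x, hx⟩ - z • x‖ := by
  set T : E →ₗ.[ℂ] E := (-(z • (LinearMap.id : E →ₗ[ℂ] E))) +ᵥ H
  have hTx : ∀ y : H.domain, T y = H y - z • (y : E) := by
    intro y
    refine (LinearPMap.vadd_apply (-(z • (LinearMap.id : E →ₗ[ℂ] E))) H y).trans ?_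
    simp [sub_eq_neg_add]
  have hker : T.toFun.ker = ⊥ := by
    rw [LinearMap.ker_eq_bot']
    intro y hy
    have h1 := abs_im_mul_norm_le hH z y
    have h2 : H y - z • (y : E) = 0 := (hTx y).symm.trans hy
    rw [h2, norm_zero] at h1
    have h3 : ‖(y : E)‖ = 0 := by
      have := abs_pos.2 hz
      nlinarith [norm_nonneg (y : E)]
    exact Subtype.ext (norm_eq_zero.1 h3)
  obtain ⟨y, hy1, hy2⟩ := (LinearPMap.mem_graph_iff _).1
    (LinearPMap.mem_inverse_graph hker (⟨x, hx⟩ : T.domain))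
  replace hy1 : (y : E) = H ⟨x, hx⟩ - z • x := hy1.trans (hTx _)
  replace hy2 : resolventOp H z y = x := hy2
  have hmem : (y : E) ∈ (compOp A (resolventOp H z)).domain :=
    ⟨y, show resolventOp H z y ∈ A.domain from hy2 ▸ hA, rfl⟩
  have hval : compOp A (resolventOp H z) ⟨y, hmem⟩ = A ⟨x, hA⟩ := by
    change A _ = _
    congr 1
    exact Subtype.ext hy2
  have h4 := (le_iSup (fun w : (compOp A (resolventOp H z)).domain =>
    ‖compOp A (resolventOp H z) w‖ₑ / ‖(w : E)‖ₑ) ⟨y, hmem⟩).trans h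
  rw [hval] at h4
  replace h4 : ‖A ⟨x, hA⟩‖ₑ / ‖(y : E)‖ₑ ≤ ENNReal.ofReal a := h4
  rcases eq_or_ne (y : E) 0 with h0 | h0
  · have h5 := abs_im_mul_norm_le hH z ⟨x, hx⟩
    rw [← hy1, h0, norm_zero] at h5
    have h6 : x = 0 := by
      have := abs_pos.2 hz
      have h7 : |z.im| * ‖x‖ ≤ 0 := h5
      exact norm_eq_zero.1 (by nlinarith [norm_nonneg x])
    have h8 : (⟨x, hA⟩ : A.domain) = 0 := Subtype.ext h6
    rw [h8, LinearPMap.map_zero, norm_zero]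
    positivity
  · rw [← hy1]
    rw [ENNReal.div_le_iff (by simpa using h0) (by simp)] at h4
    rw [← ofReal_norm, ← ofReal_norm, ← ENNReal.ofReal_mul ha] at h4
    exact (ENNReal.ofReal_le_ofReal_iff (by positivity)).1 h4

variable [CompleteSpace E]

/-- Under the assumptions (A) the relative bound of `A` with respect to `H₀ - z` is smaller
than one, uniformly for `Im z = ±ε`. -/
theorem AssumptionsA.exists_bound {H₀ A : E →ₗ.[ℂ] E} (hA : AssumptionsA H₀ A) :
    ∃ a ε : ℝ, 0 ≤ a ∧ a < 1 ∧ 0 < ε ∧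
      (∀ (l : ℝ) (x : E) (h : x ∈ H₀.domain) (h' : x ∈ A.domain),
        ‖A ⟨x, h'⟩‖ ≤ a * ‖H₀ ⟨x, h⟩ - ((l : ℂ) + Complex.I * ε) • x‖) ∧
      (∀ (l : ℝ) (x : E) (h : x ∈ H₀.domain) (h' : x ∈ A.domain),
        ‖A ⟨x, h'⟩‖ ≤ a * ‖H₀ ⟨x, h⟩ - ((l : ℂ) - Complex.I * ε) • x‖) := by
  obtain ⟨ε, hε, h1, h2⟩ := hA.resolvent_bound
  set s₁ := ⨆ l : ℝ, unboundedNorm (compOp A (resolventOp H₀ (l + Complex.I * ε)))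
  set s₂ := ⨆ l : ℝ, unboundedNorm (compOp A (resolventOp H₀ (l - Complex.I * ε)))
  have hs : max s₁ s₂ < 1 := max_lt h1 h2
  have htop : max s₁ s₂ ≠ ∞ := (hs.trans ENNReal.one_lt_top).ne
  have hsym := isFormalAdjoint_self hA.selfAdjoint
  refine ⟨(max s₁ s₂).toReal, ε, ENNReal.toReal_nonneg, ?_, hε, fun l x h h' => ?_,
    fun l x h h' => ?_⟩
  · have := (ENNReal.toReal_lt_toReal htop ENNReal.one_ne_top).2 hs
    simpa using this
  · refine norm_apply_le_of_unboundedNorm_le hsym (by simpa using hε.ne') ENNReal.toReal_nonneg ?_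
      x h h'
    rw [ENNReal.ofReal_toReal htop]
    exact (le_iSup (fun l : ℝ => unboundedNorm (compOp A (resolventOp H₀ (l + Complex.I * ε))))
      l).trans (le_max_left _ _)
  · refine norm_apply_le_of_unboundedNorm_le hsym (by simpa using hε.ne') ENNReal.toReal_nonneg ?_
      x h h'
    rw [ENNReal.ofReal_toReal htop]
    exact (le_iSup (fun l : ℝ => unboundedNorm (compOp A (resolventOp H₀ (l - Complex.I * ε))))
      l).trans (le_max_right _ _)

/-- A perturbation with relative bound smaller than one keeps `H - z + A` surjective:
`H - z + A = (1 + A (H - z)⁻¹) (H - z)`, and the first factor is invertible by a Neumann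
series. -/
theorem surjective_add_sub_smul {H A : E →ₗ.[ℂ] E} (hH : IsSelfAdjoint H)
    (hle : H.domain ≤ A.domain) {z : ℂ} (hz : z.im ≠ 0) {a : ℝ} (ha0 : 0 ≤ a) (ha : a < 1)
    (hb : ∀ (x : E) (h : x ∈ H.domain) (hA : x ∈ A.domain),
      ‖A ⟨x, hA⟩‖ ≤ a * ‖H ⟨x, h⟩ - z • x‖) (y : E) :
    ∃ x : (H + A).domain, (H + A) x - z • (x : E) = y := by
  have hR := isResolvent_resolvent hH hz
  obtain ⟨S, hS⟩ := exists_clm_comp hle ha0 hb (resolvent H z)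
    (ContinuousLinearMap.id ℂ E + z • resolvent H z) hR.mem hR.apply
  have hnorm : ‖-S‖ < 1 := by
    rw [norm_neg]
    refine lt_of_le_of_lt (ContinuousLinearMap.opNorm_le_bound _ ha0 fun x => ?_) ha
    have h := hb _ (hR.mem x) (hle (hR.mem x))
    rw [hR.apply, add_sub_cancel_right, ← hS] at h
    exact h
  obtain ⟨u, hu⟩ := isUnit_one_sub_of_norm_lt_one hnorm
  obtain ⟨w, hw⟩ : ∃ w, w + S w = y := by
    refine ⟨(↑u⁻¹ : E →L[ℂ] E) y, ?_⟩
    have h1 : ((u : E →L[ℂ] E) * (↑u⁻¹ : E →L[ℂ] E)) y = y := by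
      rw [Units.mul_inv]; rfl
    rw [hu] at h1
    simpa using h1
  refine ⟨⟨resolvent H z w, hR.mem w, hle (hR.mem w)⟩, ?_⟩
  rw [LinearPMap.add_apply]
  change H ⟨_, hR.mem w⟩ + A ⟨_, hle (hR.mem w)⟩ - z • resolvent H z w = y
  rw [hR.apply, ← hS, ← hw]
  abel

/-- Under the assumptions (A), `H₀ + A` is a perturbation of `H₀`, and conversely. -/
theorem AssumptionsA.exists_isPerturbation {H₀ A : E →ₗ.[ℂ] E} (hA : AssumptionsA H₀ A) :
    ∃ c ε : ℝ, IsPerturbation H₀ (H₀ + A) A c ε ∧ IsPerturbation (H₀ + A) H₀ (-A) c ε := by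
  obtain ⟨a, ε, ha0, ha1, hε, hb1, hb2⟩ := hA.exists_bound
  have hsym := isFormalAdjoint_self hA.selfAdjoint
  have hdom : (H₀ + A).domain = H₀.domain := by
    rw [LinearPMap.add_domain]
    exact inf_eq_left.2 hA.domain_le
  have happ : ∀ (x : E) (h : x ∈ H₀.domain) (h' : x ∈ (H₀ + A).domain) (hx : x ∈ A.domain),
      (H₀ + A) ⟨x, h'⟩ = H₀ ⟨x, h⟩ + A ⟨x, hx⟩ := fun x h h' hx => by
    rw [LinearPMap.add_apply]
  have hself : IsSelfAdjoint (H₀ + A) := by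
    refine isSelfAdjoint_of_surjective (by rw [hdom]; exact hA.selfAdjoint.dense_domain) ?_
      (Complex.I * ε) ?_ ?_
    · intro x y
      rw [LinearPMap.add_apply, LinearPMap.add_apply, inner_add_left, inner_add_right]
      exact congrArg₂ (· + ·) (hsym ⟨x, x.2.1⟩ ⟨y, y.2.1⟩) (hA.symmetric ⟨x, x.2.2⟩ ⟨y, y.2.2⟩)
    · refine surjective_add_sub_smul hA.selfAdjoint hA.domain_le (by simpa using hε.ne') ha0 ha1
        fun x h h' => ?_
      simpa using hb1 0 x h h'
    · refine surjective_add_sub_smul hA.selfAdjoint hA.domain_le (by simpa using hε.ne') ha0 ha1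
        fun x h h' => ?_
      simpa using hb2 0 x h h'
  -- `‖A x‖ ≤ a ‖(H₀ - z) x‖ ≤ a ‖(H₀ + A - z) x‖ + a ‖A x‖` gives the constant `a / (1 - a)`
  have h1a : 0 < 1 - a := by linarith
  have hac : a ≤ a / (1 - a) := by
    rw [le_div_iff₀ h1a]
    nlinarith
  have hB : ∀ (l : ℝ) (x : E) (h : x ∈ H₀.domain) (h' : x ∈ A.domain),
      ‖A ⟨x, h'⟩‖ ≤ a / (1 - a) * ‖H₀ ⟨x, h⟩ - ((l : ℂ) + Complex.I * ε) • x‖ :=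
    fun l x h h' => (hb1 l x h h').trans (mul_le_mul_of_nonneg_right hac (norm_nonneg _))
  have hB' : ∀ (l : ℝ) (x : E) (h : x ∈ (H₀ + A).domain) (h' : x ∈ A.domain),
      ‖A ⟨x, h'⟩‖ ≤ a / (1 - a) * ‖(H₀ + A) ⟨x, h⟩ - ((l : ℂ) + Complex.I * ε) • x‖ := by
    intro l x h h'
    have h2 := hb1 l x h.1 h'
    have h3 : H₀ ⟨x, h.1⟩ - ((l : ℂ) + Complex.I * ε) • x
        = ((H₀ + A) ⟨x, h⟩ - ((l : ℂ) + Complex.I * ε) • x) - A ⟨x, h'⟩ := by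
      rw [happ x h.1 h h']; abel
    rw [h3] at h2
    have h4 := norm_sub_le ((H₀ + A) ⟨x, h⟩ - ((l : ℂ) + Complex.I * ε) • x) (A ⟨x, h'⟩)
    rw [div_mul_eq_mul_div, le_div_iff₀ h1a]
    nlinarith
  refine ⟨a / (1 - a), ε, ⟨hA.selfAdjoint, hA.symmetric, hdom, hA.domain_le, happ,
    by positivity, hε, hB, hB'⟩, ⟨hself, ?_, hdom.symm, ?_, ?_, by positivity, hε, ?_, ?_⟩⟩
  · intro x y
    rw [LinearPMap.neg_apply, LinearPMap.neg_apply, inner_neg_left, inner_neg_right]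
    exact congrArg Neg.neg (hA.symmetric x y)
  · exact hdom.le.trans hA.domain_le
  · intro x h h' hx
    rw [happ x h' h hx, LinearPMap.neg_apply]
    exact (add_neg_cancel_right _ _).symm
  · intro l x h hx
    rw [LinearPMap.neg_apply, norm_neg]
    exact hB' l x h hx
  · intro l x h hx
    rw [LinearPMap.neg_apply, norm_neg]
    exact hB l x h hx

end Perturbation

/-! ### Calculus for primitives of integrable vector-valued functions -/

section Primitive

variable {F : Type*} [NormedAddCommGroup F] [NormedSpace ℝ F] [CompleteSpace F]
  {w h : ℝ → F} {a b : ℝ}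

omit [CompleteSpace F] in
theorem absolutelyContinuousOnInterval_of_primitive (hab : a ≤ b)
    (hi : IntervalIntegrable h volume a b)
    (hw : ∀ t ∈ Icc a b, w t = w a + ∫ s in a..t, h s) : AbsolutelyContinuousOnInterval w a b := by
  have h1 := hi.norm.absolutelyContinuousOnInterval_intervalIntegral (c := a) left_mem_uIcc
  have hsub : ∀ s ∈ Icc a b, ∀ t ∈ Icc a b, IntervalIntegrable h volume s t := fun s hs t ht =>
    hi.mono_set (by rw [uIcc_of_le hab]; exact uIcc_subset_Icc hs ht)
  refine squeeze_zero' (Eventually.of_forall fun _ => Finset.sum_nonneg fun _ _ => dist_nonneg)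
    ?_ h1
  rw [eventually_inf_principal]
  refine Eventually.of_forall fun I hI => Finset.sum_le_sum fun i hi' => ?_
  have h2 := hI.1 i hi'
  rw [uIcc_of_le hab] at h2
  have ha : a ∈ Icc a b := left_mem_Icc.2 hab
  rw [dist_comm, dist_comm (∫ v in a..(I.2 i).1, ‖h v‖), dist_eq_norm, hw _ h2.1, hw _ h2.2,
    add_sub_add_left_eq_sub, Real.dist_eq,
    intervalIntegral.integral_interval_sub_left (hsub _ ha _ h2.2) (hsub _ ha _ h2.1),
    intervalIntegral.integral_interval_sub_left (hsub _ ha _ h2.2).norm (hsub _ ha _ h2.1).norm]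
  exact intervalIntegral.norm_integral_le_abs_integral_norm

theorem ae_hasDerivAt_of_primitive (hab : a ≤ b) (hi : IntervalIntegrable h volume a b)
    (hw : ∀ t ∈ Icc a b, w t = w a + ∫ s in a..t, h s) :
    ∀ᵐ x, x ∈ Ioo a b → HasDerivAt w (h x) x := by
  filter_upwards [hi.ae_hasDerivAt_integral] with x hx hxab
  rw [uIcc_of_le hab] at hx
  have h1 := (hx (Ioo_subset_Icc_self hxab) a (left_mem_Icc.2 hab)).const_add (w a)
  refine h1.congr_of_eventuallyEq ?_
  filter_upwards [Ioo_mem_nhds hxab.1 hxab.2] with t ht using hw t (Ioo_subset_Icc_self ht)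

/-- The fundamental theorem of calculus for absolutely continuous functions with an integrable
derivative, with values in a Banach space. -/
theorem integral_eq_sub_of_absolutelyContinuous (hab : a ≤ b)
    (hw : AbsolutelyContinuousOnInterval w a b) (hi : IntervalIntegrable h volume a b)
    (hd : ∀ᵐ x, x ∈ Ioo a b → HasDerivAt w (h x) x) : ∫ s in a..b, h s = w b - w a := by
  have hp : ∀ t ∈ Icc a b, (fun t => ∫ s in a..t, h s) t
      = (fun t => ∫ s in a..t, h s) a + ∫ s in a..t, h s := fun t _ => by simp
  have h1 := hw.sub (absolutelyContinuousOnInterval_of_primitive hab hi hp)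
  obtain ⟨C, hC⟩ := h1.const_of_ae_hasDerivAt_zero (by
    filter_upwards [hd, ae_hasDerivAt_of_primitive hab hi hp, Measure.ae_ne volume a,
      Measure.ae_ne volume b] with x hx1 hx2 hxa hxb hx
    rw [uIcc_of_le hab] at hx
    have hx' : x ∈ Ioo a b := ⟨lt_of_le_of_ne hx.1 hxa.symm, lt_of_le_of_ne hx.2 hxb⟩
    simpa using! (hx1 hx').sub (hx2 hx'))
  have h2 := (hC b right_mem_uIcc).trans (hC a left_mem_uIcc).symm
  simp only [Pi.sub_apply, intervalIntegral.integral_same, sub_zero] at h2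
  rw [← h2]; abel

theorem integral_norm_sq_primitive {E : Type*} [NormedAddCommGroup E] [InnerProductSpace ℂ E]
    [CompleteSpace E] {w h : ℝ → E} (hab : a ≤ b) (hi : IntervalIntegrable h volume a b)
    (hw : ∀ t ∈ Icc a b, w t = w a + ∫ s in a..t, h s) :
    ∫ s in a..b, 2 * (⟪w s, h s⟫_ℂ).re = ‖w b‖ ^ 2 - ‖w a‖ ^ 2 := by
  have hac := absolutelyContinuousOnInterval_of_primitive hab hi hw
  have hnorm : AbsolutelyContinuousOnInterval (fun t => ‖w t‖) a b := by
    refine squeeze_zero (fun _ => Finset.sum_nonneg fun _ _ => dist_nonneg) (fun I => ?_) hac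
    exact Finset.sum_le_sum fun i _ =>
      (dist_norm_norm_le _ _).trans_eq (dist_eq_norm _ _).symm
  have hcont : ContinuousOn w (Icc a b) := by simpa [uIcc_of_le hab] using hac.continuousOn
  refine integral_eq_sub_of_absolutelyContinuous (w := fun t => ‖w t‖ ^ 2) hab ?_ ?_ ?_
  · simpa [pow_two] using! hnorm.mul hnorm
  · refine IntervalIntegrable.const_mul ?_ 2
    rw [intervalIntegrable_iff_integrableOn_Ioc_of_le hab] at hi ⊢
    obtain ⟨C, hC⟩ := isCompact_Icc.exists_bound_of_continuousOn hcont
    have hwm : AEStronglyMeasurable w (volume.restrict (Ioc a b)) :=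
      (hcont.mono Ioc_subset_Icc_self).aestronglyMeasurable measurableSet_Ioc
    have hI : Integrable (fun t => ⟪w t, h t⟫_ℂ) (volume.restrict (Ioc a b)) := by
      refine ((hi.norm.const_mul C).mono' (hwm.inner hi.aestronglyMeasurable) ?_)
      filter_upwards [ae_restrict_mem measurableSet_Ioc] with t ht
      exact (norm_inner_le_norm _ _).trans
        (mul_le_mul_of_nonneg_right (hC t (Ioc_subset_Icc_self ht)) (norm_nonneg _))
    exact hI.re
  · filter_upwards [ae_hasDerivAt_of_primitive hab hi hw] with x hx hxab
    let : InnerProductSpace ℝ E := InnerProductSpace.rclikeToReal ℂ E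
    exact (hx hxab).norm_sq

theorem integral_smul_primitive {E : Type*} [NormedAddCommGroup E] [NormedSpace ℂ E]
    [CompleteSpace E] {w h : ℝ → E} {ψ : ℝ → ℂ} (hψ : ContDiff ℝ 1 ψ) (hab : a ≤ b)
    (hi : IntervalIntegrable h volume a b)
    (hw : ∀ t ∈ Icc a b, w t = w a + ∫ s in a..t, h s) :
    ∫ s in a..b, (deriv ψ s • w s + ψ s • h s) = ψ b • w b - ψ a • w a := by
  have hac := absolutelyContinuousOnInterval_of_primitive hab hi hw
  have hcont : ContinuousOn w (uIcc a b) := hac.continuousOn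
  have hψac : AbsolutelyContinuousOnInterval ψ a b :=
    hψ.contDiffOn.absolutelyContinuousOnInterval
  refine integral_eq_sub_of_absolutelyContinuous (w := fun t => ψ t • w t) hab ?_ ?_ ?_
  · exact hψac.fun_smul hac
  · refine IntervalIntegrable.add ?_ ?_
    · exact ((hψ.continuous_deriv le_rfl).continuousOn.smul hcont).intervalIntegrable
    · exact hi.continuousOn_smul hψ.continuous.continuousOn
  · filter_upwards [ae_hasDerivAt_of_primitive hab hi hw] with x hx hxab
    have h1 := ((hψ.differentiable one_ne_zero) x).hasDerivAt.smul (hx hxab)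
    rwa [add_comm] at h1

/-- Integration by parts on the whole line against Schwartz functions, for a bounded primitive
of a square integrable function. -/
theorem integral_deriv_smul_eq_neg_of_primitive {E : Type*} [NormedAddCommGroup E]
    [NormedSpace ℂ E] [CompleteSpace E] {w h : ℝ → E} {C : ℝ}
    (hwm : AEStronglyMeasurable w)
    (hC : ∀ t, ‖w t‖ ≤ C) (hh : MemLp h 2)
    (hw : ∀ a b, a ≤ b → w b = w a + ∫ s in a..b, h s) (ψ : SchwartzMap ℝ ℂ) :
    ∫ t, deriv ψ t • w t = -∫ t, ψ t • h t := by
  have hloc : LocallyIntegrable h := hh.locallyIntegrable (by norm_num)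
  have hint1 : Integrable fun t => deriv ψ t • w t := by
    have h1 : Integrable (deriv ψ) := (SchwartzMap.derivCLM ℂ ℂ ψ).integrable
    exact h1.smul_bdd C hwm (Eventually.of_forall hC)
  have hint2 : Integrable fun t => ψ t • h t :=
    memLp_one_iff_integrable.1 (hh.smul (ψ.memLp 2))
  have hψ : ContDiff ℝ 1 ψ := ψ.smooth 1
  have h1 := intervalIntegral_tendsto_integral (hint1.add hint2)
    (tendsto_neg_atTop_atBot.comp tendsto_natCast_atTop_atTop)
    (tendsto_natCast_atTop_atTop (R := ℝ))
  have h2 : ∀ n : ℕ, ∫ s in (-(n : ℝ))..n, (deriv ψ s • w s + ψ s • h s)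
      = ψ n • w n - ψ (-n) • w (-n) := fun n =>
    integral_smul_primitive hψ (by linarith [Nat.cast_nonneg (α := ℝ) n])
      (hloc.integrableOn_isCompact isCompact_uIcc).intervalIntegrable fun t ht => hw _ _ ht.1
  have hz : Tendsto ψ (cocompact ℝ) (𝓝 0) := zero_at_infty ψ
  have h3 : ∀ u : ℕ → ℝ, Tendsto u atTop (cocompact ℝ) →
      Tendsto (fun n => ψ (u n) • w (u n)) atTop (𝓝 0) := by
    intro u hu
    refine squeeze_zero_norm (a := fun n => ‖ψ (u n)‖ * C) (fun n => ?_) ?_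
    · rw [norm_smul]
      exact mul_le_mul_of_nonneg_left (hC _) (norm_nonneg _)
    · simpa using ((hz.comp hu).norm.mul_const C)
  have h4 : Tendsto (fun n : ℕ => ψ n • w n - ψ (-n) • w (-n)) atTop (𝓝 0) := by
    have h5 := (h3 (fun n => n) ((tendsto_natCast_atTop_atTop (R := ℝ)).mono_right
      atTop_le_cocompact)).sub (h3 (fun n => -n) ((tendsto_neg_atTop_atBot.comp
      (tendsto_natCast_atTop_atTop (R := ℝ))).mono_right atBot_le_cocompact))
    simpa using h5
  have h5 := tendsto_nhds_unique (h1.congr h2) h4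
  simp only [Pi.add_apply] at h5
  rw [integral_add hint1 hint2] at h5
  exact eq_neg_of_add_eq_zero_left h5

end Primitive

/-! ### The Fourier transform in time and the resolvent estimate -/

section Fourier

variable {E : Type*} [NormedAddCommGroup E] [InnerProductSpace ℂ E] [CompleteSpace E]

theorem integral_smul_fourier_eq (u : Lp E 2 (volume : Measure ℝ)) (ψ : 𝓢(ℝ, ℂ)) :
    ∫ t, ψ t • (𝓕 u : Lp E 2 (volume : Measure ℝ)) t = ∫ t, 𝓕 ψ t • u t := by
  have h := congrArg (fun T : 𝓢'(ℝ, E) => T ψ) (Lp.fourier_toTemperedDistribution_eq u)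
  simp only [TemperedDistribution.fourier_apply, Lp.toTemperedDistribution_apply] at h
  exact h.symm

theorem ae_eq_of_integral_schwartz_smul_eq {u v : ℝ → E} (hu : LocallyIntegrable u)
    (hv : LocallyIntegrable v) (h : ∀ ψ : 𝓢(ℝ, ℂ), ∫ t, ψ t • u t = ∫ t, ψ t • v t) :
    u =ᵐ[volume] v := by
  refine ae_eq_of_integral_contDiff_smul_eq hu hv fun g hg hgc => ?_
  have h1 : HasCompactSupport (Complex.ofRealCLM ∘ g) := hgc.comp_left rfl
  have h2 : ContDiff ℝ (⊤ : ℕ∞) (Complex.ofRealCLM ∘ g) := by fun_prop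
  simpa using! h (h1.toSchwartzMap h2)

theorem fourier_compLp (S : E →L[ℂ] E) (u : Lp E 2 (volume : Measure ℝ)) :
    𝓕 (S.compLp u) = S.compLp (𝓕 u : Lp E 2 (volume : Measure ℝ)) := by
  have key : ∀ (v : Lp E 2 (volume : Measure ℝ)) (ψ : 𝓢(ℝ, ℂ)),
      ∫ t, ψ t • S.compLp v t = S (∫ t, ψ t • v t) := fun v ψ => by
    have hi : Integrable fun t => ψ t • v t :=
      memLp_one_iff_integrable.1 ((Lp.memLp v).smul (ψ.memLp 2))
    rw [← S.integral_comp_comm hi]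
    refine integral_congr_ae ?_
    filter_upwards [S.coeFn_compLp v] with t ht
    rw [ht, map_smul]
  refine Lp.ext (ae_eq_of_integral_schwartz_smul_eq ((Lp.memLp _).locallyIntegrable (by norm_num))
    ((Lp.memLp _).locallyIntegrable (by norm_num)) fun ψ => ?_)
  rw [integral_smul_fourier_eq, key, key, integral_smul_fourier_eq]

/-- The Fourier transform turns a weak derivative into the multiplication by `2πiξ`. -/
theorem fourier_weakDeriv {w h : Lp E 2 (volume : Measure ℝ)}
    (hw : ∀ ψ : 𝓢(ℝ, ℂ), ∫ t, deriv ψ t • w t = -∫ t, ψ t • h t) :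
    ∀ᵐ ξ : ℝ, (𝓕 h : Lp E 2 (volume : Measure ℝ)) ξ
      = (2 * Real.pi * Complex.I * ξ : ℂ) • (𝓕 w : Lp E 2 (volume : Measure ℝ)) ξ := by
  have hd : ∂_{(1 : ℝ)} (w : 𝓢'(ℝ, E)) = (h : 𝓢'(ℝ, E)) := by
    ext ψ
    have h1 := hw ψ
    simp only [TemperedDistribution.lineDerivOp_apply_apply, Lp.toTemperedDistribution_apply]
    rw [← neg_eq_iff_eq_neg, ← integral_neg] at h1
    rw [← h1]
    refine integral_congr_ae (Eventually.of_forall fun t => ?_)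
    simp [SchwartzMap.lineDerivOp_apply_eq_fderiv]
  have hF := congrArg (fun T : 𝓢'(ℝ, E) => 𝓕 T) hd
  simp only [TemperedDistribution.fourier_lineDerivOp_eq, Lp.fourier_toTemperedDistribution_eq]
    at hF
  refine ae_eq_of_integral_schwartz_smul_eq ((Lp.memLp _).locallyIntegrable (by norm_num)) ?_
    fun ψ => ?_
  · exact ((Lp.memLp (𝓕 w : Lp E 2 (volume : Measure ℝ))).locallyIntegrable
      (by norm_num)).continuous_smul (by fun_prop)
  · have h1 := congrArg (fun T : 𝓢'(ℝ, E) => T ψ) hF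
    have h2 : (fun x : ℝ => (inner ℝ x (1 : ℝ) : ℂ)).HasTemperateGrowth := by
      fun_prop
    simp only [smul_apply, TemperedDistribution.smulLeftCLM_apply_apply,
      Lp.toTemperedDistribution_apply] at h1
    rw [← h1, ← integral_smul]
    refine integral_congr_ae (Eventually.of_forall fun t => ?_)
    simp only [SchwartzMap.smulLeftCLM_apply_apply h2, smul_smul, smul_eq_mul]
    simp only [RCLike.inner_apply, one_mul, conj_trivial]
    congr 1
    ring

/-- The resolvent estimate in space-time. On the Fourier side `i∂ₜ - H + iε` acts as
`-(H - l - iε)` with `l = -2πξ`, so that a bound of `S` by `K - (l + iε) R`, uniform in the real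
parameter `l`, is by Plancherel's theorem a bound in `L²(ℝ, E)`. -/
theorem norm_compLp_le_of_uniform_bound {R K S : E →L[ℂ] E} {c ε : ℝ}
    (hb : ∀ (l : ℝ) (x : E), ‖S x‖ ≤ c * ‖K x - ((l : ℂ) + Complex.I * ε) • R x‖)
    (y h : Lp E 2 (volume : Measure ℝ))
    (hw : ∀ ψ : 𝓢(ℝ, ℂ), ∫ t, deriv ψ t • R.compLp y t = -∫ t, ψ t • h t) :
    ‖S.compLp y‖ ≤ c * ‖Complex.I • h - K.compLp y + (Complex.I * ε) • R.compLp y‖ := by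
  rw [← Lp.norm_fourier_eq, ← Lp.norm_fourier_eq (_ + _), fourier_compLp,
    FourierTransform.fourier_add,
    FourierTransform.fourier_smul, sub_eq_add_neg, FourierTransform.fourier_add,
    FourierTransform.fourier_smul, ← neg_one_smul ℂ (K.compLp y), FourierTransform.fourier_smul,
    fourier_compLp, fourier_compLp]
  have h1 := fourier_weakDeriv hw
  rw [fourier_compLp] at h1
  set z : Lp E 2 (volume : Measure ℝ) := 𝓕 y
  set g : Lp E 2 (volume : Measure ℝ) := 𝓕 h
  refine Lp.norm_le_mul_norm_of_ae_le_mul ?_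
  filter_upwards [h1, S.coeFn_compLp z, K.coeFn_compLp z, R.coeFn_compLp z,
    Lp.coeFn_add (Complex.I • g + (-1 : ℂ) • K.compLp z) ((Complex.I * ε) • R.compLp z),
    Lp.coeFn_add (Complex.I • g) ((-1 : ℂ) • K.compLp z), Lp.coeFn_smul Complex.I g,
    Lp.coeFn_smul (-1 : ℂ) (K.compLp z), Lp.coeFn_smul (Complex.I * ε : ℂ) (R.compLp z)]
    with ξ e1 e2 e3 e4 e5 e6 e7 e8 e9
  rw [e5, Pi.add_apply, e6, Pi.add_apply, e7, e8, e9, Pi.smul_apply, Pi.smul_apply, Pi.smul_apply,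
    e1, e2, e3, e4]
  refine (hb (-(2 * Real.pi * ξ)) (z ξ)).trans_eq ?_
  rw [← norm_neg]
  congr 2
  push_cast
  have hI : Complex.I * (2 * Real.pi * Complex.I * ξ) = -(2 * Real.pi * ξ : ℂ) := by
    linear_combination (2 * Real.pi * ξ : ℂ) * Complex.I_mul_I
  rw [smul_smul, hI]
  module

end Fourier

/-! ### From weak solutions to integral equations -/

section Step

theorem deriv_smoothTransition_eq_zero {s : ℝ} (hs : s ∉ Icc (0 : ℝ) 1) :
    deriv Real.smoothTransition s = 0 := by
  rw [mem_Icc, not_and_or, not_le, not_le] at hs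
  rcases hs with hs | hs
  · have h : Real.smoothTransition =ᶠ[𝓝 s] fun _ => 0 := by
      filter_upwards [Iio_mem_nhds hs] with t ht
      exact Real.smoothTransition.zero_of_nonpos (le_of_lt ht)
    rw [h.deriv_eq, deriv_const]
  · have h : Real.smoothTransition =ᶠ[𝓝 s] fun _ => 1 := by
      filter_upwards [Ioi_mem_nhds hs] with t ht
      exact Real.smoothTransition.one_of_one_le (le_of_lt ht)
    rw [h.deriv_eq, deriv_const]

theorem continuous_deriv_smoothTransition : Continuous (deriv Real.smoothTransition) :=
  (Real.smoothTransition.contDiff (n := 1)).continuous_deriv le_rfl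

theorem hasCompactSupport_deriv_smoothTransition :
    HasCompactSupport (deriv Real.smoothTransition) :=
  HasCompactSupport.intro isCompact_Icc fun _ hs => deriv_smoothTransition_eq_zero hs

theorem integral_deriv_smoothTransition : ∫ s, deriv Real.smoothTransition s = 1 := by
  have h := integral_of_hasDerivAt_of_tendsto (f := Real.smoothTransition) (m := 0) (n := 1)
    (fun s => ((Real.smoothTransition.contDiff (n := 1)).differentiable one_ne_zero s).hasDerivAt)
    (continuous_deriv_smoothTransition.integrable_of_hasCompactSupport
      hasCompactSupport_deriv_smoothTransition) ?_ ?_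
  · simpa using h
  · refine tendsto_const_nhds.congr' ?_
    filter_upwards [eventually_le_atBot 0] with t ht
    exact (Real.smoothTransition.zero_of_nonpos ht).symm
  · refine tendsto_const_nhds.congr' ?_
    filter_upwards [eventually_ge_atTop 1] with t ht
    exact (Real.smoothTransition.one_of_one_le ht).symm

/-- A smooth step from `0` to `1` on the interval `[a, a + 1 / (k + 1)]`. -/
def step (k : ℕ) (a t : ℝ) : ℝ := Real.smoothTransition ((k + 1) * (t - a))

theorem contDiff_step (k : ℕ) (a : ℝ) : ContDiff ℝ 1 (step k a) :=
  Real.smoothTransition.contDiff.comp (by fun_prop)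

theorem deriv_step (k : ℕ) (a t : ℝ) :
    deriv (step k a) t = deriv Real.smoothTransition ((k + 1) * (t - a)) * (k + 1) := by
  have h1 : HasDerivAt (fun t : ℝ => ((k : ℝ) + 1) * (t - a)) (k + 1) t := by
    simpa using ((hasDerivAt_id t).sub_const a).const_mul ((k : ℝ) + 1)
  have h2 := ((Real.smoothTransition.contDiff (n := 1)).differentiable one_ne_zero
    ((k + 1) * (t - a))).hasDerivAt
  exact (h2.comp t h1).deriv

theorem step_of_le {k : ℕ} {a t : ℝ} (h : t ≤ a) : step k a t = 0 :=
  Real.smoothTransition.zero_of_nonpos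
    (mul_nonpos_of_nonneg_of_nonpos (by positivity) (by linarith))

theorem step_of_ge {k : ℕ} {a t : ℝ} (h : a + 1 / ((k : ℝ) + 1) ≤ t) : step k a t = 1 := by
  apply Real.smoothTransition.one_of_one_le
  have hk : (0 : ℝ) < k + 1 := by positivity
  have h1 : 1 / ((k : ℝ) + 1) ≤ t - a := by linarith
  rwa [div_le_iff₀ hk, mul_comm] at h1

theorem tendsto_step (a t : ℝ) :
    Tendsto (fun k => step k a t) atTop (𝓝 (indicator (Ioi a) (fun _ => 1) t)) := by
  rcases le_or_gt t a with h | h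
  · rw [indicator_of_notMem (notMem_Ioi.2 h)]
    exact tendsto_const_nhds.congr fun k => (step_of_le h).symm
  · rw [indicator_of_mem (mem_Ioi.2 h)]
    refine tendsto_const_nhds.congr' ?_
    filter_upwards [(tendsto_one_div_add_atTop_nhds_zero_nat (𝕜 := ℝ)).eventually_le_const
      (sub_pos.2 h)] with k hk
    exact (step_of_ge (by linarith)).symm

/-- The derivatives of the steps converge to the Dirac measure at `a`. -/
theorem tendsto_integral_deriv_step {g : ℝ → ℂ} (hg : Continuous g) (a : ℝ) :
    Tendsto (fun k => ∫ t, ((deriv (step k a) t : ℝ) : ℂ) * g t) atTop (𝓝 (g a)) := by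
  set σ' := deriv Real.smoothTransition
  have h1 : ∀ k : ℕ, ∫ t, ((deriv (step k a) t : ℝ) : ℂ) * g t
      = ∫ s in (0 : ℝ)..1, (σ' s : ℂ) * g (a + (1 / ((k : ℝ) + 1)) * s) := by
    intro k
    have hk : (0 : ℝ) < k + 1 := by positivity
    set f : ℝ → ℂ := fun s => (σ' s : ℂ) * g (a + (1 / ((k : ℝ) + 1)) * s)
    have h2 : ∀ t, ((deriv (step k a) t : ℝ) : ℂ) * g t
        = ((k : ℝ) + 1) • f (((k : ℝ) + 1) * (t - a)) := by
      intro t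
      simp only [f, deriv_step]
      rw [← mul_assoc (1 / ((k : ℝ) + 1)), one_div_mul_cancel hk.ne', one_mul,
        add_sub_cancel, Complex.real_smul]
      push_cast
      ring
    simp_rw [h2]
    rw [integral_smul, integral_sub_right_eq_self (fun t => f (((k : ℝ) + 1) * t)) a,
      Measure.integral_comp_mul_left, smul_smul, abs_of_pos (by positivity),
      mul_inv_cancel₀ hk.ne', one_smul, intervalIntegral.integral_of_le zero_le_one,
      ← integral_Icc_eq_integral_Ioc]
    refine (setIntegral_eq_integral_of_forall_compl_eq_zero fun s hs => ?_).symm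
    simp [f, σ', deriv_smoothTransition_eq_zero hs]
  simp_rw [h1]
  have h3 : Continuous fun τ : ℝ => ∫ s in (0 : ℝ)..1, (σ' s : ℂ) * g (a + τ * s) := by
    have hσ : Continuous σ' := continuous_deriv_smoothTransition
    exact intervalIntegral.continuous_parametric_intervalIntegral_of_continuous'
      (by fun_prop) 0 1
  have h4 := (h3.tendsto 0).comp (tendsto_one_div_add_atTop_nhds_zero_nat (𝕜 := ℝ))
  have h5 : ∫ s in (0 : ℝ)..1, (σ' s : ℂ) * g (a + 0 * s) = g a := by
    simp only [zero_mul, add_zero, intervalIntegral.integral_mul_const]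
    rw [intervalIntegral.integral_ofReal, intervalIntegral.integral_of_le zero_le_one,
      ← integral_Icc_eq_integral_Ioc, setIntegral_eq_integral_of_forall_compl_eq_zero
        fun s hs => deriv_smoothTransition_eq_zero hs, integral_deriv_smoothTransition]
    simp
  rw [h5] at h4
  exact h4

theorem integrable_deriv_step_mul {g : ℝ → ℂ} (hg : Continuous g) (k : ℕ) (a : ℝ) :
    Integrable fun t => ((deriv (step k a) t : ℝ) : ℂ) * g t := by
  have hc := (contDiff_step k a).continuous_deriv le_rfl
  refine Continuous.integrable_of_hasCompactSupport (by fun_prop) ?_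
  refine HasCompactSupport.intro (K := Icc a (a + 1 / ((k : ℝ) + 1))) isCompact_Icc
    fun t ht => ?_
  rw [deriv_step, deriv_smoothTransition_eq_zero]
  · simp
  · intro h
    refine ht ⟨?_, ?_⟩
    · by_contra hlt
      push Not at hlt
      have : ((k : ℝ) + 1) * (t - a) < 0 := mul_neg_of_pos_of_neg (by positivity) (by linarith)
      linarith [h.1]
    · have h2 := h.2
      have hk : (0 : ℝ) < k + 1 := by positivity
      rw [mul_comm, ← le_div_iff₀ hk] at h2
      linarith

end Step

section Weak

variable {E : Type*} [NormedAddCommGroup E] [InnerProductSpace ℂ E]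
  {T : ℝ} {H : E →ₗ.[ℂ] E} {u F : L2I E T} {v : ℝ → E}

theorem L2I.integrableOn (u : L2I E T) : IntegrableOn (fun t => u t) (Ioo 0 T) :=
  (Lp.memLp u).integrable (by norm_num)

theorem integrableOn_inner_const (u : L2I E T) (x : E) :
    IntegrableOn (fun t => ⟪u t, x⟫_ℂ) (Ioo 0 T) :=
  integrable_inner_of_continuous u continuous_const

theorem isTestFunction_smul {η : ℝ → ℝ} (hη : ContDiff ℝ 1 η) (hc : HasCompactSupport η)
    (hs : tsupport η ⊆ Ioo 0 T) (x : H.domain) :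
    IsTestFunction T H (fun t => (η t : ℂ) • x) := by
  have h1 : (fun t => (((η t : ℂ) • x : H.domain) : E)) = fun t => η t • (x : E) := by
    ext t; simp
  refine ⟨?_, ?_, ?_, ?_⟩
  · rw [h1]; exact hη.smul contDiff_const
  · have h2 : (fun t => H ((η t : ℂ) • x)) = fun t => η t • H x := by
      ext t; rw [LinearPMap.map_smul]; simp
    rw [h2]
    exact hη.continuous.smul continuous_const
  · rw [h1]; exact hc.smul_right
  · rw [h1]; exact (tsupport_smul_subset_left η _).trans hs

/-- The weak equation tested with `η(t) x`. -/
theorem WeakEq.integral_scalar (h : WeakEq T H (fun _ => 0) u F) {η : ℝ → ℝ}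
    (hη : ContDiff ℝ 1 η) (hc : HasCompactSupport η) (hs : tsupport η ⊆ Ioo 0 T) (x : H.domain) :
    Complex.I * ∫ t in Ioo 0 T, ((deriv η t : ℝ) : ℂ) * ⟪u t, (x : E)⟫_ℂ
      = ∫ t in Ioo 0 T, (η t : ℂ) * (⟪u t, H x⟫_ℂ + ⟪F t, (x : E)⟫_ℂ) := by
  have h1 := h _ (isTestFunction_smul hη hc hs x)
  have hd : ∀ t, deriv (fun s => (η s : ℂ) • (x : E)) t = ((deriv η t : ℝ) : ℂ) • (x : E) := by
    intro t
    have h2 := (((hη.differentiable one_ne_zero) t).hasDerivAt.ofReal_comp.smul_const (x : E)).deriv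
    simpa using h2
  have hbd : ∀ {f : ℝ → ℝ} (hf : Continuous f) (g : L2I E T) (y : E),
      IntegrableOn (fun t => (f t : ℂ) * ⟪g t, y⟫_ℂ) (Ioo 0 T) := by
    intro f hf g y
    have h3 := integrable_inner_of_continuous g
      (show Continuous fun t => (f t : ℂ) • y by fun_prop)
    simpa only [inner_smul_right] using h3
  have i1 := hbd (hη.continuous_deriv le_rfl) u (x : E)
  have i2 := hbd hη.continuous u (H x)
  have i3 := hbd hη.continuous F (x : E)
  simp only [hd, LinearPMap.map_smul, Submodule.coe_smul, zero_apply, sub_zero, inner_sub_right,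
    inner_smul_right] at h1
  rw [integral_sub (i1.const_mul _) i2, integral_const_mul] at h1
  rw [sub_eq_iff_eq_add'.1 h1, ← integral_add i2 i3]
  refine integral_congr_ae (Eventually.of_forall fun t => ?_)
  simp only
  ring

/-- The weak equation on the subinterval `[a, b]`: the test functions `η(t) x` with `η` tending to
the indicator function of `(a, b]` give the boundary values at `a` and `b`. -/
theorem WeakEq.inner_sub_inner (h : WeakEq T H (fun _ => 0) u F) (hv : Continuous v)
    (huv : u =ᵐ[volume.restrict (Ioo 0 T)] v) (x : H.domain) {a b : ℝ} (ha : 0 < a) (hab : a ≤ b)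
    (hb : b < T) :
    Complex.I * (⟪v a, (x : E)⟫_ℂ - ⟪v b, (x : E)⟫_ℂ)
      = ∫ t in a..b, (⟪u t, H x⟫_ℂ + ⟪F t, (x : E)⟫_ℂ) := by
  set r : ℝ → ℂ := fun t => ⟪u t, H x⟫_ℂ + ⟪F t, (x : E)⟫_ℂ
  have hr : IntegrableOn r (Ioo 0 T) :=
    (integrableOn_inner_const u _).add (integrableOn_inner_const F _)
  have hg : Continuous fun t => ⟪v t, (x : E)⟫_ℂ := hv.inner continuous_const
  set η : ℕ → ℝ → ℝ := fun k t => step k a t - step k b t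
  have hη : ∀ k, ContDiff ℝ 1 (η k) := fun k => (contDiff_step k a).sub (contDiff_step k b)
  have hηd : ∀ k t, deriv (η k) t = deriv (step k a) t - deriv (step k b) t := fun k t =>
    deriv_sub ((contDiff_step k a).differentiable one_ne_zero t)
      ((contDiff_step k b).differentiable one_ne_zero t)
  have hη0 : ∀ (k : ℕ) t, t ∉ Icc a (b + 1 / ((k : ℝ) + 1)) → η k t = 0 := by
    intro k t ht
    rw [mem_Icc, not_and_or, not_le, not_le] at ht
    rcases ht with ht | ht
    · simp only [η]
      rw [step_of_le ht.le, step_of_le (ht.le.trans hab), sub_self]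
    · simp only [η]
      rw [step_of_ge ht.le, step_of_ge (by linarith), sub_self]
  have hts : ∀ k : ℕ, tsupport (η k) ⊆ Icc a (b + 1 / ((k : ℝ) + 1)) := fun k =>
    closure_minimal (fun t ht => by_contra fun h' => ht (hη0 k t h')) isClosed_Icc
  have hk : ∀ᶠ k : ℕ in atTop, tsupport (η k) ⊆ Ioo 0 T := by
    filter_upwards [(tendsto_one_div_add_atTop_nhds_zero_nat (𝕜 := ℝ)).eventually_lt_const
      (sub_pos.2 hb)] with k hk t ht
    have := hts k ht
    exact ⟨ha.trans_le this.1, by linarith [this.2]⟩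
  have hl : Tendsto (fun k => Complex.I * ∫ t, ((deriv (η k) t : ℝ) : ℂ) * ⟪v t, (x : E)⟫_ℂ) atTop
      (𝓝 (Complex.I * (⟪v a, (x : E)⟫_ℂ - ⟪v b, (x : E)⟫_ℂ))) := by
    refine Tendsto.const_mul _ (((tendsto_integral_deriv_step hg a).sub
      (tendsto_integral_deriv_step hg b)).congr fun k => ?_)
    rw [← integral_sub (integrable_deriv_step_mul hg k a) (integrable_deriv_step_mul hg k b)]
    simp_rw [hηd]
    push_cast
    simp_rw [sub_mul]
  have hrt : Tendsto (fun k => ∫ t in Ioo 0 T, (η k t : ℂ) * r t) atTop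
      (𝓝 (∫ t in a..b, r t)) := by
    have h1 : ∫ t in a..b, r t = ∫ t in Ioo 0 T, (Ioc a b).indicator r t := by
      rw [intervalIntegral.integral_of_le hab, integral_indicator measurableSet_Ioc,
        Measure.restrict_restrict measurableSet_Ioc, inter_eq_left.2]
      exact fun t ht => ⟨ha.trans ht.1, ht.2.trans_lt hb⟩
    rw [h1]
    refine tendsto_integral_of_dominated_convergence (fun t => ‖r t‖) (fun k => ?_) hr.norm
      (fun k => Eventually.of_forall fun t => ?_) (Eventually.of_forall fun t => ?_)
    · exact (Complex.continuous_ofReal.comp (hη k).continuous).aestronglyMeasurable.mul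
        hr.aestronglyMeasurable
    · rw [norm_mul, Complex.norm_real]
      refine mul_le_of_le_one_left (norm_nonneg _) ?_
      simp only [η, step, Real.norm_eq_abs, abs_le]
      constructor <;>
      linarith [Real.smoothTransition.nonneg (((k : ℝ) + 1) * (t - a)),
        Real.smoothTransition.le_one (((k : ℝ) + 1) * (t - a)),
        Real.smoothTransition.nonneg (((k : ℝ) + 1) * (t - b)),
        Real.smoothTransition.le_one (((k : ℝ) + 1) * (t - b))]
    · have h2 := ((Complex.continuous_ofReal.tendsto _).comp
        ((tendsto_step a t).sub (tendsto_step b t))).mul_const (r t)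
      have h6 : (Ioc a b).indicator r t = (((Ioi a).indicator (fun _ => (1 : ℝ)) t
          - (Ioi b).indicator (fun _ => 1) t : ℝ) : ℂ) * r t := by
        by_cases h3 : t ∈ Ioc a b
        · simp [indicator, h3.1, h3.2.not_gt, h3.2]
        · rw [indicator_of_notMem h3]
          by_cases h4 : a < t
          · have h5 : b < t := not_le.1 fun h => h3 ⟨h4, h⟩
            simp [indicator, h4, h5]
          · have h5 : ¬ b < t := fun h => h4 (hab.trans_lt h)
            simp [indicator, h4, h5]
      rw [h6]
      exact h2
  refine tendsto_nhds_unique hl (hrt.congr' ?_)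
  filter_upwards [hk] with k hk
  rw [← h.integral_scalar (hη k) (HasCompactSupport.intro isCompact_Icc (hη0 k)) hk x]
  congr 1
  rw [← setIntegral_eq_integral_of_forall_compl_eq_zero (s := Ioo 0 T) (f := fun t =>
    ((deriv (η k) t : ℝ) : ℂ) * ⟪v t, (x : E)⟫_ℂ)]
  · refine integral_congr_ae ?_
    filter_upwards [huv] with t ht
    rw [ht]
  · intro t ht
    have : deriv (η k) t = 0 := by
      by_contra h0
      exact ht (hk (support_deriv_subset h0))
    simp [this]

theorem WeakEq.inner_eq_integral (h : WeakEq T H (fun _ => 0) u F) (hT : 0 < T)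
    (hv : Continuous v) (huv : u =ᵐ[volume.restrict (Ioo 0 T)] v) (x : H.domain) {t : ℝ}
    (ht : t ∈ Icc 0 T) :
    Complex.I * (⟪v 0, (x : E)⟫_ℂ - ⟪v t, (x : E)⟫_ℂ)
      = ∫ s in 0..t, (⟪v s, H x⟫_ℂ + ⟪F s, (x : E)⟫_ℂ) := by
  set r : ℝ → ℂ := fun t => ⟪v t, H x⟫_ℂ + ⟪F t, (x : E)⟫_ℂ
  have hr : IntegrableOn r (Icc 0 T) := by
    rw [integrableOn_Icc_iff_integrableOn_Ioo]
    refine Integrable.add ?_ (integrableOn_inner_const F _)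
    exact (integrableOn_inner_const u (H x)).congr (by
      filter_upwards [huv] with s hs
      rw [hs])
  set D : ℝ → ℂ := fun t => Complex.I * ⟪v t, (x : E)⟫_ℂ + ∫ s in 0..t, r s
  have hD : ContinuousOn D (Icc 0 T) := by
    refine ContinuousOn.add (by fun_prop) ?_
    simpa [uIcc_of_le hT.le] using
      intervalIntegral.continuousOn_primitive_interval (a := 0) (b := T) (f := r) (μ := volume)
        (by rwa [uIcc_of_le hT.le])
  have hint : ∀ a ∈ Icc 0 T, ∀ b ∈ Icc 0 T, IntervalIntegrable r volume a b := fun a ha b hb =>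
    (hr.mono_set (uIcc_subset_Icc ha hb)).intervalIntegrable
  have h0 : (0 : ℝ) ∈ Icc 0 T := left_mem_Icc.2 hT.le
  have hconst : ∀ a b : ℝ, 0 < a → a ≤ b → b < T → D a = D b := by
    intro a b ha hab hb
    have h1 := h.inner_sub_inner hv huv x ha hab hb
    have h2 : ∫ t in a..b, (⟪u t, H x⟫_ℂ + ⟪F t, (x : E)⟫_ℂ) = ∫ t in a..b, r t := by
      refine intervalIntegral.integral_congr_ae_restrict ?_
      rw [uIoc_of_le hab]
      have h3 := ae_restrict_of_ae_restrict_of_subset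
        (show Ioc a b ⊆ Ioo 0 T from fun s hs => ⟨ha.trans hs.1, hs.2.trans_lt hb⟩) huv
      filter_upwards [h3] with s hs
      simp only [r]
      rw [hs]
    have ha' : a ∈ Icc 0 T := ⟨ha.le, hab.trans hb.le⟩
    have hb' : b ∈ Icc 0 T := ⟨ha.le.trans hab, hb.le⟩
    rw [h2, ← intervalIntegral.integral_interval_sub_left (hint 0 h0 b hb') (hint 0 h0 a ha')]
      at h1
    simp only [D]
    linear_combination h1
  have hmid : EqOn D (fun _ => D (T / 2)) (Ioo 0 T) := by
    intro s hs
    rcases le_total s (T / 2) with h1 | h1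
    · exact hconst s (T / 2) hs.1 h1 (by linarith)
    · exact (hconst (T / 2) s (by linarith) h1 hs.2).symm
  have hall : EqOn D (fun _ => D (T / 2)) (Icc 0 T) :=
    hmid.of_subset_closure hD continuousOn_const Ioo_subset_Icc_self
      (by rw [closure_Ioo hT.ne])
  have h1 := (hall ht).trans (hall h0).symm
  simp only [D, intervalIntegral.integral_same] at h1
  linear_combination -h1

end Weak

section Mild

variable {E : Type*} [NormedAddCommGroup E] [InnerProductSpace ℂ E] [CompleteSpace E]
  {T : ℝ} {H : E →ₗ.[ℂ] E} {u F : L2I E T} {v : ℝ → E}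

/-- The bounded operator `H J` for the regularization `J = (1 + i H / k)⁻¹`. -/
def yosidaGen (H : E →ₗ.[ℂ] E) (k : ℝ) : E →L[ℂ] E :=
  ((k : ℂ) * Complex.I) • (yosida H k - ContinuousLinearMap.id ℂ E)

omit [CompleteSpace E] in
theorem yosidaGen_apply (H : E →ₗ.[ℂ] E) (k : ℝ) (x : E) :
    yosidaGen H k x = ((k : ℂ) * Complex.I) • (yosida H k x - x) := rfl

theorem inner_yosidaGen_left (hH : IsSelfAdjoint H) {k : ℝ} (hk : k ≠ 0) (x y : E) :
    ⟪yosidaGen H k x, y⟫_ℂ = ⟪x, yosidaGen H (-k) y⟫_ℂ := by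
  simp only [yosidaGen_apply, inner_smul_left, inner_smul_right, inner_sub_left, inner_sub_right,
    inner_yosida_left hH hk]
  simp

omit [CompleteSpace E] in
theorem L2I.intervalIntegrable (F : L2I E T) {t : ℝ} (ht : t ∈ Icc 0 T) :
    IntervalIntegrable (fun s => F s) volume 0 t := by
  have h1 := F.integrableOn
  rw [← integrableOn_Ioc_iff_integrableOn_Ioo] at h1
  rw [intervalIntegrable_iff_integrableOn_Ioc_of_le ht.1]
  exact h1.mono_set (Ioc_subset_Ioc_right ht.2)

/-- The regularization `J v` of a weak solution is absolutely continuous, with derivative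
`-i (H J v + J F)`. -/
theorem WeakEq.yosida_eq_integral (h : WeakEq T H (fun _ => 0) u F) (hH : IsSelfAdjoint H)
    (hT : 0 < T) (hv : Continuous v) (huv : u =ᵐ[volume.restrict (Ioo 0 T)] v) {k : ℝ}
    (hk : k ≠ 0) {t : ℝ} (ht : t ∈ Icc 0 T) :
    yosida H k (v t) = yosida H k (v 0)
      + ∫ s in 0..t, -Complex.I • (yosidaGen H k (v s) + yosida H k (F s)) := by
  have hi : IntervalIntegrable (fun s => yosidaGen H k (v s) + yosida H k (F s)) volume 0 t := by
    have h1 := F.intervalIntegrable ht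
    rw [intervalIntegrable_iff] at h1
    refine IntervalIntegrable.add (Continuous.intervalIntegrable (by fun_prop) _ _) ?_
    rw [intervalIntegrable_iff]
    exact (yosida H k).integrable_comp h1
  rw [← sub_eq_iff_eq_add', intervalIntegral.integral_smul]
  refine ext_inner_right ℂ fun y => ?_
  have hk' : -k ≠ 0 := neg_ne_zero.2 hk
  have h1 := h.inner_eq_integral hT hv huv ⟨_, yosida_mem_domain hH hk' y⟩ ht
  rw [apply_yosida hH hk' y] at h1
  change _ = ∫ s in 0..t, (⟪v s, yosidaGen H (-k) y⟫_ℂ + ⟪F s, yosida H (-k) y⟫_ℂ) at h1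
  simp only [← inner_yosidaGen_left hH hk, ← inner_yosida_left hH hk, ← inner_add_left] at h1
  have h2 : ∫ s in 0..t, ⟪yosidaGen H k (v s) + yosida H k (F s), y⟫_ℂ
      = ⟪∫ s in 0..t, (yosidaGen H k (v s) + yosida H k (F s)), y⟫_ℂ := by
    rw [intervalIntegral.integral_of_le ht.1, intervalIntegral.integral_of_le ht.1]
    rw [intervalIntegrable_iff_integrableOn_Ioc_of_le ht.1] at hi
    rw [← inner_conj_symm, ← integral_inner hi, ← integral_conj]
    simp only [inner_conj_symm]
  rw [h2] at h1
  rw [inner_sub_left, inner_smul_left, ← h1]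
  simp only [map_neg, Complex.conj_I, neg_neg]
  linear_combination (⟪yosida H k (v t), y⟫_ℂ - ⟪yosida H k (v 0), y⟫_ℂ) * Complex.I_mul_I

end Mild

/-! ### The energy inequality -/

section Energy

theorem inner_self_eq_ofReal {F : Type*} [NormedAddCommGroup F] [InnerProductSpace ℂ F] (x : F) :
    ⟪x, x⟫_ℂ = ((‖x‖ ^ 2 : ℝ) : ℂ) := by
  rw [inner_self_eq_norm_sq_to_K]; simp

theorem Lp_norm_sq_eq_integral {E : Type*} [NormedAddCommGroup E] [InnerProductSpace ℂ E]
    {μ : Measure ℝ} (f : Lp E 2 μ) : ‖f‖ ^ 2 = ∫ t, ‖f t‖ ^ 2 ∂μ := by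
  have h := L2.inner_def (𝕜 := ℂ) f f
  simp only [inner_self_eq_ofReal] at h
  exact Complex.ofReal_injective (h.trans integral_complex_ofReal)

theorem tendsto_yosida_natCast {E : Type*} [NormedAddCommGroup E] [InnerProductSpace ℂ E]
    [CompleteSpace E] {H : E →ₗ.[ℂ] E} (hH : IsSelfAdjoint H) (x : E) :
    Tendsto (fun n : ℕ => yosida H (n + 1) x) atTop (𝓝 x) := by
  refine (tendsto_yosida hH x).comp ?_
  have h : Tendsto (fun n : ℕ => (n : ℝ) + 1) atTop atTop :=
    tendsto_atTop_add_const_right _ _ tendsto_natCast_atTop_atTop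
  exact h.mono_right ((IsOrderBornology.cobounded_eq (α := ℝ)) ▸ le_sup_right)

theorem tendsto_yosida_neg_natCast {E : Type*} [NormedAddCommGroup E] [InnerProductSpace ℂ E]
    [CompleteSpace E] {H : E →ₗ.[ℂ] E} (hH : IsSelfAdjoint H) (x : E) :
    Tendsto (fun n : ℕ => yosida H (-(n + 1)) x) atTop (𝓝 x) := by
  refine (tendsto_yosida hH x).comp ?_
  have h : Tendsto (fun n : ℕ => -((n : ℝ) + 1)) atTop atBot :=
    tendsto_neg_atTop_atBot.comp
      (tendsto_atTop_add_const_right _ _ tendsto_natCast_atTop_atTop)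
  exact h.mono_right ((IsOrderBornology.cobounded_eq (α := ℝ)) ▸ le_sup_left)

variable {E : Type*} [NormedAddCommGroup E] [InnerProductSpace ℂ E]
  {T : ℝ} {H : E →ₗ.[ℂ] E} {u F : L2I E T} {v : ℝ → E}

theorem L2I.integral_norm_le (hT : 0 < T) (f : L2I E T) :
    ∫ t in Ioo 0 T, ‖f t‖ ≤ √T * ‖f‖ := by
  set S := ∫ t in Ioo 0 T, ‖f t‖
  have hS : 0 ≤ S := integral_nonneg fun _ => norm_nonneg _
  have i1 : IntegrableOn (fun t => ‖f t‖) (Ioo 0 T) := f.integrableOn.norm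
  have i2 : IntegrableOn (fun t => ‖f t‖ ^ 2) (Ioo 0 T) :=
    (Lp.memLp f).integrable_norm_pow (by simp)
  -- the variance of `‖f‖` is nonnegative
  have h1 : 0 ≤ ∫ t in Ioo 0 T, (‖f t‖ - S / T) ^ 2 := integral_nonneg fun _ => sq_nonneg _
  have h2 : ∫ t in Ioo 0 T, (‖f t‖ - S / T) ^ 2 = ‖f‖ ^ 2 - S ^ 2 / T := by
    have h3 : ∀ t, (‖f t‖ - S / T) ^ 2 = ‖f t‖ ^ 2 - 2 * (S / T) * ‖f t‖ + (S / T) ^ 2 :=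
      fun t => by ring
    simp_rw [h3]
    have i3 : IntegrableOn (fun t => ‖f t‖ ^ 2 - 2 * (S / T) * ‖f t‖) (Ioo 0 T) :=
      i2.sub (i1.const_mul _)
    rw [integral_add i3 (integrable_const _),
      integral_sub i2 (i1.const_mul _), integral_const_mul, Lp_norm_sq_eq_integral]
    simp only [integral_const, measureReal_restrict_apply_univ, Real.volume_real_Ioo_of_le hT.le,
      smul_eq_mul]
    change _ - 2 * (S / T) * S + _ = _
    field_simp
    ring
  rw [h2, sub_nonneg, div_le_iff₀ hT] at h1
  refine abs_le_of_sq_le_sq' ?_ (by positivity) |>.2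
  rw [mul_pow, Real.sq_sqrt hT.le]
  linarith

variable [CompleteSpace E]

theorem re_inner_yosida_yosidaGen (hH : IsSelfAdjoint H) {k : ℝ} (hk : k ≠ 0) (x : E) :
    (⟪yosida H k x, -Complex.I • yosidaGen H k x⟫_ℂ).re = 0 := by
  have h1 := isFormalAdjoint_self hH ⟨_, yosida_mem_domain hH hk x⟩ ⟨_, yosida_mem_domain hH hk x⟩
  rw [apply_yosida hH hk] at h1
  have h2 : conj ⟪yosida H k x, yosidaGen H k x⟫_ℂ = ⟪yosida H k x, yosidaGen H k x⟫_ℂ := by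
    rw [inner_conj_symm]
    exact h1
  have h3 := congrArg Complex.im h2
  rw [Complex.conj_im] at h3
  rw [inner_smul_right]
  simp only [Complex.mul_re, Complex.neg_re, Complex.neg_im, Complex.I_re, Complex.I_im]
  linarith

/-- The energy identity for weak solutions of `(i∂ₜ - H) u = F`. -/
theorem WeakEq.norm_sq_sub_norm_sq (h : WeakEq T H (fun _ => 0) u F) (hH : IsSelfAdjoint H)
    (hT : 0 < T) (hv : Continuous v) (huv : u =ᵐ[volume.restrict (Ioo 0 T)] v) {t : ℝ}
    (ht : t ∈ Icc 0 T) :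
    ‖v t‖ ^ 2 - ‖v 0‖ ^ 2 = ∫ s in 0..t, 2 * (⟪v s, -Complex.I • F s⟫_ℂ).re := by
  have hF := F.intervalIntegrable ht
  have hn : ∀ n : ℕ, ((n : ℝ) + 1) ≠ 0 := fun n => by positivity
  have h1 : ∀ n : ℕ, ∫ s in 0..t,
      2 * (⟪yosida H (n + 1) (v s), -Complex.I • yosida H (n + 1) (F s)⟫_ℂ).re
        = ‖yosida H (n + 1) (v t)‖ ^ 2 - ‖yosida H (n + 1) (v 0)‖ ^ 2 := by
    intro n
    have hi : IntervalIntegrable (fun s => -Complex.I • (yosidaGen H (n + 1) (v s)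
        + yosida H (n + 1) (F s))) volume 0 t := by
      rw [intervalIntegrable_iff] at hF
      refine IntervalIntegrable.smul
        (IntervalIntegrable.add (Continuous.intervalIntegrable (by fun_prop) _ _) ?_) _
      rw [intervalIntegrable_iff]
      exact (yosida H (n + 1)).integrable_comp hF
    rw [← integral_norm_sq_primitive ht.1 hi
      (w := fun s => yosida H (n + 1) (v s)) fun s hs =>
        h.yosida_eq_integral hH hT hv huv (hn n) ⟨hs.1, hs.2.trans ht.2⟩]
    refine intervalIntegral.integral_congr fun s _ => ?_
    simp only [smul_add, inner_add_right, Complex.add_re, re_inner_yosida_yosidaGen hH (hn n),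
      zero_add]
  have h2 : Tendsto (fun n : ℕ => ‖yosida H (n + 1) (v t)‖ ^ 2 - ‖yosida H (n + 1) (v 0)‖ ^ 2)
      atTop (𝓝 (‖v t‖ ^ 2 - ‖v 0‖ ^ 2)) :=
    ((tendsto_yosida_natCast hH _).norm.pow 2).sub ((tendsto_yosida_natCast hH _).norm.pow 2)
  refine tendsto_nhds_unique h2 (Tendsto.congr h1 ?_)
  obtain ⟨C, hC⟩ := isCompact_Icc.exists_bound_of_continuousOn (hv.continuousOn (s := Icc 0 t))
  rw [intervalIntegrable_iff] at hF
  refine intervalIntegral.tendsto_integral_filter_of_dominated_convergence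
    (fun s => 2 * (C * ‖F s‖)) (Eventually.of_forall fun n => ?_)
    (Eventually.of_forall fun n => Eventually.of_forall fun s hs => ?_) ?_
    (Eventually.of_forall fun s hs => ?_)
  · refine AEStronglyMeasurable.const_mul ?_ 2
    refine Complex.continuous_re.comp_aestronglyMeasurable (AEStronglyMeasurable.inner
      (Continuous.aestronglyMeasurable (by fun_prop)) (AEStronglyMeasurable.const_smul ?_ _))
    exact (yosida H (n + 1)).continuous.comp_aestronglyMeasurable hF.aestronglyMeasurable
  · rw [Real.norm_eq_abs, abs_mul, abs_two]
    rw [uIoc_of_le ht.1] at hs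
    refine mul_le_mul_of_nonneg_left ?_ zero_le_two
    refine (Complex.abs_re_le_norm _).trans ((norm_inner_le_norm _ _).trans ?_)
    rw [norm_smul, norm_neg, Complex.norm_I, one_mul]
    have h3 := hC s (Ioc_subset_Icc_self hs)
    exact mul_le_mul ((norm_yosida_apply_le hH (hn n) _).trans h3)
      (norm_yosida_apply_le hH (hn n) _) (norm_nonneg _) ((norm_nonneg _).trans h3)
  · rw [intervalIntegrable_iff]
    exact (hF.norm.const_mul C).const_mul 2
  · refine Tendsto.const_mul 2 ((Complex.continuous_re.tendsto _).comp ?_)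
    exact (tendsto_yosida_natCast hH _).inner ((tendsto_yosida_natCast hH _).const_smul _)

/-- The energy inequality. The right-hand side `F` of the equation may differ from `f` by a term
that does not contribute to the derivative of `‖v‖²`. -/
theorem WeakEq.norm_le (h : WeakEq T H (fun _ => 0) u F) (hH : IsSelfAdjoint H)
    (hT : 0 < T) (hv : Continuous v) (huv : u =ᵐ[volume.restrict (Ioo 0 T)] v) (f : L2I E T)
    (hf : ∀ᵐ t ∂volume.restrict (Ioo 0 T),
      (⟪v t, -Complex.I • F t⟫_ℂ).re = (⟪v t, -Complex.I • f t⟫_ℂ).re)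
    {t : ℝ} (ht : t ∈ Icc 0 T) : ‖v t‖ ≤ ‖v 0‖ + 2 * (√T * ‖f‖) := by
  obtain ⟨τ, hτ, hmax⟩ := isCompact_Icc.exists_isMaxOn (nonempty_Icc.2 hT.le)
    (hv.norm.continuousOn (s := Icc 0 T))
  have hmax' : ∀ s ∈ Icc 0 T, ‖v s‖ ≤ ‖v τ‖ := fun s hs => hmax hs
  have h1 := h.norm_sq_sub_norm_sq hH hT hv huv hτ
  have h2 : ∫ s in 0..τ, 2 * (⟪v s, -Complex.I • F s⟫_ℂ).re
      ≤ ∫ s in Ioo 0 T, 2 * ‖v τ‖ * ‖f s‖ := by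
    have hle : Ioo 0 τ ⊆ Ioo 0 T := Ioo_subset_Ioo_right hτ.2
    have hi : IntegrableOn (fun s => 2 * ‖v τ‖ * ‖f s‖) (Ioo 0 T) := f.integrableOn.norm.const_mul _
    rw [intervalIntegral.integral_of_le hτ.1, integral_Ioc_eq_integral_Ioo]
    refine le_trans ?_ (setIntegral_mono_set hi (Eventually.of_forall fun s => by
      simp only [Pi.zero_apply]; positivity) hle.eventuallyLE)
    by_cases hint : IntegrableOn (fun s => 2 * (⟪v s, -Complex.I • F s⟫_ℂ).re) (Ioo 0 τ)
    · refine integral_mono_ae hint (hi.mono_set hle) ?_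
      filter_upwards [ae_restrict_of_ae_restrict_of_subset hle hf,
        ae_restrict_mem measurableSet_Ioo] with s hs hs'
      rw [hs, mul_assoc]
      refine mul_le_mul_of_nonneg_left ?_ zero_le_two
      refine (Complex.re_le_norm _).trans ((norm_inner_le_norm _ _).trans ?_)
      rw [norm_smul, norm_neg, Complex.norm_I, one_mul]
      exact mul_le_mul_of_nonneg_right (hmax' s (Ioo_subset_Icc_self (hle hs'))) (norm_nonneg _)
    · -- the integral over `(0, τ)` has the value zero by convention
      rw [integral_undef hint]
      exact integral_nonneg fun s => by positivity
  rw [integral_const_mul] at h2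
  have h3 := L2I.integral_norm_le hT f
  have h4 : ‖v τ‖ ^ 2 ≤ ‖v τ‖ * (‖v 0‖ + 2 * (√T * ‖f‖)) := by
    have h5 := hmax' 0 (left_mem_Icc.2 hT.le)
    nlinarith [norm_nonneg (v τ), norm_nonneg (v 0),
      mul_le_mul_of_nonneg_left h3 (norm_nonneg (v τ))]
  refine (hmax' t ht).trans ?_
  rcases eq_or_lt_of_le (norm_nonneg (v τ)) with h0 | h0
  · rw [← h0]; positivity
  · rw [pow_two] at h4
    exact le_of_mul_le_mul_left h4 h0

end Energy

/-! ### Approximate evolutions -/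

section Flow

variable {E : Type*} [NormedAddCommGroup E] [InnerProductSpace ℂ E] [CompleteSpace E]
  {H : E →ₗ.[ℂ] E} {k : ℝ}

/-- The contraction semigroup `exp (τ |k| (J - 1))` with `J = (1 + i H / k)⁻¹`. For large `|k|` it
approximates `exp (-iτH)` if `k > 0`, and `exp (iτH)` if `k < 0`. -/
def yosidaFlow (H : E →ₗ.[ℂ] E) (k τ : ℝ) : E →L[ℂ] E :=
  NormedSpace.exp (τ • ((|k| : ℝ) • (yosida H k - ContinuousLinearMap.id ℂ E)))

theorem yosidaFlow_zero (H : E →ₗ.[ℂ] E) (k : ℝ) (x : E) : yosidaFlow H k 0 x = x := by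
  rw [yosidaFlow, zero_smul, NormedSpace.exp_zero]
  rfl

theorem hasDerivAt_yosidaFlow (H : E →ₗ.[ℂ] E) (k τ : ℝ) (x : E) :
    HasDerivAt (fun τ => yosidaFlow H k τ x)
      (|k| • (yosida H k (yosidaFlow H k τ x) - yosidaFlow H k τ x)) τ := by
  have h := hasDerivAt_exp_smul_const' (𝕂 := ℝ)
    ((|k| : ℝ) • (yosida H k - ContinuousLinearMap.id ℂ E)) τ
  exact ((ContinuousLinearMap.apply ℂ E x).restrictScalars ℝ).hasFDerivAt.comp_hasDerivAt τ h

theorem yosidaFlow_commute {B : E →L[ℂ] E} (hB : Commute B (yosida H k)) (τ : ℝ) (x : E) :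
    B (yosidaFlow H k τ x) = yosidaFlow H k τ (B x) := by
  have h1 : Commute B (yosida H k - ContinuousLinearMap.id ℂ E) :=
    hB.sub_right (Commute.one_right B)
  have h2 : Commute B (yosidaFlow H k τ) := ((h1.smul_right |k|).smul_right τ).exp_right
  exact congrArg (fun S : E →L[ℂ] E => S x) h2

theorem norm_yosidaFlow_le (hH : IsSelfAdjoint H) (hk : k ≠ 0) {τ : ℝ} (hτ : 0 ≤ τ) (x : E) :
    ‖yosidaFlow H k τ x‖ ≤ ‖x‖ := by
  let : InnerProductSpace ℝ E := InnerProductSpace.rclikeToReal ℂ E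
  have hd : ∀ s, HasDerivAt (fun τ => ‖yosidaFlow H k τ x‖ ^ 2) _ s := fun s =>
    (hasDerivAt_yosidaFlow H k s x).norm_sq
  have h1 : Antitone fun τ => ‖yosidaFlow H k τ x‖ ^ 2 := by
    refine antitone_of_deriv_nonpos (fun s => (hd s).differentiableAt) fun s => ?_
    rw [(hd s).deriv, inner_smul_right, inner_sub_right, real_inner_self_eq_norm_sq]
    have h2 := real_inner_le_norm (yosidaFlow H k s x) (yosida H k (yosidaFlow H k s x))
    have h3 := mul_le_mul_of_nonneg_left (norm_yosida_apply_le hH hk (yosidaFlow H k s x))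
      (norm_nonneg (yosidaFlow H k s x))
    have h4 := mul_nonneg (abs_nonneg k) (show 0 ≤ ‖yosidaFlow H k s x‖ ^ 2
      - inner ℝ (yosidaFlow H k s x) (yosida H k (yosidaFlow H k s x)) by nlinarith)
    linarith
  have h2 := h1 hτ
  simp only [yosidaFlow_zero] at h2
  exact le_of_sq_le_sq h2 (norm_nonneg x)

theorem continuous_yosidaFlow (H : E →ₗ.[ℂ] E) (k : ℝ) (x : E) :
    Continuous fun τ => yosidaFlow H k τ x :=
  continuous_iff_continuousAt.2 fun τ => (hasDerivAt_yosidaFlow H k τ x).continuousAt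

end Flow

/-! ### Functions defined piecewise on the line -/

section Glue

variable {F : Type*} {T : ℝ} {a b c : ℝ → F}

/-- The function that agrees with `a` on `(-∞, 0]`, with `b` on `(0, T]` and with `c` on
`(T, ∞)`. -/
def glue (T : ℝ) (a b c : ℝ → F) (t : ℝ) : F := if t ≤ 0 then a t else if t ≤ T then b t else c t

theorem glue_left {t : ℝ} (h : t ≤ 0) : glue T a b c t = a t := if_pos h

theorem glue_mid {t : ℝ} (h : t ∈ Ioc 0 T) : glue T a b c t = b t := by
  rw [glue, if_neg h.1.not_ge, if_pos h.2]

theorem glue_right (hT : 0 ≤ T) {t : ℝ} (h : T < t) : glue T a b c t = c t := by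
  rw [glue, if_neg (hT.trans_lt h).not_ge, if_neg h.not_ge]

variable [NormedAddCommGroup F]

theorem memLp_glue (hT : 0 ≤ T) (ha : MemLp a 2 (volume.restrict (Iic 0)))
    (hb : MemLp b 2 (volume.restrict (Ioc 0 T))) (hc : MemLp c 2 (volume.restrict (Ioi T))) :
    MemLp (glue T a b c) 2 := by
  have h := (((memLp_indicator_iff_restrict measurableSet_Iic).2 ha).add
    ((memLp_indicator_iff_restrict measurableSet_Ioc).2 hb)).add
    ((memLp_indicator_iff_restrict measurableSet_Ioi).2 hc)
  convert h using 1
  ext t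
  simp only [Pi.add_apply]
  rcases le_or_gt t 0 with h0 | h0
  · simp [glue_left h0, indicator, h0, h0.not_gt, (h0.trans hT).not_gt]
  · rcases le_or_gt t T with h1 | h1
    · simp [glue_mid (show t ∈ Ioc 0 T from ⟨h0, h1⟩), indicator, h0, h1, h0.not_ge, h1.not_gt]
    · simp [glue_right hT h1, indicator, h0, h1, h0.not_ge, h1.not_ge]

theorem integral_eq_three {g : ℝ → ℝ} (hT : 0 ≤ T) (hg : Integrable g) :
    ∫ t, g t = (∫ t in Iic 0, g t) + (∫ t in Ioc 0 T, g t) + ∫ t in Ioi T, g t := by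
  rw [← intervalIntegral.integral_Iic_add_Ioi (b := 0) hg.integrableOn hg.integrableOn, add_assoc]
  congr 1
  rw [← setIntegral_union (Ioc_disjoint_Ioi le_rfl) measurableSet_Ioi hg.integrableOn
    hg.integrableOn, Ioc_union_Ioi_eq_Ioi hT]

variable [NormedSpace ℝ F] [CompleteSpace F]

omit [CompleteSpace F] in
theorem glue_primitive {a' b' c' : ℝ → F} (hT : 0 ≤ T)
    (hint : LocallyIntegrable (glue T a' b' c'))
    (h0 : a 0 = b 0) (h1 : b T = c T)
    (ha : ∀ t ≤ 0, a 0 - a t = ∫ s in t..0, a' s)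
    (hb : ∀ t ∈ Icc 0 T, b t - b 0 = ∫ s in 0..t, b' s)
    (hc : ∀ t, T ≤ t → c t - c T = ∫ s in T..t, c' s) (s t : ℝ) :
    glue T a b c t = glue T a b c s + ∫ r in s..t, glue T a' b' c' r := by
  have hi : ∀ x y, IntervalIntegrable (glue T a' b' c') volume x y := fun x y =>
    (hint.integrableOn_isCompact isCompact_uIcc).intervalIntegrable
  have hmid : ∀ t ∈ Icc 0 T, ∫ r in 0..t, glue T a' b' c' r = b t - b 0 := by
    intro t ht
    rw [hb t ht]
    refine intervalIntegral.integral_congr_ae (Eventually.of_forall fun r hr => ?_)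
    rw [uIoc_of_le ht.1] at hr
    exact glue_mid ⟨hr.1, hr.2.trans ht.2⟩
  have key : ∀ t, glue T a b c t = a 0 + ∫ r in 0..t, glue T a' b' c' r := by
    intro t
    rcases le_or_gt t 0 with ht | ht
    · have h2 : ∫ r in t..0, glue T a' b' c' r = ∫ r in t..0, a' r := by
        refine intervalIntegral.integral_congr_ae (Eventually.of_forall fun r hr => ?_)
        rw [uIoc_of_le ht] at hr
        exact glue_left hr.2
      rw [glue_left ht, intervalIntegral.integral_symm, h2, ← ha t ht]
      abel
    · rcases le_or_gt t T with h2 | h2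
      · rw [glue_mid ⟨ht, h2⟩, hmid t ⟨ht.le, h2⟩, h0]
        abel
      · have h3 : ∫ r in T..t, glue T a' b' c' r = ∫ r in T..t, c' r := by
          refine intervalIntegral.integral_congr_ae (Eventually.of_forall fun r hr => ?_)
          rw [uIoc_of_le h2.le] at hr
          exact glue_right hT hr.1
        rw [glue_right hT h2, ← intervalIntegral.integral_add_adjacent_intervals (hi 0 T) (hi T t),
          hmid T ⟨hT, le_rfl⟩, h3, ← hc t h2.le, h0, h1]
        abel
  rw [key s, key t, add_assoc, intervalIntegral.integral_add_adjacent_intervals (hi 0 s) (hi s t)]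

end Glue

/-! ### The smoothing estimate for regularized solutions -/

section Decay

theorem integrableOn_exp_sq_Iic {ε : ℝ} (hε : 0 < ε) :
    IntegrableOn (fun t : ℝ => Real.exp (ε * t) ^ 2) (Iic 0) := by
  have h : (fun t : ℝ => Real.exp (ε * t) ^ 2) = fun t => Real.exp (2 * ε * t) := by
    ext t; rw [← Real.exp_nat_mul]; congr 1; push_cast; ring
  rw [h]
  exact integrableOn_exp_mul_Iic (by positivity) 0

theorem integral_exp_sq_Iic {ε : ℝ} (hε : 0 < ε) :
    ∫ t in Iic (0 : ℝ), Real.exp (ε * t) ^ 2 = 1 / (2 * ε) := by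
  have h : (fun t : ℝ => Real.exp (ε * t) ^ 2) = fun t => Real.exp (2 * ε * t) := by
    ext t; rw [← Real.exp_nat_mul]; congr 1; push_cast; ring
  rw [h, integral_exp_mul_Iic (by positivity)]
  simp

theorem exp_sq_eq (ε T t : ℝ) :
    Real.exp (-(ε * (t - T))) ^ 2 = Real.exp (2 * ε * T) * Real.exp (-(2 * ε) * t) := by
  rw [← Real.exp_nat_mul, ← Real.exp_add]; congr 1; push_cast; ring

theorem integrableOn_exp_sq_Ioi {ε : ℝ} (hε : 0 < ε) (T : ℝ) :
    IntegrableOn (fun t : ℝ => Real.exp (-(ε * (t - T))) ^ 2) (Ioi T) := by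
  simp_rw [exp_sq_eq]
  exact (integrableOn_exp_mul_Ioi (by linarith) T).const_mul _

theorem integral_exp_sq_Ioi {ε : ℝ} (hε : 0 < ε) (T : ℝ) :
    ∫ t in Ioi T, Real.exp (-(ε * (t - T))) ^ 2 = 1 / (2 * ε) := by
  simp_rw [exp_sq_eq]
  rw [integral_const_mul, integral_exp_mul_Ioi (by linarith), neg_div_neg_eq, ← mul_div_assoc,
    ← Real.exp_add]
  simp

variable {E : Type*} [NormedAddCommGroup E] [InnerProductSpace ℂ E]

theorem memLp_of_norm_le_mul {F : Type*} [NormedAddCommGroup F] {q : ℝ → F} {e : ℝ → ℝ}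
    {s : Set ℝ} {C : ℝ} (hs : MeasurableSet s) (hq : AEStronglyMeasurable q (volume.restrict s))
    (he : Continuous e) (hei : IntegrableOn (fun t => e t ^ 2) s)
    (hle : ∀ t ∈ s, ‖q t‖ ≤ C * ‖e t‖) : MemLp q 2 (volume.restrict s) := by
  have h1 : MemLp e 2 (volume.restrict s) :=
    (memLp_two_iff_integrable_sq he.aestronglyMeasurable).2 hei
  refine h1.of_le_mul (c := C) hq ?_
  filter_upwards [ae_restrict_mem hs] with t ht using hle t ht

theorem setIntegral_norm_sq_le_mul {F : Type*} [NormedAddCommGroup F] {q : ℝ → F} {e : ℝ → ℝ}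
    {s : Set ℝ} {C : ℝ} (hs : MeasurableSet s)
    (hei : IntegrableOn (fun t => e t ^ 2) s)
    (hle : ∀ t ∈ s, ‖q t‖ ≤ C * e t) :
    ∫ t in s, ‖q t‖ ^ 2 ≤ C ^ 2 * ∫ t in s, e t ^ 2 := by
  rw [← integral_const_mul]
  refine integral_mono_of_nonneg (Eventually.of_forall fun _ => sq_nonneg _) (hei.const_mul _) ?_
  filter_upwards [ae_restrict_mem hs] with t ht
  have := hle t ht
  change _ ≤ C ^ 2 * e t ^ 2
  rw [← mul_pow]
  exact pow_le_pow_left₀ (norm_nonneg _) this 2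

variable [CompleteSpace E] {H : E →ₗ.[ℂ] E} {σ ε κ t₀ : ℝ} {x : E}

/-- The approximate evolution of `x`, started at time `t₀` in the direction of the sign `σ` and
damped by a factor `exp (-ε |t - t₀|)`. -/
def decay (H : E →ₗ.[ℂ] E) (σ ε κ t₀ : ℝ) (x : E) (t : ℝ) : E :=
  Real.exp (-(ε * (σ * (t - t₀)))) • yosidaFlow H κ (σ * (t - t₀)) x

theorem decay_self (H : E →ₗ.[ℂ] E) (σ ε κ t₀ : ℝ) (x : E) : decay H σ ε κ t₀ x t₀ = x := by
  simp [decay, yosidaFlow_zero]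

theorem hasDerivAt_decay (hσ : σ * |κ| = κ) (t : ℝ) :
    HasDerivAt (decay H σ ε κ t₀ x)
      (-(ε * σ) • decay H σ ε κ t₀ x t - Complex.I • yosidaGen H κ (decay H σ ε κ t₀ x t)) t := by
  have h0 : HasDerivAt (fun t => σ * (t - t₀)) σ t := by
    simpa using ((hasDerivAt_id t).sub_const t₀).const_mul σ
  have h1 : HasDerivAt (fun t => Real.exp (-(ε * (σ * (t - t₀)))))
      (Real.exp (-(ε * (σ * (t - t₀)))) * -(ε * σ)) t := (h0.const_mul ε).fun_neg.exp
  have h2 : HasDerivAt (fun t => yosidaFlow H κ (σ * (t - t₀)) x)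
      (κ • (yosida H κ (yosidaFlow H κ (σ * (t - t₀)) x) - yosidaFlow H κ (σ * (t - t₀)) x)) t := by
    have h3 := (hasDerivAt_yosidaFlow H κ (σ * (t - t₀)) x).scomp t h0
    rwa [smul_smul, hσ] at h3
  refine (h1.fun_smul h2).congr_deriv ?_
  simp only [decay, yosidaGen_apply]
  set e := Real.exp (-(ε * (σ * (t - t₀))))
  set q := yosidaFlow H κ (σ * (t - t₀)) x
  have h3 : yosida H κ (e • q) = e • yosida H κ q :=
    (yosida H κ).map_smul_of_tower e q
  rw [h3, ← smul_sub e, smul_smul Complex.I,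
    show Complex.I * ((κ : ℂ) * Complex.I) = ((-κ : ℝ) : ℂ) by
      push_cast; linear_combination (κ : ℂ) * Complex.I_mul_I, Complex.coe_smul]
  module

theorem norm_apply_decay_le (hH : IsSelfAdjoint H) (hκ : κ ≠ 0) {B : E →L[ℂ] E}
    (hB : Commute B (yosida H κ)) {t : ℝ} (ht : 0 ≤ σ * (t - t₀)) :
    ‖B (decay H σ ε κ t₀ x t)‖ ≤ Real.exp (-(ε * (σ * (t - t₀)))) * ‖B x‖ := by
  rw [decay, B.map_smul_of_tower, norm_smul, Real.norm_eq_abs, Real.abs_exp, yosidaFlow_commute hB]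
  exact mul_le_mul_of_nonneg_left (norm_yosidaFlow_le hH hκ ht _) (Real.exp_nonneg _)

theorem continuous_decay (H : E →ₗ.[ℂ] E) (σ ε κ t₀ : ℝ) (x : E) :
    Continuous (decay H σ ε κ t₀ x) := by
  have h := (continuous_yosidaFlow H κ x).comp (show Continuous fun t => σ * (t - t₀) by fun_prop)
  exact (show Continuous fun t => Real.exp (-(ε * (σ * (t - t₀)))) by fun_prop).smul h

/-- Bounded operators `R` and `K = H R` that commute with the regularizations `J` of `H`. The
relation `K = H R` is recorded in the form `R (H J) = J K`, between bounded operators. -/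
structure IsRegularizer (H : E →ₗ.[ℂ] E) (R K : E →L[ℂ] E) : Prop where
  comm : ∀ κ : ℝ, κ ≠ 0 → Commute R (yosida H κ)
  comm' : ∀ κ : ℝ, κ ≠ 0 → Commute K (yosida H κ)
  gen : ∀ κ : ℝ, κ ≠ 0 → ∀ x, R (yosidaGen H κ x) = yosida H κ (K x)

theorem isRegularizer_yosida (hH : IsSelfAdjoint H) {k : ℝ} (hk : k ≠ 0) :
    IsRegularizer H (yosida H k) (yosidaGen H k) := by
  have hc : ∀ κ : ℝ, κ ≠ 0 → ∀ x, yosida H k (yosida H κ x) = yosida H κ (yosida H k x) :=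
    fun κ hκ x => congrArg (fun S : E →L[ℂ] E => S x) (commute_yosida hH hk hκ)
  refine ⟨fun κ hκ => commute_yosida hH hk hκ, fun κ hκ => ?_, fun κ hκ x => ?_⟩
  · exact ((commute_yosida hH hk hκ).sub_left (Commute.one_left _)).smul_left _
  · have h1 : ∀ {l m : ℝ} (hl : l ≠ 0) (hm : m ≠ 0) (y : E),
        yosida H l (yosidaGen H m y) = yosidaGen H m (yosida H l y) := by
      intro l m hl hm y
      have h := congrArg (fun S : E →L[ℂ] E => S y) (commute_yosida hH hl hm)
      replace h : yosida H l (yosida H m y) = yosida H m (yosida H l y) := h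
      rw [yosidaGen_apply, yosidaGen_apply, map_smul, map_sub, h]
    rw [h1 hk hκ, h1 hκ hk]
    have h2 := apply_yosida hH hk (yosida H κ x)
    have h3 := apply_yosida hH hκ (yosida H k x)
    have h4 : (⟨yosida H k (yosida H κ x), yosida_mem_domain hH hk _⟩ : H.domain)
        = ⟨yosida H κ (yosida H k x), yosida_mem_domain hH hκ _⟩ := Subtype.ext (hc κ hκ x)
    rw [h4, h3] at h2
    exact h2

omit [CompleteSpace E] in
theorem IsRegularizer.sub {R K R' K' : E →L[ℂ] E} (h : IsRegularizer H R K)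
    (h' : IsRegularizer H R' K') : IsRegularizer H (R - R') (K - K') :=
  ⟨fun κ hκ => (h.comm κ hκ).sub_left (h'.comm κ hκ),
    fun κ hκ => (h.comm' κ hκ).sub_left (h'.comm' κ hκ),
    fun κ hκ x => by
      simp only [sub_apply, h.gen κ hκ, h'.gen κ hκ, map_sub]⟩

end Decay

section Estimate

variable {E : Type*} [NormedAddCommGroup E] [InnerProductSpace ℂ E] [CompleteSpace E]
  {H : E →ₗ.[ℂ] E} {R K S : E →L[ℂ] E} {T c ε : ℝ} {v : ℝ → E} {F : L2I E T}

/-- The smoothing estimate for regularized solutions, with the error that comes from replacing the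
free evolution outside `[0, T]` by approximate evolutions with the parameter `m`. -/
theorem integral_norm_sq_apply_le_add (hH : IsSelfAdjoint H) (hT : 0 < T) (hε : 0 < ε)
    (hreg : IsRegularizer H R K)
    (hS : ∀ (l : ℝ) (x : E), ‖S x‖ ≤ c * ‖K x - ((l : ℂ) + Complex.I * ε) • R x‖)
    (hv : Continuous v)
    (hprim : ∀ t ∈ Icc 0 T,
      R (v t) = R (v 0) + ∫ s in 0..t, -Complex.I • (K (v s) + R (F s)))
    {m : ℝ} (hm : 0 < m) :
    ∫ t in Ioc 0 T, ‖S (v t)‖ ^ 2 ≤ c ^ 2 * ((∫ t in Ioc 0 T,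
      ‖R (F t) + (Complex.I * ε) • R (v t)‖ ^ 2) +
      ((2 * ε * ‖R (v 0)‖ + ‖yosida H (-m) (K (v 0)) - K (v 0)‖) ^ 2
        + ‖yosida H m (K (v T)) - K (v T)‖ ^ 2) / (2 * ε)) := by
  have hm0 : m ≠ 0 := hm.ne'
  have hm1 : -m ≠ 0 := neg_ne_zero.2 hm0
  -- the extension of `v` to the whole line and the derivative of its regularization
  set a : ℝ → E := decay H (-1) ε (-m) 0 (v 0) with ha
  set b : ℝ → E := decay H 1 ε m T (v T) with hb
  set a' : ℝ → E := fun t => ε • R (a t) - Complex.I • yosida H (-m) (K (a t)) with ha'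
  set v' : ℝ → E := fun t => -Complex.I • (K (v t) + R (F t)) with hv'
  set b' : ℝ → E := fun t => -ε • R (b t) - Complex.I • yosida H m (K (b t)) with hb'
  set y : ℝ → E := glue T a v b with hy
  set h : ℝ → E := glue T a' v' b' with hh
  have hac : Continuous a := continuous_decay ..
  have hbc : Continuous b := continuous_decay ..
  have ha'c : Continuous a' := by fun_prop
  have hb'c : Continuous b' := by fun_prop
  have hda : ∀ t, HasDerivAt (fun t => R (a t)) (a' t) t := by
    intro t
    have h1 := (R.restrictScalars ℝ).hasFDerivAt.comp_hasDerivAt t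
      (hasDerivAt_decay (H := H) (σ := -1) (ε := ε) (κ := -m) (t₀ := 0) (x := v 0)
        (by rw [abs_neg, abs_of_pos hm]; ring) t)
    refine h1.congr_deriv ?_
    simp only [ContinuousLinearMap.coe_restrictScalars', map_sub, map_smul, R.map_smul_of_tower,
      hreg.gen _ hm1, ha', ha]
    simp
  have hdb : ∀ t, HasDerivAt (fun t => R (b t)) (b' t) t := by
    intro t
    have h1 := (R.restrictScalars ℝ).hasFDerivAt.comp_hasDerivAt t
      (hasDerivAt_decay (H := H) (σ := 1) (ε := ε) (κ := m) (t₀ := T) (x := v T)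
        (by rw [abs_of_pos hm]; ring) t)
    refine h1.congr_deriv ?_
    simp only [ContinuousLinearMap.coe_restrictScalars', map_sub, map_smul, R.map_smul_of_tower,
      hreg.gen _ hm0, hb', hb]
    simp
  have hna : ∀ {B : E →L[ℂ] E}, Commute B (yosida H (-m)) → ∀ t ≤ 0,
      ‖B (a t)‖ ≤ ‖B (v 0)‖ * Real.exp (ε * t) := by
    intro B hB t ht
    have h1 := norm_apply_decay_le (σ := -1) (ε := ε) (t₀ := 0) (x := v 0) hH hm1 hB (t := t)
      (by linarith)
    rw [mul_comm, show ε * t = -(ε * (-1 * (t - 0))) by ring]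
    exact h1
  have hnb : ∀ {B : E →L[ℂ] E}, Commute B (yosida H m) → ∀ t, T ≤ t →
      ‖B (b t)‖ ≤ ‖B (v T)‖ * Real.exp (-(ε * (t - T))) := by
    intro B hB t ht
    have h1 := norm_apply_decay_le (σ := 1) (ε := ε) (t₀ := T) (x := v T) hH hm0 hB (t := t)
      (by linarith)
    rw [mul_comm, show -(ε * (t - T)) = -(ε * (1 * (t - T))) by ring]
    exact h1
  have hJKa : Commute (yosida H (-m) * K) (yosida H (-m)) :=
    (Commute.refl _).mul_left (hreg.comm' _ hm1)
  have hJKb : Commute (yosida H m * K) (yosida H m) :=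
    (Commute.refl _).mul_left (hreg.comm' _ hm0)
  have heL : Continuous fun t => Real.exp (ε * t) := by fun_prop
  have heR : Continuous fun t => Real.exp (-(ε * (t - T))) := by fun_prop
  have hFm : MemLp (fun t => F t) 2 (volume.restrict (Ioc 0 T)) := by
    rw [← restrict_Ioo_eq_restrict_Ioc]
    exact Lp.memLp F
  have hcb : ∀ {q : ℝ → E}, Continuous q → MemLp q 2 (volume.restrict (Ioc 0 T)) := by
    intro q hq
    obtain ⟨C, hC⟩ := isCompact_Icc.exists_bound_of_continuousOn (hq.continuousOn (s := Icc 0 T))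
    refine MemLp.of_bound hq.aestronglyMeasurable C ?_
    filter_upwards [ae_restrict_mem measurableSet_Ioc] with t ht using hC t (Ioc_subset_Icc_self ht)
  have hyL : MemLp y 2 := by
    refine memLp_glue hT.le ?_ (hcb hv) ?_
    · refine memLp_of_norm_le_mul (C := ‖v 0‖) measurableSet_Iic hac.aestronglyMeasurable heL
        (integrableOn_exp_sq_Iic hε) fun t ht => ?_
      rw [Real.norm_eq_abs, Real.abs_exp]
      exact hna (B := 1) (Commute.one_left _) t ht
    · refine memLp_of_norm_le_mul (C := ‖v T‖) measurableSet_Ioi hbc.aestronglyMeasurable heR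
        (integrableOn_exp_sq_Ioi hε T) fun t ht => ?_
      rw [Real.norm_eq_abs, Real.abs_exp]
      exact hnb (B := 1) (Commute.one_left _) t (le_of_lt ht)
  have hhL : MemLp h 2 := by
    refine memLp_glue hT.le ?_ ?_ ?_
    · refine memLp_of_norm_le_mul (C := ε * ‖R (v 0)‖ + ‖yosida H (-m) (K (v 0))‖)
        measurableSet_Iic ha'c.aestronglyMeasurable heL (integrableOn_exp_sq_Iic hε)
        fun t ht => ?_
      rw [Real.norm_eq_abs, Real.abs_exp]
      refine (norm_sub_le _ _).trans ?_
      rw [norm_smul, norm_smul, Complex.norm_I, one_mul, Real.norm_of_nonneg hε.le, add_mul,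
        mul_assoc]
      exact add_le_add (mul_le_mul_of_nonneg_left (hna (hreg.comm _ hm1) t ht) hε.le)
        (hna hJKa t ht)
    · exact (((hcb (K.continuous.comp hv)).add (R.comp_memLp' hFm)).const_smul (-Complex.I))
    · refine memLp_of_norm_le_mul (C := ε * ‖R (v T)‖ + ‖yosida H m (K (v T))‖)
        measurableSet_Ioi hb'c.aestronglyMeasurable heR (integrableOn_exp_sq_Ioi hε T)
        fun t ht => ?_
      rw [Real.norm_eq_abs, Real.abs_exp]
      refine (norm_sub_le _ _).trans ?_
      rw [norm_smul, norm_smul, Complex.norm_I, one_mul, norm_neg, Real.norm_of_nonneg hε.le,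
        add_mul, mul_assoc]
      exact add_le_add (mul_le_mul_of_nonneg_left (hnb (hreg.comm _ hm0) t (le_of_lt ht)) hε.le)
        (hnb hJKb t (le_of_lt ht))
  have hRy : ∀ t, R (y t) = glue T (fun t => R (a t)) (fun t => R (v t)) (fun t => R (b t)) t := by
    intro t
    simp only [hy, glue]
    split_ifs <;> rfl
  have hprimy : ∀ s t, s ≤ t → R (y t) = R (y s) + ∫ r in s..t, h r := by
    intro s t _
    rw [hRy, hRy]
    refine glue_primitive hT.le (hhL.locallyIntegrable (by norm_num)) ?_ ?_ ?_ ?_ ?_ s t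
    · simp only [ha, decay_self]
    · simp only [hb, decay_self]
    · intro t _
      exact (intervalIntegral.integral_eq_sub_of_hasDerivAt (fun r _ => hda r)
        (ha'c.intervalIntegrable _ _)).symm
    · intro t ht
      rw [hprim t ht, add_sub_cancel_left]
    · intro t _
      exact (intervalIntegral.integral_eq_sub_of_hasDerivAt (fun r _ => hdb r)
        (hb'c.intervalIntegrable _ _)).symm
  obtain ⟨C, hC⟩ := isCompact_Icc.exists_bound_of_continuousOn
    ((R.continuous.comp hv).continuousOn (s := Icc 0 T))
  have hbd : ∀ t, ‖R (y t)‖ ≤ C := by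
    intro t
    rcases le_or_gt t 0 with h0 | h0
    · rw [hy, glue_left h0]
      refine (hna (hreg.comm _ hm1) t h0).trans ((mul_le_of_le_one_right (norm_nonneg _) ?_).trans
        (hC 0 (left_mem_Icc.2 hT.le)))
      exact Real.exp_le_one_iff.2 (mul_nonpos_of_nonneg_of_nonpos hε.le h0)
    · rcases le_or_gt t T with h1 | h1
      · rw [hy, glue_mid ⟨h0, h1⟩]
        exact hC t ⟨h0.le, h1⟩
      · rw [hy, glue_right hT.le h1]
        refine (hnb (hreg.comm _ hm0) t h1.le).trans ((mul_le_of_le_one_right (norm_nonneg _)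
          ?_).trans (hC T (right_mem_Icc.2 hT.le)))
        exact Real.exp_le_one_iff.2 (neg_nonpos.2 (mul_nonneg hε.le (by linarith)))
  -- the estimate on the whole line
  have hmain := norm_compLp_le_of_uniform_bound hS (hyL.toLp y) (hhL.toLp h) (by
    intro ψ
    have h1 := integral_deriv_smul_eq_neg_of_primitive (w := fun t => R (y t)) (C := C)
      (R.continuous.comp_aestronglyMeasurable hyL.aestronglyMeasurable) hbd hhL hprimy ψ
    refine (integral_congr_ae ?_).trans (h1.trans (congrArg Neg.neg (integral_congr_ae ?_)))
    · filter_upwards [R.coeFn_compLp (hyL.toLp y), hyL.coeFn_toLp] with t e1 e2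
      rw [e1, e2]
    · filter_upwards [hhL.coeFn_toLp] with t e1
      rw [e1])
  -- the right-hand side of the damped equation for the extended function, on each of the pieces
  set G : ℝ → E := fun t => Complex.I • h t - K (y t) + (Complex.I * ε) • R (y t) with hG
  have hGL : MemLp G 2 := ((hhL.const_smul Complex.I).sub (K.comp_memLp' hyL)).add
    ((R.comp_memLp' hyL).const_smul (Complex.I * ε))
  have hsq := pow_le_pow_left₀ (norm_nonneg _) hmain 2
  have hl : ∫ t in Ioc 0 T, ‖S (v t)‖ ^ 2 ≤ ‖S.compLp (hyL.toLp y)‖ ^ 2 := by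
    have e : ∫ t, ‖S.compLp (hyL.toLp y) t‖ ^ 2 = ∫ t, ‖S (y t)‖ ^ 2 := by
      refine integral_congr_ae ?_
      filter_upwards [S.coeFn_compLp (hyL.toLp y), hyL.coeFn_toLp] with t e1 e2
      rw [e1, e2]
    rw [Lp_norm_sq_eq_integral, e]
    have e2 : ∫ t in Ioc 0 T, ‖S (v t)‖ ^ 2 = ∫ t in Ioc 0 T, ‖S (y t)‖ ^ 2 :=
      setIntegral_congr_fun measurableSet_Ioc fun t ht => by simp only [hy, glue_mid ht]
    rw [e2]
    exact setIntegral_le_integral ((S.comp_memLp' hyL).integrable_norm_pow (by simp))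
      (Eventually.of_forall fun _ => sq_nonneg _)
  have hr : ‖Complex.I • hhL.toLp h - K.compLp (hyL.toLp y)
      + (Complex.I * ε) • R.compLp (hyL.toLp y)‖ ^ 2 = ∫ t, ‖G t‖ ^ 2 := by
    rw [Lp_norm_sq_eq_integral]
    refine integral_congr_ae ?_
    filter_upwards [K.coeFn_compLp (hyL.toLp y), R.coeFn_compLp (hyL.toLp y), hyL.coeFn_toLp,
      hhL.coeFn_toLp, Lp.coeFn_add (Complex.I • hhL.toLp h - K.compLp (hyL.toLp y))
        ((Complex.I * ε : ℂ) • R.compLp (hyL.toLp y)),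
      Lp.coeFn_sub (Complex.I • hhL.toLp h) (K.compLp (hyL.toLp y)),
      Lp.coeFn_smul Complex.I (hhL.toLp h),
      Lp.coeFn_smul (Complex.I * ε : ℂ) (R.compLp (hyL.toLp y))] with t e1 e2 e3 e4 e5 e6 e7 e8
    rw [e5, Pi.add_apply, e6, Pi.sub_apply, e7, e8, Pi.smul_apply, Pi.smul_apply, e1, e2, e3, e4]
  rw [mul_pow, hr, integral_eq_three hT.le (hGL.integrable_norm_pow (by simp))] at hsq
  refine hl.trans (hsq.trans (mul_le_mul_of_nonneg_left ?_ (sq_nonneg c)))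
  have hGm : ∫ t in Ioc 0 T, ‖G t‖ ^ 2
      = ∫ t in Ioc 0 T, ‖R (F t) + (Complex.I * ε) • R (v t)‖ ^ 2 := by
    refine setIntegral_congr_fun measurableSet_Ioc fun t ht => ?_
    simp only [hG, hy, hh, glue_mid ht, hv']
    congr 2
    rw [smul_smul, mul_neg, Complex.I_mul_I, neg_neg, one_smul]
    abel
  have hI : ∀ z : E, Complex.I • (Complex.I • z) = -z := fun z => by
    rw [smul_smul, Complex.I_mul_I, neg_one_smul]
  have hεI : ∀ z : E, Complex.I • (ε • z) = (Complex.I * ε) • z := fun z => by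
    rw [← Complex.coe_smul, smul_smul]
  have hGa : ∫ t in Iic 0, ‖G t‖ ^ 2
      ≤ (2 * ε * ‖R (v 0)‖ + ‖yosida H (-m) (K (v 0)) - K (v 0)‖) ^ 2 * (1 / (2 * ε)) := by
    rw [← integral_exp_sq_Iic hε]
    refine setIntegral_norm_sq_le_mul measurableSet_Iic (integrableOn_exp_sq_Iic hε) fun t ht => ?_
    have e1 : G t = (2 * (Complex.I * ε)) • R (a t)
        + (yosida H (-m) * K - K) (a t) := by
      simp only [hG, hy, hh, glue_left (mem_Iic.1 ht), ha', smul_sub, hI, hεI]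
      rw [sub_apply, mul_apply_eq_comp]
      module
    have e2 := hna (hJKa.sub_left (hreg.comm' _ hm1)) t ht
    rw [e1]
    refine (norm_add_le _ _).trans ?_
    rw [norm_smul, add_mul]
    refine add_le_add ?_ e2
    rw [norm_mul, norm_mul, Complex.norm_I, one_mul, Complex.norm_real, Real.norm_of_nonneg hε.le,
      mul_assoc _ ‖R (v 0)‖]
    refine (mul_le_mul_of_nonneg_left (hna (hreg.comm _ hm1) t ht) (by positivity)).trans_eq ?_
    simp
  have hGb : ∫ t in Ioi T, ‖G t‖ ^ 2
      ≤ ‖yosida H m (K (v T)) - K (v T)‖ ^ 2 * (1 / (2 * ε)) := by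
    rw [← integral_exp_sq_Ioi hε T]
    refine setIntegral_norm_sq_le_mul measurableSet_Ioi (integrableOn_exp_sq_Ioi hε T)
      fun t ht => ?_
    have e1 : G t = (yosida H m * K - K) (b t) := by
      simp only [hG, hy, hh, glue_right hT.le (mem_Ioi.1 ht), hb', smul_sub, hI, neg_smul,
        smul_neg, hεI]
      rw [sub_apply, mul_apply_eq_comp]
      module
    rw [e1]
    exact hnb (hJKb.sub_left (hreg.comm' _ hm0)) t (le_of_lt ht)
  rw [hGm]
  refine (add_le_add (add_le_add hGa le_rfl) hGb).trans_eq ?_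
  ring

/-- The smoothing estimate for regularized solutions: the errors of the approximate evolutions
vanish in the limit. -/
theorem integral_norm_sq_apply_le (hH : IsSelfAdjoint H) (hT : 0 < T) (hε : 0 < ε)
    (hreg : IsRegularizer H R K)
    (hS : ∀ (l : ℝ) (x : E), ‖S x‖ ≤ c * ‖K x - ((l : ℂ) + Complex.I * ε) • R x‖)
    (hv : Continuous v)
    (hprim : ∀ t ∈ Icc 0 T,
      R (v t) = R (v 0) + ∫ s in 0..t, -Complex.I • (K (v s) + R (F s))) :
    ∫ t in Ioc 0 T, ‖S (v t)‖ ^ 2 ≤ c ^ 2 * ((∫ t in Ioc 0 T,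
      ‖R (F t) + (Complex.I * ε) • R (v t)‖ ^ 2) + 2 * ε * ‖R (v 0)‖ ^ 2) := by
  have h1 : ∀ n : ℕ, _ := fun n : ℕ => integral_norm_sq_apply_le_add hH hT hε hreg hS hv hprim
    (m := n + 1) (by positivity)
  have h2 : Tendsto (fun n : ℕ => ‖yosida H (-(n + 1)) (K (v 0)) - K (v 0)‖) atTop (𝓝 0) :=
    tendsto_iff_norm_sub_tendsto_zero.1 (tendsto_yosida_neg_natCast hH _)
  have h3 : Tendsto (fun n : ℕ => ‖yosida H (n + 1) (K (v T)) - K (v T)‖) atTop (𝓝 0) :=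
    tendsto_iff_norm_sub_tendsto_zero.1 (tendsto_yosida_natCast hH _)
  have h4 := ((((h2.const_add (2 * ε * ‖R (v 0)‖)).pow 2).add (h3.pow 2)).div_const
    (2 * ε)).const_add (∫ t in Ioc 0 T, ‖R (F t) + (Complex.I * ε) • R (v t)‖ ^ 2)
    |>.const_mul (c ^ 2)
  refine (ge_of_tendsto' h4 h1).trans_eq ?_
  field_simp
  ring

end Estimate

/-! ### Weak solutions for the perturbed operator -/

section L2

variable {E : Type*} [NormedAddCommGroup E] [InnerProductSpace ℂ E] {T : ℝ}

omit [InnerProductSpace ℂ E] in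
theorem memLp_Ioo_of_continuous {g : ℝ → E} (hg : Continuous g) :
    MemLp g 2 (volume.restrict (Ioo 0 T)) := by
  obtain ⟨C, hC⟩ := isCompact_Icc.exists_bound_of_continuousOn (hg.continuousOn (s := Icc 0 T))
  refine MemLp.of_bound hg.aestronglyMeasurable C ?_
  filter_upwards [ae_restrict_mem measurableSet_Ioo] with t ht using hC t (Ioo_subset_Icc_self ht)

theorem tendsto_integral_inner {w : ℕ → L2I E T} {w' : L2I E T} (hw : Tendsto w atTop (𝓝 w'))
    {g : ℝ → E} (hg : Continuous g) :
    Tendsto (fun n => ∫ t in Ioo 0 T, ⟪w n t, g t⟫_ℂ) atTop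
      (𝓝 (∫ t in Ioo 0 T, ⟪w' t, g t⟫_ℂ)) := by
  have hG := memLp_Ioo_of_continuous (T := T) hg
  have h : ∀ f : L2I E T, ∫ t in Ioo 0 T, ⟪f t, g t⟫_ℂ = ⟪f, hG.toLp g⟫_ℂ := by
    intro f
    rw [L2.inner_def]
    refine integral_congr_ae ?_
    filter_upwards [hG.coeFn_toLp] with t ht
    rw [ht]
  simp_rw [h]
  exact hw.inner tendsto_const_nhds

theorem sub_compLp (S S' : E →L[ℂ] E) (w : L2I E T) :
    (S - S').compLp w = S.compLp w - S'.compLp w := by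
  refine Lp.ext ?_
  filter_upwards [(S - S').coeFn_compLp w, S.coeFn_compLp w, S'.coeFn_compLp w,
    Lp.coeFn_sub (S.compLp w) (S'.compLp w)] with t e1 e2 e3 e4
  rw [e1, e4, Pi.sub_apply, e2, e3, sub_apply]

variable [CompleteSpace E] {H : E →ₗ.[ℂ] E}

theorem tendsto_compLp_yosida (hH : IsSelfAdjoint H) (w : L2I E T) :
    Tendsto (fun n : ℕ => (yosida H (n + 1)).compLp w) atTop (𝓝 w) := by
  have hn : ∀ n : ℕ, ((n : ℝ) + 1) ≠ 0 := fun n => by positivity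
  have hw : Integrable (fun t => ‖w t‖ ^ 2) (volume.restrict (Ioo 0 T)) :=
    (Lp.memLp w).integrable_norm_pow (by simp)
  have h1 : Tendsto (fun n : ℕ => ∫ t in Ioo 0 T, ‖yosida H (n + 1) (w t) - w t‖ ^ 2) atTop
      (𝓝 (∫ _ in Ioo 0 T, (0 : ℝ))) := by
    refine tendsto_integral_of_dominated_convergence (fun t => 4 * ‖w t‖ ^ 2) (fun n => ?_)
      (hw.const_mul 4) (fun n => Eventually.of_forall fun t => ?_)
      (Eventually.of_forall fun t => ?_)
    · exact (((yosida H (n + 1)).continuous.comp_aestronglyMeasurable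
        (Lp.aestronglyMeasurable w)).sub (Lp.aestronglyMeasurable w)).norm.pow 2
    · rw [norm_pow, norm_norm]
      have h2 := norm_sub_le (yosida H (n + 1) (w t)) (w t)
      have h3 := norm_yosida_apply_le hH (hn n) (w t)
      nlinarith [norm_nonneg (yosida H (n + 1) (w t) - w t), norm_nonneg (w t)]
    · have h2 := (tendsto_iff_norm_sub_tendsto_zero.1 (tendsto_yosida_natCast hH (w t))).pow 2
      simpa using h2
  rw [integral_zero] at h1
  rw [tendsto_iff_norm_sub_tendsto_zero]
  have h2 := h1.sqrt
  rw [Real.sqrt_zero] at h2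
  refine h2.congr fun n => ?_
  rw [← Real.sqrt_sq (norm_nonneg ((yosida H (n + 1)).compLp w - w)), Lp_norm_sq_eq_integral]
  congr 1
  refine integral_congr_ae ?_
  filter_upwards [(yosida H (n + 1)).coeFn_compLp w, Lp.coeFn_sub ((yosida H (n + 1)).compLp w) w]
    with t e1 e2
  rw [e2, Pi.sub_apply, e1]

end L2

section Perturbed

variable {E : Type*} [NormedAddCommGroup E] [InnerProductSpace ℂ E] [CompleteSpace E]
  {H H' A : E →ₗ.[ℂ] E} {c ε T : ℝ} {u F : L2I E T} {v : ℝ → E}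

/-- The smoothing estimate for `S = A R`, as an inequality between norms in `L²(I, E)`. -/
theorem IsPerturbation.norm_compLp_sq_le (P : IsPerturbation H H' A c ε) {R K S : E →L[ℂ] E}
    (hreg : IsRegularizer H R K) (hmem : ∀ x, R x ∈ H.domain)
    (hK : ∀ x, H ⟨R x, hmem x⟩ = K x) (hS : ∀ x, S x = A ⟨R x, P.domain_le (hmem x)⟩)
    (hT : 0 < T) (hv : Continuous v) (huv : u =ᵐ[volume.restrict (Ioo 0 T)] v)
    (hprim : ∀ t ∈ Icc 0 T,
      R (v t) = R (v 0) + ∫ s in 0..t, -Complex.I • (K (v s) + R (F s))) :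
    ‖S.compLp u‖ ^ 2
      ≤ c ^ 2 * (‖R.compLp (F + (Complex.I * ε) • u)‖ ^ 2 + 2 * ε * ‖R (v 0)‖ ^ 2) := by
  have h := integral_norm_sq_apply_le P.selfAdjoint hT P.pos hreg (S := S) (c := c)
    (fun l x => by
      have h1 := P.bound l (R x) (hmem x) (P.domain_le (hmem x))
      rwa [← hS, hK] at h1) hv hprim
  rw [integral_Ioc_eq_integral_Ioo, integral_Ioc_eq_integral_Ioo] at h
  refine (le_of_eq ?_).trans (h.trans_eq ?_)
  · rw [Lp_norm_sq_eq_integral]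
    refine integral_congr_ae ?_
    filter_upwards [S.coeFn_compLp u, huv] with t e1 e2
    rw [e1, e2]
  · rw [Lp_norm_sq_eq_integral]
    congr 2
    refine integral_congr_ae ?_
    filter_upwards [R.coeFn_compLp (F + (Complex.I * ε : ℂ) • u), huv,
      Lp.coeFn_add F ((Complex.I * ε : ℂ) • u), Lp.coeFn_smul (Complex.I * ε : ℂ) u]
      with t e1 e2 e3 e4
    rw [e1, e3, Pi.add_apply, e4, Pi.smul_apply, e2, map_add, map_smul]

/-- The smoothing estimate: `A u` exists in `L²(I, E)`, in the weak sense, for each weak solution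
`u` of `(i∂ₜ - H) u = F` with a square integrable `F`. It is the limit of `A J u` for the
regularizations `J` of `H`; the sequence is Cauchy by the estimate for regularized solutions,
applied to the difference of two regularizations. -/
theorem IsPerturbation.exists_apply (P : IsPerturbation H H' A c ε)
    (h : WeakEq T H (fun _ => 0) u F) (hT : 0 < T) (hv : Continuous v)
    (huv : u =ᵐ[volume.restrict (Ioo 0 T)] v) :
    ∃ g : L2I E T,
      ‖g‖ ^ 2 ≤ c ^ 2 * (‖F + (Complex.I * ε) • u‖ ^ 2 + 2 * ε * ‖v 0‖ ^ 2) ∧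
      ∀ φ : ℝ → A.domain, Continuous (fun t => (φ t : E)) → Continuous (fun t => A (φ t)) →
        ∫ t in Ioo 0 T, ⟪u t, A (φ t)⟫_ℂ = ∫ t in Ioo 0 T, ⟪g t, (φ t : E)⟫_ℂ := by
  have hH := P.selfAdjoint
  have hn : ∀ n : ℕ, ((n : ℝ) + 1) ≠ 0 := fun n => by positivity
  have hmem := fun (n : ℕ) x => yosida_mem_domain hH (hn n) x
  have hgen : ∀ (n : ℕ) x, H ⟨yosida H (n + 1) x, hmem n x⟩ = yosidaGen H (n + 1) x :=
    fun n x => apply_yosida hH (hn n) x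
  have hex : ∀ n : ℕ, ∃ S : E →L[ℂ] E, ∀ x, S x = A ⟨yosida H (n + 1) x, P.domain_le (hmem n x)⟩ :=
    fun n => exists_clm_comp P.domain_le P.nonneg (P.bound 0) _ _ (hmem n) (hgen n)
  choose S hS using hex
  set W : L2I E T := F + (Complex.I * ε : ℂ) • u
  have hprim := fun (n : ℕ) t (ht : t ∈ Icc 0 T) => h.yosida_eq_integral hH hT hv huv (hn n) ht
  have hint : ∀ (n : ℕ) t, t ∈ Icc 0 T → IntervalIntegrable (fun s => -Complex.I •
      (yosidaGen H (n + 1) (v s) + yosida H (n + 1) (F s))) volume 0 t := by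
    intro n t ht
    have hF := F.intervalIntegrable ht
    rw [intervalIntegrable_iff] at hF
    refine IntervalIntegrable.smul
      (IntervalIntegrable.add (Continuous.intervalIntegrable (by fun_prop) _ _) ?_) _
    rw [intervalIntegrable_iff]
    exact (yosida H (n + 1)).integrable_comp hF
  have hone : ∀ n : ℕ, ‖(S n).compLp u‖ ^ 2
      ≤ c ^ 2 * (‖(yosida H (n + 1)).compLp W‖ ^ 2 + 2 * ε * ‖yosida H (n + 1) (v 0)‖ ^ 2) :=
    fun n => P.norm_compLp_sq_le (isRegularizer_yosida hH (hn n)) (hmem n) (hgen n) (hS n) hT hv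
      huv (hprim n)
  have htwo : ∀ n m : ℕ, ‖(S n).compLp u - (S m).compLp u‖ ^ 2
      ≤ c ^ 2 * (‖(yosida H (n + 1)).compLp W - (yosida H (m + 1)).compLp W‖ ^ 2
        + 2 * ε * ‖yosida H (n + 1) (v 0) - yosida H (m + 1) (v 0)‖ ^ 2) := by
    intro n m
    have hmem' : ∀ x, (yosida H (n + 1) - yosida H (m + 1)) x ∈ H.domain := fun x =>
      H.domain.sub_mem (hmem n x) (hmem m x)
    have h1 := P.norm_compLp_sq_le (v := v) (u := u) (F := F) (S := S n - S m)
      ((isRegularizer_yosida hH (hn n)).sub (isRegularizer_yosida hH (hn m))) hmem'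
      (fun x => (H.map_sub ⟨_, hmem n x⟩ ⟨_, hmem m x⟩).trans
        (congrArg₂ (· - ·) (hgen n x) (hgen m x)))
      (fun x => by
        rw [sub_apply, hS, hS, ← LinearPMap.map_sub]
        rfl) hT hv huv fun t ht => by
        simp only [sub_apply]
        rw [hprim n t ht, hprim m t ht, add_sub_add_comm,
          ← intervalIntegral.integral_sub (hint n t ht) (hint m t ht)]
        congr 2
        ext s
        rw [← smul_sub, add_sub_add_comm]
    simpa only [sub_compLp, sub_apply] using h1
  have hJW := tendsto_compLp_yosida hH W
  have hJv := tendsto_yosida_natCast hH (v 0)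
  have hcauchy : CauchySeq fun n => (S n).compLp u := by
    rw [cauchySeq_iff_tendsto_dist_atTop_0]
    have h1 := cauchySeq_iff_tendsto_dist_atTop_0.1 hJW.cauchySeq
    have h2 := cauchySeq_iff_tendsto_dist_atTop_0.1 hJv.cauchySeq
    have h3 := (((h1.pow 2).add ((h2.pow 2).const_mul (2 * ε))).const_mul (c ^ 2)).sqrt
    simp only [ne_eq, OfNat.ofNat_ne_zero, not_false_eq_true, zero_pow, mul_zero, add_zero,
      Real.sqrt_zero] at h3
    refine squeeze_zero (fun _ => dist_nonneg) (fun p => ?_) h3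
    refine Real.le_sqrt_of_sq_le ?_
    simp only [dist_eq_norm]
    exact htwo p.1 p.2
  obtain ⟨g, hg⟩ := cauchySeq_tendsto_of_complete hcauchy
  -- both the bound and the identity `(A J u | φ) = (J u | A φ)` pass to the limit
  refine ⟨g, ?_, fun φ hφ hAφ => ?_⟩
  · exact le_of_tendsto_of_tendsto' (hg.norm.pow 2)
      (((hJW.norm.pow 2).add ((hJv.norm.pow 2).const_mul (2 * ε))).const_mul (c ^ 2)) hone
  · refine tendsto_nhds_unique ((tendsto_integral_inner (tendsto_compLp_yosida hH u) hAφ).congr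
      fun n => ?_) (tendsto_integral_inner hg hφ)
    refine integral_congr_ae ?_
    filter_upwards [(yosida H (n + 1)).coeFn_compLp u, (S n).coeFn_compLp u] with t e1 e2
    rw [e1, e2, hS]
    exact (P.symmetric ⟨_, P.domain_le (hmem n (u t))⟩ (φ t)).symm

/-- `A` is bounded relative to `H'`, hence continuous for the graph norm of `H'`. -/
theorem IsPerturbation.continuous_apply (P : IsPerturbation H H' A c ε) {φ : ℝ → H'.domain}
    (hφ : IsTestFunction T H' φ) (hmem : ∀ t, (φ t : E) ∈ A.domain) :
    Continuous fun t => A ⟨φ t, hmem t⟩ := by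
  refine continuous_iff_continuousAt.2 fun s => tendsto_iff_norm_sub_tendsto_zero.2 ?_
  have h1 : Continuous fun t => c * ‖(H' (φ t) - H' (φ s))
      - (((0 : ℝ) : ℂ) + Complex.I * ε) • ((φ t : E) - φ s)‖ := by
    exact (((hφ.continuous_apply.sub continuous_const).sub
      ((hφ.contDiff.continuous.sub continuous_const).const_smul _)).norm).const_mul c
  have h2 := h1.tendsto s
  simp only [sub_self, smul_zero, norm_zero, mul_zero] at h2
  refine squeeze_zero (fun _ => norm_nonneg _) (fun t => ?_) h2
  have h3 := P.bound' 0 ((φ t : E) - φ s) (φ t - φ s).2 (A.domain.sub_mem (hmem t) (hmem s))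
  rw [← LinearPMap.map_sub, ← LinearPMap.map_sub]
  exact h3

/-- A weak solution for `H` is a weak solution for `H'`, with the right-hand side `F - A u`. -/
theorem IsPerturbation.exists_weakEq (P : IsPerturbation H H' A c ε)
    (h : WeakEq T H (fun _ => 0) u F) (hT : 0 < T) (hv : Continuous v)
    (huv : u =ᵐ[volume.restrict (Ioo 0 T)] v) :
    ∃ g : L2I E T,
      ‖g‖ ^ 2 ≤ c ^ 2 * (‖F + (Complex.I * ε) • u‖ ^ 2 + 2 * ε * ‖v 0‖ ^ 2) ∧
      WeakEq T H' (fun _ => 0) u (F - g) := by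
  obtain ⟨g, hg1, hg2⟩ := P.exists_apply h hT hv huv
  refine ⟨g, hg1, fun φ hφ => ?_⟩
  have hH : ∀ t, (φ t : E) ∈ H.domain := fun t => P.domain_eq ▸ (φ t).2
  have hA : ∀ t, (φ t : E) ∈ A.domain := fun t => P.domain_le (hH t)
  have hAc := P.continuous_apply hφ hA
  have happ : ∀ t, H ⟨φ t, hH t⟩ = H' (φ t) - A ⟨φ t, hA t⟩ := fun t =>
    eq_sub_of_add_eq (P.apply_eq _ (hH t) (φ t).2 (hA t)).symm
  have hψ : IsTestFunction T H (fun t => ⟨φ t, hH t⟩) :=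
    ⟨hφ.contDiff, by simp only [happ]; exact hφ.continuous_apply.sub hAc, hφ.hasCompactSupport,
      hφ.tsupport_subset⟩
  have h1 := h _ hψ
  have h2 := hg2 (fun t => ⟨φ t, hA t⟩) hφ.contDiff.continuous hAc
  have i1 := integrable_inner_of_continuous u hψ.continuous_deriv_sub
  have i2 := integrable_inner_of_continuous u hAc
  have i3 := integrable_inner_of_continuous F hφ.contDiff.continuous
  have i4 := integrable_inner_of_continuous g hφ.contDiff.continuous
  have h3 := congrArg₂ (· - ·) h1 h2
  simp only at h3
  refine Eq.trans ?_ (Eq.trans ((integral_sub i1 i2).trans h3) (Eq.trans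
    (integral_sub i3 i4).symm ?_))
  · refine integral_congr_ae (Eventually.of_forall fun t => ?_)
    simp only
    rw [← inner_sub_right, happ]
    congr 1
    abel
  · refine integral_congr_ae ?_
    filter_upwards [Lp.coeFn_sub F g] with t e
    rw [e, Pi.sub_apply, inner_sub_left]

end Perturbed

/-! ### Uniqueness of the initial value and of the right-hand side -/

section Uniqueness

variable {E : Type*} [NormedAddCommGroup E] [InnerProductSpace ℂ E] {T : ℝ}
  {u u' : L2I E T} {x x' : E}

omit [InnerProductSpace ℂ E] in
theorem exists_continuous_eqOn_Icc (hT : 0 < T) {w : ℝ → E} (hw : ContinuousOn w (Icc 0 T)) :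
    ∃ v : ℝ → E, Continuous v ∧ EqOn v w (Icc 0 T) :=
  ⟨IccExtend hT.le ((Icc 0 T).domRestrict w), hw.domRestrict.Icc_extend', fun _ ht =>
    IccExtend_of_mem hT.le _ ht⟩

theorem HasInitialValue.exists_continuous (hT : 0 < T) (h : HasInitialValue T u x) :
    ∃ v : ℝ → E, Continuous v ∧ u =ᵐ[volume.restrict (Ioo 0 T)] v ∧ v 0 = x := by
  obtain ⟨w, hw, huw, rfl⟩ := h
  obtain ⟨v, hv, hvw⟩ := exists_continuous_eqOn_Icc hT hw
  refine ⟨v, hv, ?_, hvw (left_mem_Icc.2 hT.le)⟩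
  filter_upwards [huw, ae_restrict_mem measurableSet_Ioo] with t e ht
  rw [e, hvw (Ioo_subset_Icc_self ht)]

theorem HasInitialValue.unique (hT : 0 < T) (h : HasInitialValue T u x)
    (h' : HasInitialValue T u x') : x = x' := by
  obtain ⟨v, hv, huv, rfl⟩ := h
  obtain ⟨w, hw, huw, rfl⟩ := h'
  have h1 : EqOn v w (Ioo 0 T) := Measure.eqOn_open_of_ae_eq (huv.symm.trans huw) isOpen_Ioo
    (hv.mono Ioo_subset_Icc_self) (hw.mono Ioo_subset_Icc_self)
  exact h1.of_subset_closure hv hw Ioo_subset_Icc_self (by rw [closure_Ioo hT.ne])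
    (left_mem_Icc.2 hT.le)

theorem HasInitialValue.initialValue_eq (hT : 0 < T) (h : HasInitialValue T u x) :
    initialValue T u = x := by
  have hex : ∃ x, HasInitialValue T u x := ⟨x, h⟩
  rw [initialValue, dif_pos hex]
  exact hex.choose_spec.unique hT h

theorem HasInitialValue.add (h : HasInitialValue T u x) (h' : HasInitialValue T u' x') :
    HasInitialValue T (u + u') (x + x') := by
  obtain ⟨v, hv, huv, rfl⟩ := h
  obtain ⟨w, hw, huw, rfl⟩ := h'
  refine ⟨v + w, hv.add hw, ?_, rfl⟩
  filter_upwards [Lp.coeFn_add u u', huv, huw] with t h1 h2 h3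
  rw [h1, Pi.add_apply, Pi.add_apply, h2, h3]

theorem HasInitialValue.smul (c : ℂ) (h : HasInitialValue T u x) :
    HasInitialValue T (c • u) (c • x) := by
  obtain ⟨v, hv, huv, rfl⟩ := h
  refine ⟨c • v, hv.const_smul c, ?_, rfl⟩
  filter_upwards [Lp.coeFn_smul c u, huv] with t h1 h2
  rw [h1, Pi.smul_apply, Pi.smul_apply, h2]

variable [CompleteSpace E] [TopologicalSpace.SeparableSpace E] {H : E →ₗ.[ℂ] E}
  {B : ℝ → E →L[ℂ] E} {f f' : L2I E T}

/-- Since `D(H)` is dense, the test functions `η(t) x` with `x ∈ D(H)` determine the right-hand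
side. -/
theorem WeakEq.unique (hH : IsSelfAdjoint H) (h : WeakEq T H B u f) (h' : WeakEq T H B u f') :
    f = f' := by
  have : SecondCountableTopology E := UniformSpace.secondCountable_of_separable E
  have hD : ∀ x : H.domain, ∀ᵐ t ∂volume.restrict (Ioo 0 T), ⟪f t - f' t, (x : E)⟫_ℂ = 0 := by
    intro x
    have i1 : ∀ (η : ℝ → ℝ) (hη : Continuous η) (g : L2I E T),
        IntegrableOn (fun t => (η t : ℂ) * ⟪g t, (x : E)⟫_ℂ) (Ioo 0 T) := by
      intro η hη g
      have h3 := integrable_inner_of_continuous g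
        (show Continuous fun t => (η t : ℂ) • (x : E) by fun_prop)
      simpa only [inner_smul_right] using h3
    have hloc : IntegrableOn (fun t => ⟪f t - f' t, (x : E)⟫_ℂ) (Ioo 0 T) := by
      simp only [inner_sub_left]
      exact (integrableOn_inner_const f _).sub (integrableOn_inner_const f' _)
    have h1 := isOpen_Ioo.ae_eq_zero_of_integral_contDiff_smul_eq_zero (U := Ioo 0 T)
      hloc.locallyIntegrableOn fun η hη hc hs => ?_
    · exact (ae_restrict_iff' measurableSet_Ioo).2 h1
    · have hη1 : ContDiff ℝ 1 η := hη.of_le (by norm_cast)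
      have ht := isTestFunction_smul hη1 hc hs x
      have h2 := (h _ ht).symm.trans (h' _ ht)
      simp only [Submodule.coe_smul, inner_smul_right] at h2
      rw [← setIntegral_eq_integral_of_forall_compl_eq_zero (s := Ioo 0 T)]
      · simp only [inner_sub_left, smul_sub, Complex.real_smul]
        rw [integral_sub (i1 η hη.continuous f) (i1 η hη.continuous f'), h2, sub_self]
      · intro t ht'
        rw [image_eq_zero_of_notMem_tsupport fun h => ht' (hs h), zero_smul]
  -- pass from `D(H)` to arbitrary vectors by means of the regularizations
  refine Lp.ext ?_
  have h3 : (fun t => f t - f' t) =ᵐ[volume.restrict (Ioo 0 T)] 0 := by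
    refine ae_eq_zero_of_forall_inner (𝕜 := ℂ) fun y => ?_
    have h4 : ∀ᵐ t ∂volume.restrict (Ioo 0 T), ∀ n : ℕ,
        ⟪f t - f' t, yosida H (n + 1) y⟫_ℂ = 0 :=
      ae_all_iff.2 fun n => hD ⟨_, yosida_mem_domain hH (by positivity) y⟩
    filter_upwards [h4] with t ht
    have h5 : Tendsto (fun n : ℕ => ⟪f t - f' t, yosida H (n + 1) y⟫_ℂ) atTop
        (𝓝 ⟪f t - f' t, y⟫_ℂ) := tendsto_const_nhds.inner (tendsto_yosida_natCast hH y)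
    simp only [ht] at h5
    rw [← inner_conj_symm, ← tendsto_nhds_unique tendsto_const_nhds h5, map_zero]
    rfl
  filter_upwards [h3] with t ht
  exact sub_eq_zero.1 ht

theorem WeakEq.schrodingerOp_eq (hH : IsSelfAdjoint H) (h : WeakEq T H B u f) :
    schrodingerOp T H B u = f := by
  have hex : ∃ f, WeakEq T H B u f := ⟨f, h⟩
  rw [schrodingerOp, dif_pos hex]
  exact hex.choose_spec.unique hH h

end Uniqueness

/-! ### Bounded time-dependent perturbations -/

section Family

variable {E : Type*} [NormedAddCommGroup E] [InnerProductSpace ℂ E] [CompleteSpace E] {T : ℝ}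
  {H : E →ₗ.[ℂ] E} {B : ℝ → E →L[ℂ] E} {u u' f f' w : L2I E T}

theorem IsStronglyContinuousFamily.exists_bound (hB : IsStronglyContinuousFamily T B) :
    ∃ M : ℝ, ∀ t ∈ Icc 0 T, ‖B t‖ ≤ M := by
  obtain ⟨M, hM⟩ := banach_steinhaus (g := fun t : Icc (0 : ℝ) T => B t) fun x => by
    obtain ⟨C, hC⟩ := isCompact_Icc.exists_bound_of_continuousOn (hB.continuousOn x)
    exact ⟨C, fun t => hC t t.2⟩
  exact ⟨M, fun t ht => hM ⟨t, ht⟩⟩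

theorem IsStronglyContinuousFamily.zero (T : ℝ) :
    IsStronglyContinuousFamily T (fun _ => (0 : E →L[ℂ] E)) :=
  ⟨fun _ => continuousOn_const, fun _ _ => IsSelfAdjoint.zero _⟩

theorem IsStronglyContinuousFamily.continuousOn_apply (hB : IsStronglyContinuousFamily T B)
    {v : ℝ → E} (hv : Continuous v) : ContinuousOn (fun t => B t (v t)) (Icc 0 T) := by
  obtain ⟨M, hM⟩ := hB.exists_bound
  intro s hs
  refine tendsto_iff_norm_sub_tendsto_zero.2 ?_
  have h1 : Tendsto (fun t => M * ‖v t - v s‖ + ‖B t (v s) - B s (v s)‖) (𝓝[Icc 0 T] s)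
      (𝓝 (M * 0 + 0)) :=
    ((tendsto_iff_norm_sub_tendsto_zero.1 hv.continuousWithinAt).const_mul M).add
      (tendsto_iff_norm_sub_tendsto_zero.1 (hB.continuousOn (v s) s hs))
  rw [mul_zero, add_zero] at h1
  refine squeeze_zero' (Eventually.of_forall fun _ => norm_nonneg _) ?_ h1
  filter_upwards [self_mem_nhdsWithin] with t ht
  have h2 : B t (v t) - B s (v s) = B t (v t - v s) + (B t (v s) - B s (v s)) := by
    rw [map_sub]; abel
  rw [h2]
  exact (norm_add_le _ _).trans (add_le_add_left ((B t).le_of_opNorm_le (hM t ht) _) _)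

/-- For a strongly continuous family `B` and `u` with a continuous representative, `B u` is an
element of `L²(I, E)`. -/
theorem IsStronglyContinuousFamily.exists_apply (hT : 0 < T) (hB : IsStronglyContinuousFamily T B)
    {v : ℝ → E} (hv : Continuous v) (huv : u =ᵐ[volume.restrict (Ioo 0 T)] v) :
    ∃ w : L2I E T, (w =ᵐ[volume.restrict (Ioo 0 T)] fun t => B t (u t)) ∧
      ∀ M : ℝ, (∀ t ∈ Icc 0 T, ‖B t‖ ≤ M) → ‖w‖ ≤ M * ‖u‖ := by
  obtain ⟨q, hq, hqB⟩ := exists_continuous_eqOn_Icc hT (hB.continuousOn_apply hv)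
  have hqL := memLp_Ioo_of_continuous (T := T) hq
  have h1 : hqL.toLp q =ᵐ[volume.restrict (Ioo 0 T)] fun t => B t (u t) := by
    filter_upwards [hqL.coeFn_toLp, huv, ae_restrict_mem measurableSet_Ioo] with t e1 e2 ht
    rw [e1, e2, hqB (Ioo_subset_Icc_self ht)]
  refine ⟨hqL.toLp q, h1, fun M hM => Lp.norm_le_mul_norm_of_ae_le_mul ?_⟩
  filter_upwards [h1, ae_restrict_mem measurableSet_Ioo] with t e ht
  rw [e]
  exact (B t).le_of_opNorm_le (hM t (Ioo_subset_Icc_self ht)) _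

theorem IsStronglyContinuousFamily.integrableOn_inner (hT : 0 < T)
    (hB : IsStronglyContinuousFamily T B) (u : L2I E T) {g : ℝ → E} (hg : Continuous g) :
    IntegrableOn (fun t => ⟪u t, B t (g t)⟫_ℂ) (Ioo 0 T) := by
  obtain ⟨q, hq, hqB⟩ := exists_continuous_eqOn_Icc hT (hB.continuousOn_apply hg)
  refine (integrable_inner_of_continuous u hq).congr ?_
  filter_upwards [ae_restrict_mem measurableSet_Ioo] with t ht
  rw [hqB (Ioo_subset_Icc_self ht)]

theorem IsTestFunction.integrableOn_inner (hT : 0 < T) (hB : IsStronglyContinuousFamily T B)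
    (u : L2I E T) {φ : ℝ → H.domain} (hφ : IsTestFunction T H φ) :
    IntegrableOn (fun t => ⟪u t, Complex.I • deriv (fun s => (φ s : E)) t - H (φ t)
      - B t (φ t)⟫_ℂ) (Ioo 0 T) := by
  refine ((integrable_inner_of_continuous u hφ.continuous_deriv_sub).sub
    (hB.integrableOn_inner hT u hφ.contDiff.continuous)).congr
    (Eventually.of_forall fun t => ?_)
  simp only [Pi.sub_apply]
  rw [← inner_sub_right, zero_apply, sub_zero]

theorem WeakEq.add (hT : 0 < T) (hB : IsStronglyContinuousFamily T B) (h : WeakEq T H B u f)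
    (h' : WeakEq T H B u' f') : WeakEq T H B (u + u') (f + f') := by
  intro φ hφ
  have h1 := integral_add (hφ.integrableOn_inner hT hB u) (hφ.integrableOn_inner hT hB u')
  have h2 := integral_add (integrable_inner_of_continuous f hφ.contDiff.continuous)
    (integrable_inner_of_continuous f' hφ.contDiff.continuous)
  rw [h φ hφ, h' φ hφ, ← h2] at h1
  refine Eq.trans (integral_congr_ae ?_) (h1.trans (integral_congr_ae ?_))
  · filter_upwards [Lp.coeFn_add u u'] with t ht
    rw [ht, Pi.add_apply, inner_add_left]
  · filter_upwards [Lp.coeFn_add f f'] with t ht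
    rw [ht, Pi.add_apply, inner_add_left]

omit [CompleteSpace E] in
theorem WeakEq.smul (c : ℂ) (h : WeakEq T H B u f) : WeakEq T H B (c • u) (c • f) := by
  intro φ hφ
  have h1 := congrArg (fun z => conj c * z) (h φ hφ)
  simp only [← integral_const_mul] at h1
  refine Eq.trans (integral_congr_ae ?_) (h1.trans (integral_congr_ae ?_))
  · filter_upwards [Lp.coeFn_smul c u] with t ht
    rw [ht, Pi.smul_apply, inner_smul_left]
  · filter_upwards [Lp.coeFn_smul c f] with t ht
    rw [ht, Pi.smul_apply, inner_smul_left]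

/-- The bounded term `B u` can be moved to the right-hand side of the equation. -/
theorem WeakEq.sub_apply (hT : 0 < T) (hB : IsStronglyContinuousFamily T B)
    (h : WeakEq T H (fun _ => 0) u f) (hw : w =ᵐ[volume.restrict (Ioo 0 T)] fun t => B t (u t)) :
    WeakEq T H B u (f - w) := by
  intro φ hφ
  have i1 := integrable_inner_of_continuous u hφ.continuous_deriv_sub
  have i2 := hB.integrableOn_inner hT u hφ.contDiff.continuous
  have i3 := integrable_inner_of_continuous f hφ.contDiff.continuous
  have i4 := integrable_inner_of_continuous w hφ.contDiff.continuous
  have h2 : ∫ t in Ioo 0 T, ⟪u t, B t (φ t)⟫_ℂ = ∫ t in Ioo 0 T, ⟪w t, (φ t : E)⟫_ℂ := by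
    refine integral_congr_ae ?_
    filter_upwards [hw, ae_restrict_mem measurableSet_Ioo] with t e ht
    rw [e]
    exact ((hB.selfAdjoint t (Ioo_subset_Icc_self ht)).isSymmetric (u t) (φ t)).symm
  have h3 := congrArg₂ (· - ·) (h φ hφ) h2
  simp only at h3
  refine Eq.trans ?_ (Eq.trans ((integral_sub i1 i2).trans h3) (Eq.trans
    (integral_sub i3 i4).symm ?_))
  · refine integral_congr_ae (Eventually.of_forall fun t => ?_)
    simp only
    rw [← inner_sub_right, zero_apply, sub_zero]
  · refine integral_congr_ae ?_
    filter_upwards [Lp.coeFn_sub f w] with t e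
    rw [e, Pi.sub_apply, inner_sub_left]

end Family

/-! ### Comparison of the norms -/

section Norms

variable {E : Type*} [NormedAddCommGroup E] [InnerProductSpace ℂ E] {T : ℝ}
  (H : E →ₗ.[ℂ] E) (B : ℝ → E →L[ℂ] E) (u : L2I E T)

theorem energyNorm_nonneg : 0 ≤ energyNorm T H B u := Real.sqrt_nonneg _

theorem norm_initialValue_le (hT : 0 < T) : ‖initialValue T u‖ ≤ energyNorm T H B u :=
  Real.le_sqrt_of_sq_le (le_add_of_nonneg_right (by positivity))

theorem sqrt_mul_norm_schrodingerOp_le (hT : 0 < T) :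
    √T * ‖schrodingerOp T H B u‖ ≤ energyNorm T H B u := by
  refine Real.le_sqrt_of_sq_le ?_
  rw [mul_pow, Real.sq_sqrt hT.le]
  exact le_add_of_nonneg_left (by positivity)

theorem energyNorm_le_add (hT : 0 < T) :
    energyNorm T H B u ≤ ‖initialValue T u‖ + √T * ‖schrodingerOp T H B u‖ := by
  refine Real.sqrt_le_iff.2 ⟨by positivity, ?_⟩
  have h : T = √T ^ 2 := (Real.sq_sqrt hT.le).symm
  nth_rewrite 2 [h]
  have h2 : 0 ≤ ‖initialValue T u‖ * (√T * ‖schrodingerOp T H B u‖) := by positivity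
  nlinarith

end Norms

section Comparison

variable {E : Type*} [NormedAddCommGroup E] [InnerProductSpace ℂ E] [CompleteSpace E]
  [TopologicalSpace.SeparableSpace E] {T : ℝ} {H H' A : E →ₗ.[ℂ] E} {B : ℝ → E →L[ℂ] E}
  {u : L2I E T} {c ε : ℝ}

theorem exists_continuous_of_mem_XX (hH : IsSelfAdjoint H) (hT : 0 < T) (hu : u ∈ XX T H) :
    ∃ v : ℝ → E, Continuous v ∧ u =ᵐ[volume.restrict (Ioo 0 T)] v ∧ v 0 = initialValue T u ∧
      WeakEq T H (fun _ => 0) u (schrodingerOp T H (fun _ => 0) u) := by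
  obtain ⟨x, f, hf, hx⟩ := hu
  obtain ⟨v, hv, huv, hv0⟩ := hx.exists_continuous hT
  refine ⟨v, hv, huv, ?_, ?_⟩
  · rw [hv0, hx.initialValue_eq hT]
  · rwa [hf.schrodingerOp_eq hH]

theorem exists_weakEq_of_mem_XX (hH : IsSelfAdjoint H) (hT : 0 < T) (hu : u ∈ XX T H)
    (hB : IsStronglyContinuousFamily T B) :
    ∃ w : L2I E T, (w =ᵐ[volume.restrict (Ioo 0 T)] fun t => B t (u t)) ∧
      (∀ M : ℝ, (∀ t ∈ Icc 0 T, ‖B t‖ ≤ M) → ‖w‖ ≤ M * ‖u‖) ∧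
      WeakEq T H B u (schrodingerOp T H (fun _ => 0) u - w) := by
  obtain ⟨v, hv, huv, -, h⟩ := exists_continuous_of_mem_XX hH hT hu
  obtain ⟨w, hw, hwM⟩ := hB.exists_apply hT hv huv
  exact ⟨w, hw, hwM, h.sub_apply hT hB hw⟩

theorem weakEq_schrodingerOp (hH : IsSelfAdjoint H) (hT : 0 < T) (hu : u ∈ XX T H)
    (hB : IsStronglyContinuousFamily T B) : WeakEq T H B u (schrodingerOp T H B u) := by
  obtain ⟨w, -, -, h⟩ := exists_weakEq_of_mem_XX hH hT hu hB
  rwa [h.schrodingerOp_eq hH]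

/-- The energy inequality bounds the `L²` norm by each of the norms under consideration: the
self-adjoint operators `B t` do not contribute to the derivative of `‖u‖²`. -/
theorem norm_le_energyNorm (hH : IsSelfAdjoint H) (hT : 0 < T) (hu : u ∈ XX T H)
    (hB : IsStronglyContinuousFamily T B) : ‖u‖ ≤ √T * (3 * energyNorm T H B u) := by
  obtain ⟨v, hv, huv, hv0, h⟩ := exists_continuous_of_mem_XX hH hT hu
  obtain ⟨w, hw, -, hB'⟩ := exists_weakEq_of_mem_XX hH hT hu hB
  set F := schrodingerOp T H (fun _ => 0) u
  have hop : schrodingerOp T H B u = F - w := hB'.schrodingerOp_eq hH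
  have hsup : ∀ t ∈ Icc 0 T, ‖v t‖ ≤ 3 * energyNorm T H B u := by
    intro t ht
    have h1 := h.norm_le hH hT hv huv (F - w) (by
      filter_upwards [hw, huv, Lp.coeFn_sub F w, ae_restrict_mem measurableSet_Ioo]
        with s e1 e2 e3 hs
      have hs' := (hB.selfAdjoint s (Ioo_subset_Icc_self hs)).isSymmetric (v s) (v s)
      have hc : conj ⟪v s, B s (v s)⟫_ℂ = ⟪v s, B s (v s)⟫_ℂ := by
        rw [inner_conj_symm]
        exact hs'
      have him := congrArg Complex.im hc
      rw [Complex.conj_im] at him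
      rw [e3, Pi.sub_apply, e1, e2, smul_sub, inner_sub_right, Complex.sub_re,
        inner_smul_right (v s) (B s (v s))]
      simp only [Complex.mul_re, Complex.neg_re, Complex.neg_im, Complex.I_re, Complex.I_im]
      linarith) ht
    rw [hv0, ← hop] at h1
    have h2 := norm_initialValue_le H B u hT
    have h3 := sqrt_mul_norm_schrodingerOp_le H B u hT
    linarith
  have hN := energyNorm_nonneg H B u
  refine le_of_sq_le_sq ?_ (by positivity)
  rw [mul_pow, Real.sq_sqrt hT.le, Lp_norm_sq_eq_integral]
  have h4 : ∫ t in Ioo 0 T, ‖u t‖ ^ 2 ≤ ∫ _ in Ioo 0 T, (3 * energyNorm T H B u) ^ 2 := by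
    refine integral_mono_ae ((Lp.memLp u).integrable_norm_pow (by simp)) (integrable_const _) ?_
    filter_upwards [huv, ae_restrict_mem measurableSet_Ioo] with t e ht
    rw [e]
    exact pow_le_pow_left₀ (norm_nonneg _) (hsup t (Ioo_subset_Icc_self ht)) 2
  refine h4.trans_eq ?_
  simp [Real.volume_real_Ioo_of_le hT.le]

omit [TopologicalSpace.SeparableSpace E] in
theorem IsPerturbation.XX_le (P : IsPerturbation H H' A c ε) (hT : 0 < T) :
    XX T H ≤ XX T H' := by
  rintro u ⟨x, f, hf, hx⟩
  obtain ⟨v, hv, huv, -⟩ := hx.exists_continuous hT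
  obtain ⟨g, -, hg⟩ := P.exists_weakEq hf hT hv huv
  exact ⟨x, f - g, hg, hx⟩

/-- The norms for the unperturbed and for the perturbed operator: the difference of the
right-hand sides is `A u`, which is controlled by the smoothing estimate. -/
theorem IsPerturbation.xxNorm_le (P : IsPerturbation H H' A c ε) (hH' : IsSelfAdjoint H')
    (hT : 0 < T) (hu : u ∈ XX T H) :
    xxNorm T H' u ≤ (2 + c * (1 + 3 * ε + √(2 * ε))) * (1 + T) * xxNorm T H u := by
  have hH := P.selfAdjoint
  have hc := P.nonneg
  have hε := P.pos
  obtain ⟨v, hv, huv, hv0, h⟩ := exists_continuous_of_mem_XX hH hT hu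
  obtain ⟨g, hg, hw⟩ := P.exists_weakEq h hT hv huv
  rw [hv0] at hg
  have h1 := energyNorm_le_add H' (fun _ => 0) u hT
  rw [hw.schrodingerOp_eq hH'] at h1
  have h2 := norm_initialValue_le H (fun _ => 0) u hT
  have h3 := sqrt_mul_norm_schrodingerOp_le H (fun _ => 0) u hT
  have h4 := norm_le_energyNorm hH hT hu (IsStronglyContinuousFamily.zero T)
  have hN := energyNorm_nonneg H (fun _ => 0) u
  change energyNorm T H' (fun _ => 0) u ≤ _ * energyNorm T H (fun _ => 0) u
  set N := energyNorm T H (fun _ => 0) u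
  set F := schrodingerOp T H (fun _ => 0) u
  set s := √T
  have hs : 0 ≤ s := Real.sqrt_nonneg T
  have hs2 : s * s = T := Real.mul_self_sqrt hT.le
  have hs1 : s ≤ 1 + T := by nlinarith [sq_nonneg (s - 1)]
  set r := √(2 * ε)
  have hr : 0 ≤ r := Real.sqrt_nonneg _
  have hr2 : r ^ 2 = 2 * ε := Real.sq_sqrt (by positivity)
  have h5 : ‖F + (Complex.I * ε : ℂ) • u‖ ≤ ‖F‖ + ε * ‖u‖ := by
    refine (norm_add_le _ _).trans_eq ?_
    rw [norm_smul, norm_mul, Complex.norm_I, one_mul, Complex.norm_real, Real.norm_of_nonneg hε.le]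
  have h6 : ‖g‖ ≤ c * (‖F + (Complex.I * ε : ℂ) • u‖ + r * ‖initialValue T u‖) := by
    refine le_of_sq_le_sq (hg.trans ?_) (by positivity)
    rw [mul_pow, ← hr2]
    refine mul_le_mul_of_nonneg_left ?_ (sq_nonneg c)
    have h7 : 0 ≤ ‖F + (Complex.I * ε : ℂ) • u‖ * (r * ‖initialValue T u‖) := by positivity
    nlinarith
  have h8 : s * ‖u‖ ≤ 3 * T * N := by
    refine (mul_le_mul_of_nonneg_left h4 hs).trans_eq ?_
    rw [← hs2]; ring
  have h9 : s * ‖g‖ ≤ c * (N + ε * (3 * T * N) + r * ((1 + T) * N)) := by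
    calc s * ‖g‖ ≤ s * (c * ((‖F‖ + ε * ‖u‖) + r * ‖initialValue T u‖)) :=
          mul_le_mul_of_nonneg_left (h6.trans (by gcongr)) hs
      _ = c * (s * ‖F‖ + ε * (s * ‖u‖) + r * (s * ‖initialValue T u‖)) := by ring
      _ ≤ _ := by gcongr
  have h10 : s * ‖F - g‖ ≤ s * ‖F‖ + s * ‖g‖ := by
    rw [← mul_add]
    exact mul_le_mul_of_nonneg_left (norm_sub_le F g) hs
  have h11 : energyNorm T H' (fun _ => 0) u
      ≤ N + (N + c * (N + ε * (3 * T * N) + r * ((1 + T) * N))) := by linarith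
  refine h11.trans ?_
  have h12 : 0 ≤ c * N * T := by positivity
  have h13 : 0 ≤ c * N * ε := by positivity
  have h14 : 0 ≤ T * N := by positivity
  nlinarith

/-- The bounded family `B` changes the right-hand side by at most `‖B u‖`. -/
theorem energyNorm_le_and_xxNorm_le (hH : IsSelfAdjoint H) (hT : 0 < T) (hu : u ∈ XX T H)
    (hB : IsStronglyContinuousFamily T B) {M : ℝ} (hM : ∀ t ∈ Icc 0 T, ‖B t‖ ≤ M) :
    energyNorm T H B u ≤ 2 * xxNorm T H u + M * (√T * ‖u‖) ∧
      xxNorm T H u ≤ 2 * energyNorm T H B u + M * (√T * ‖u‖) := by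
  obtain ⟨w, -, hwM, hw⟩ := exists_weakEq_of_mem_XX hH hT hu hB
  have h1 : schrodingerOp T H B u = _ := hw.schrodingerOp_eq hH
  have h2 : √T * ‖w‖ ≤ M * (√T * ‖u‖) :=
    (mul_le_mul_of_nonneg_left (hwM M hM) (Real.sqrt_nonneg T)).trans_eq (by ring)
  have h3 := energyNorm_le_add H B u hT
  have h4 := energyNorm_le_add H (fun _ => 0) u hT
  have h5 := norm_initialValue_le H B u hT
  have h6 := norm_initialValue_le H (fun _ => 0) u hT
  have h7 := sqrt_mul_norm_schrodingerOp_le H B u hT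
  have h8 := sqrt_mul_norm_schrodingerOp_le H (fun _ => 0) u hT
  have h9 : ‖schrodingerOp T H B u‖ ≤ ‖schrodingerOp T H (fun _ => 0) u‖ + ‖w‖ := by
    rw [h1]
    exact norm_sub_le _ _
  have h10 : ‖schrodingerOp T H (fun _ => 0) u‖ ≤ ‖schrodingerOp T H B u‖ + ‖w‖ := by
    rw [h1]
    simpa using norm_add_le (schrodingerOp T H (fun _ => 0) u - w) w
  have h11 := mul_le_mul_of_nonneg_left h9 (Real.sqrt_nonneg T)
  have h12 := mul_le_mul_of_nonneg_left h10 (Real.sqrt_nonneg T)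
  rw [mul_add] at h11 h12
  unfold xxNorm
  constructor <;> linarith

/-- `N` is the pullback of the Hilbert space norm of `E × L²(I, E)` under the linear map
`u ↦ (u(0), √T (i∂ₜ - H - B(t)) u)`. -/
theorem exists_seminorm_eq_energyNorm (hH : IsSelfAdjoint H) (hT : 0 < T)
    (hB : IsStronglyContinuousFamily T B) :
    ∃ N : Seminorm ℂ (XX T H), ∀ u, N u = energyNorm T H B u := by
  have hiv : ∀ u : XX T H, HasInitialValue T (u : L2I E T) (initialValue T (u : L2I E T)) := by
    rintro ⟨u, x, f, -, hx⟩
    rwa [hx.initialValue_eq hT]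
  have hop := fun u : XX T H => weakEq_schrodingerOp hH hT u.2 hB
  let L : XX T H →ₗ[ℂ] WithLp 2 (E × L2I E T) :=
    { toFun := fun u => WithLp.toLp 2 (initialValue T (u : L2I E T),
        ((√T : ℝ) : ℂ) • schrodingerOp T H B (u : L2I E T))
      map_add' := fun u u' => by
        rw [Submodule.coe_add, ((hiv u).add (hiv u')).initialValue_eq hT,
          ((hop u).add hT hB (hop u')).schrodingerOp_eq hH, smul_add]
        rfl
      map_smul' := fun a u => by
        rw [Submodule.coe_smul, ((hiv u).smul a).initialValue_eq hT,
          ((hop u).smul a).schrodingerOp_eq hH, smul_comm _ a]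
        rfl }
  refine ⟨(normSeminorm ℂ (WithLp 2 (E × L2I E T))).comp L, fun u => ?_⟩
  change ‖L u‖ = _
  rw [WithLp.prod_norm_eq_of_L2, energyNorm]
  change √(‖initialValue T (u : L2I E T)‖ ^ 2
    + ‖((√T : ℝ) : ℂ) • schrodingerOp T H B (u : L2I E T)‖ ^ 2) = _
  rw [norm_smul, mul_pow, Complex.norm_real, Real.norm_of_nonneg (Real.sqrt_nonneg T),
    Real.sq_sqrt hT.le]

end Comparison

end

end SchrodingerSpaceTime

theorem mainTheorem1 {E : Type*} [NormedAddCommGroup E] [InnerProductSpace ℂ E]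
    [CompleteSpace E] [TopologicalSpace.SeparableSpace E]
    (H₀ A : E →ₗ.[ℂ] E) (hA : SchrodingerSpaceTime.AssumptionsA H₀ A) :
    -- Time-independent case: equality of the spaces, equivalence of the norms.
    ((∀ T : ℝ, 0 < T →
        SchrodingerSpaceTime.XX T (H₀ + A) = SchrodingerSpaceTime.XX T H₀) ∧
      ∃ α C : ℝ, 0 < α ∧ 0 < C ∧ ∀ T : ℝ, 0 < T →
        ∀ u ∈ SchrodingerSpaceTime.XX T H₀,
          α / (1 + T) * SchrodingerSpaceTime.xxNorm T H₀ u
              ≤ SchrodingerSpaceTime.xxNorm T (H₀ + A) u ∧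
            SchrodingerSpaceTime.xxNorm T (H₀ + A) u
              ≤ C * (1 + T) * SchrodingerSpaceTime.xxNorm T H₀ u) ∧
    -- Time-dependent case: `N` is well defined and is a norm on `XX T H₀`.
    (∀ T : ℝ, 0 < T → ∀ B : ℝ → E →L[ℂ] E,
        SchrodingerSpaceTime.IsStronglyContinuousFamily T B →
        (∀ u ∈ SchrodingerSpaceTime.XX T H₀,
          ∃! f, SchrodingerSpaceTime.WeakEq T (H₀ + A) B u f) ∧
        ∃ N : Seminorm ℂ (SchrodingerSpaceTime.XX T H₀),
          (∀ u, N u = SchrodingerSpaceTime.energyNorm T (H₀ + A) B u) ∧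
          ∀ u, N u = 0 → u = 0) ∧
    -- Time-dependent case: equivalence of the norms, with constants that depend on `B` and `T`
    -- only through an upper bound `M` of the norms of the operators `B t`.
    (∀ M : ℝ, ∃ α C : ℝ, 0 < α ∧ 0 < C ∧ ∀ T : ℝ, 0 < T → ∀ B : ℝ → E →L[ℂ] E,
        SchrodingerSpaceTime.IsStronglyContinuousFamily T B →
        (∀ t ∈ Set.Icc 0 T, ‖B t‖ ≤ M) →
        ∀ u ∈ SchrodingerSpaceTime.XX T H₀,
          α / (1 + T) ^ 2 * SchrodingerSpaceTime.xxNorm T H₀ u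
              ≤ SchrodingerSpaceTime.energyNorm T (H₀ + A) B u ∧
            SchrodingerSpaceTime.energyNorm T (H₀ + A) B u
              ≤ C * (1 + T) * SchrodingerSpaceTime.xxNorm T H₀ u) := by
  open SchrodingerSpaceTime in
  obtain ⟨c, ε, P, P'⟩ := hA.exists_isPerturbation
  have hH := P.selfAdjoint
  have hH' := P'.selfAdjoint
  have hXX : ∀ T : ℝ, 0 < T → XX T (H₀ + A) = XX T H₀ := fun T hT =>
    le_antisymm (P'.XX_le hT) (P.XX_le hT)
  have hc := P.nonneg
  have hε := P.pos
  set C : ℝ := 2 + c * (1 + 3 * ε + √(2 * ε))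
  have hC : 0 < C := by positivity
  have hup : ∀ T : ℝ, 0 < T → ∀ u ∈ XX T H₀,
      xxNorm T (H₀ + A) u ≤ C * (1 + T) * xxNorm T H₀ u := fun T hT u hu => P.xxNorm_le hH' hT hu
  have hlow : ∀ T : ℝ, 0 < T → ∀ u ∈ XX T H₀,
      xxNorm T H₀ u ≤ C * (1 + T) * xxNorm T (H₀ + A) u := fun T hT u hu =>
    P'.xxNorm_le hH hT ((hXX T hT).symm ▸ hu)
  refine ⟨⟨hXX, 1 / C, C, by positivity, hC, fun T hT u hu => ⟨?_, hup T hT u hu⟩⟩,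
    fun T hT B hB => ?_, fun M => ?_⟩
  · rw [div_div, div_mul_eq_mul_div, one_mul, div_le_iff₀ (by positivity), mul_comm]
    exact hlow T hT u hu
  · rw [← hXX T hT]
    refine ⟨fun u hu => ⟨_, weakEq_schrodingerOp hH' hT hu hB, fun f hf => hf.unique hH'
      (weakEq_schrodingerOp hH' hT hu hB)⟩, ?_⟩
    obtain ⟨N, hN⟩ := exists_seminorm_eq_energyNorm hH' hT hB
    refine ⟨N, hN, fun u hu => ?_⟩
    have h1 := norm_le_energyNorm hH' hT u.2 hB
    rw [← hN, hu, mul_zero, mul_zero] at h1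
    exact Subtype.ext (norm_le_zero_iff.1 h1)
  · -- a negative `M` is not an upper bound, but the constants have to be positive for it as well
    refine ⟨1 / (C * (2 + 3 * |M|)), 2 * C + 3 * |M|, by positivity, by positivity,
      fun T hT B hB hM u hu => ?_⟩
    have hM' : ∀ t ∈ Set.Icc 0 T, ‖B t‖ ≤ |M| := fun t ht => (hM t ht).trans (le_abs_self M)
    have hu' : u ∈ XX T (H₀ + A) := (hXX T hT).symm ▸ hu
    obtain ⟨h1, h2⟩ := energyNorm_le_and_xxNorm_le hH' hT hu' hB hM'
    have h3 := norm_le_energyNorm hH hT hu (IsStronglyContinuousFamily.zero T)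
    have h4 := norm_le_energyNorm hH' hT hu' hB
    have h5 := hup T hT u hu
    have h6 := hlow T hT u hu
    have hsq : ∀ {N : ℝ}, ‖u‖ ≤ √T * (3 * N) → √T * ‖u‖ ≤ 3 * T * N := fun {N} h => by
      refine (mul_le_mul_of_nonneg_left h (Real.sqrt_nonneg T)).trans_eq ?_
      rw [← mul_assoc, Real.mul_self_sqrt hT.le]
      ring
    have h7 := mul_le_mul_of_nonneg_left (hsq h3) (abs_nonneg M)
    have h8 := mul_le_mul_of_nonneg_left (hsq h4) (abs_nonneg M)
    have hX : 0 ≤ xxNorm T H₀ u := energyNorm_nonneg ..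
    have hN : 0 ≤ energyNorm T (H₀ + A) B u := energyNorm_nonneg ..
    change |M| * (√T * ‖u‖) ≤ |M| * (3 * T * xxNorm T H₀ u) at h7
    constructor
    · rw [div_div, div_mul_eq_mul_div, one_mul, div_le_iff₀ (by positivity)]
      have h9 : xxNorm T (H₀ + A) u
          ≤ (2 + 3 * |M|) * (1 + T) * energyNorm T (H₀ + A) B u := by
        have h10 : 0 ≤ |M| * energyNorm T (H₀ + A) B u := by positivity
        have h11 : 0 ≤ T * energyNorm T (H₀ + A) B u := by positivity
        nlinarith
      refine h6.trans ((mul_le_mul_of_nonneg_left h9 (by positivity)).trans_eq ?_)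
      ring
    · have h9 : 0 ≤ |M| * xxNorm T H₀ u := by positivity
      nlinarith
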